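/- Let $N\ge 1$, let $\Omega\subset\mathbb R^N$ be open and bounded with smooth boundary (near each boundary point $\Omega$ is $\{g<0\}$ for a smooth $g$ with nonvanishing gradient there), let $\nu(\xi)$ be the exterior unit normal at $\xi\in\partial\Omega$ and $d\xi$ the surface measure on $\partial\Omega$, and let $T>0$. Let $u_o\in L^\infty(\Omega;\mathbb R)$ and $u_b\in L^\infty([0,T]\times\partial\Omega;\mathbb R)$. Let $f\in C^2([0,T]\times\overline\Omega\times\mathbb R;\mathbb R^N)$ with $\operatorname{div}\partial_u f$ bounded on $[0,T]\times\Omega\times\mathbb R$, and let $F\in C^2([0,T]\times\overline\Omega\times\mathbb R;\mathbb R)$ with $\partial_uF$ bounded on $[0,T]\times\Omega\times\mathbb R$. Here $\operatorname{div}$ and $\nabla$ act on the explicit variable $x$ only. Consider the problem $\partial_t u+\nabla\cdot f(t,x,u)=F(t,x,u)$ in $[0,T]\times\Omega$, $u(0,\cdot)=u_o$ on $\Omega$, $u=u_b$ on $[0,T]\times\partial\Omega$. For $u\in L^\infty([0,T]\times\Omega;\mathbb R)$ put $U=\|u\|_{L^\infty([0,T]\times\Omega)}$ and $L=\sup\{|\partial_uf(t,x,z)|: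 t\in[0,T],\,x\in\Omega,\,|z|\le U\}$. Test functions are the nonnegative $\phi\in C^1_c(\,]-\infty,T[\,\times\mathbb R^N)$. Put $s^+=\max\{s,0\}$, $s^-=\max\{-s,0\}$; $\operatorname{sgn}^+(s)=1$ if $s>0$ and $0$ otherwise; $\operatorname{sgn}^-(s)=-1$ if $s<0$ and $0$ otherwise. A boundary entropy--entropy flux pair is a pair $(H,Q)\in C^2(\mathbb R^2;\mathbb R)\times C^2([0,T]\times\overline\Omega\times\mathbb R^2;\mathbb R^N)$ such that $z\mapsto H(z,w)$ is convex, $\partial_zQ(t,x,z,w)=\partial_zH(z,w)\,\partial_uf(t,x,z)$, and $H(w,w)=0$, $Q(t,x,w,w)=0$, $\partial_zH(w,w)=0$, for all $t\in[0,T]$, $x\in\overline\Omega$, $z,w\in\mathbb R$. The function $u\in L^\infty([0,T]\times\Omega;\mathbb R)$ is an RE-solution if for every boundary entropy--entropy flux pair $(H,Q)$, every $k\in\mathbb R$ and every test function $\phi$ \begin{align*} &\int_0^T\!\!\int_\Omega\big[H(u,k)\,\partial_t\phi+Q(t,x,u,k)\cdot\nabla\phi\big]\,dx\,dt +\int_0^T\!\!\int_\Omega\partial_zH(u,k)\,\big[F(t,x,u)-\operatorname{div}f(t,x,u)\big]\phi\,dx\,dt\\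 &+\int_0^T\!\!\int_\Omega\operatorname{div}Q(t,x,u,k)\,\phi\,dx\,dt+\int_\Omega H(u_o,k)\,\phi(0,x)\,dx +L\int_0^T\!\!\int_{\partial\Omega}H(u_b,k)\,\phi\,d\xi\,dt\ \ge 0, \end{align*} and an MV-solution if for every $k\in\mathbb R$, every test function $\phi$ and both choices of the sign $\pm$ \begin{align*} &\int_0^T\!\!\int_\Omega(u-k)^\pm\,\partial_t\phi\,dx\,dt +\int_0^T\!\!\int_\Omega\operatorname{sgn}^\pm(u-k)\,\big(f(t,x,u)-f(t,x,k)\big)\cdot\nabla\phi\,dx\,dt\\ &+\int_0^T\!\!\int_\Omega\operatorname{sgn}^\pm(u-k)\,\big[F(t,x,u)-\operatorname{div}f(t,x,k)\big]\phi\,dx\,dt +\int_\Omega(u_o-k)^\pm\phi(0,x)\,dx +L\int_0^T\!\!\int_{\partial\Omega}(u_b-k)^\pm\phi\,d\xi\,dt\ \ge 0. \end{align*} Define $\mathcal F:[0,T]\times\overline\Omega\times\mathbb R^3\to\mathbb R^N$ by $$\mathcal F(t,x,z,w,k)=\begin{cases}f(t,x,w)-f(t,x,z)& z\le w\le k,\\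 0& w\le z\le k,\\ f(t,x,z)-f(t,x,k)& w\le k\le z,\\ f(t,x,k)-f(t,x,z)& z\le k\le w,\\ 0& k\le z\le w,\\ f(t,x,z)-f(t,x,w)& k\le w\le z.\end{cases}$$ Let $u$ be an RE-solution or an MV-solution. Then $\mathcal F$ is continuous, and for every $\beta\in L^1(]0,T[\times\partial\Omega;\mathbb R)$ with $\beta\ge0$ and every $k\in\mathbb R$ the integral below is well defined (absolutely convergent) for almost every sufficiently small $\rho>0$, the essential limit exists and is finite, and $$\operatorname*{ess\,lim}_{\rho\to0^+}\int_0^T\!\!\int_{\partial\Omega}\mathcal F\big(t,\xi,u(t,\xi-\rho\,\nu(\xi)),u_b(t,\xi),k\big)\cdot\nu(\xi)\,\beta(t,\xi)\,d\xi\,dt\ \ge0 .$$ -/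

import Mathlib

open Set Filter Topology MeasureTheory
open scoped ENNReal ContDiff

noncomputable section

namespace IBVP

/-- The space `ℝ^N` with its Euclidean norm. -/
abbrev Space (N : ℕ) := EuclideanSpace ℝ (Fin N)

/-! ### Domains with smooth boundary -/

/-- `g` is a smooth defining function of the set `Ω` near `ξ`: its gradient does not vanish at `ξ`
and, near `ξ`, the set `Ω` is `{g < 0}`. -/
def IsDefiningFunctionAt {N : ℕ} (Ω : Set (Space N)) (ξ : Space N) (g : Space N → ℝ) : Prop :=
  ContDiff ℝ ∞ g ∧ gradient g ξ ≠ 0 ∧ ∀ᶠ x in 𝓝 ξ, x ∈ Ω ↔ g x < 0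

/-- The boundary of `Ω` is a smooth hypersurface and `Ω` lies locally on one side of it. -/
def HasSmoothBoundary {N : ℕ} (Ω : Set (Space N)) : Prop :=
  ∀ ξ ∈ frontier Ω, ∃ g, IsDefiningFunctionAt Ω ξ g

open Classical in
/-- The exterior unit normal of `Ω` at the boundary point `ξ`, namely `∇g(ξ) / |∇g(ξ)|` for a smooth
defining function `g`; it does not depend on the choice of `g`, see `outerNormal_eq`. -/
def outerNormal {N : ℕ} (Ω : Set (Space N)) (ξ : Space N) : Space N :=
  if h : ξ ∈ frontier Ω ∧ ∃ g, IsDefiningFunctionAt Ω ξ g then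
    ‖gradient h.2.choose ξ‖⁻¹ • gradient h.2.choose ξ
  else 0

/-- The surface measure of `∂Ω`: the `(N-1)`-dimensional Hausdorff measure, normalised as in
Euclidean geometry (for `N = 1` it counts the boundary points). -/
def surfaceMeasure {N : ℕ} (Ω : Set (Space N)) : Measure (Space N) :=
  (Measure.euclideanHausdorffMeasure (N - 1) : Measure (Space N)).restrict (frontier Ω)

/-- Lebesgue measure on `[0,T] × Ω`. -/
def cylinderMeasure {N : ℕ} (T : ℝ) (Ω : Set (Space N)) : Measure (ℝ × Space N) :=
  (volume : Measure (ℝ × Space N)).restrict (Icc 0 T ×ˢ Ω)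

/-- The product of Lebesgue measure on `[0,T]` and the surface measure of `∂Ω`. -/
def lateralMeasure {N : ℕ} (T : ℝ) (Ω : Set (Space N)) : Measure (ℝ × Space N) :=
  ((volume : Measure ℝ).restrict (Icc 0 T)).prod (surfaceMeasure Ω)

/-! ### Derivatives -/

/-- The divergence of a vector field on `ℝ^N`. -/
def divergence {N : ℕ} (V : Space N → Space N) (x : Space N) : ℝ :=
  ∑ i, (fderiv ℝ V x (EuclideanSpace.single i 1)) i

/-- `∂_t φ (t,x)`. -/
def timeDeriv {N : ℕ} (φ : ℝ × Space N → ℝ) (p : ℝ × Space N) : ℝ :=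
  deriv (fun s => φ (s, p.2)) p.1

/-- `∇ φ (t,x)`, the gradient in the space variable. -/
def spaceGrad {N : ℕ} (φ : ℝ × Space N → ℝ) (p : ℝ × Space N) : Space N :=
  gradient (fun y => φ (p.1, y)) p.2

/-- `∂_u f (t,x,z)`. -/
def stateDeriv {N : ℕ} (f : ℝ → Space N → ℝ → Space N) (t : ℝ) (x : Space N) (z : ℝ) : Space N :=
  deriv (fun y => f t x y) z

/-! ### Data of the problem -/

/-- The assumption on the flux: `f` is of class `C²` on `[0,T] × closure Ω × ℝ` and
`div ∂_u f` is bounded on `[0,T] × Ω × ℝ`. (That `∂_u f` is locally bounded follows from the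
regularity of `f`.) -/
structure IsFlux {N : ℕ} (T : ℝ) (Ω : Set (Space N)) (f : ℝ → Space N → ℝ → Space N) : Prop where
  contDiffOn : ContDiffOn ℝ 2 (fun p : ℝ × Space N × ℝ => f p.1 p.2.1 p.2.2)
    (Icc 0 T ×ˢ closure Ω ×ˢ univ)
  div_bounded : ∃ C : ℝ, ∀ t ∈ Icc 0 T, ∀ x ∈ Ω, ∀ z : ℝ,
    |divergence (fun y => stateDeriv f t y z) x| ≤ C

/-- The assumption on the source: `F` is of class `C²` on `[0,T] × closure Ω × ℝ` and
`∂_u F` is bounded on `[0,T] × Ω × ℝ`. -/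
structure IsSource {N : ℕ} (T : ℝ) (Ω : Set (Space N)) (F : ℝ → Space N → ℝ → ℝ) : Prop where
  contDiffOn : ContDiffOn ℝ 2 (fun p : ℝ × Space N × ℝ => F p.1 p.2.1 p.2.2)
    (Icc 0 T ×ˢ closure Ω ×ˢ univ)
  deriv_bounded : ∃ C : ℝ, ∀ t ∈ Icc 0 T, ∀ x ∈ Ω, ∀ z : ℝ, |deriv (fun y => F t x y) z| ≤ C

/-- Nonnegative test functions of class `C¹` with compact support in `]-∞,T[ × ℝ^N`. -/
structure IsTestFunction {N : ℕ} (T : ℝ) (φ : ℝ × Space N → ℝ) : Prop where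
  contDiff : ContDiff ℝ 1 φ
  hasCompactSupport : HasCompactSupport φ
  tsupport_subset : tsupport φ ⊆ Iio T ×ˢ univ
  nonneg : ∀ p, 0 ≤ φ p

/-- `‖u‖` in `L^∞([0,T] × Ω)`. -/
def supNorm {N : ℕ} (T : ℝ) (Ω : Set (Space N)) (u : ℝ → Space N → ℝ) : ℝ :=
  (eLpNorm (Function.uncurry u) ∞ (cylinderMeasure T Ω)).toReal

/-- The constant `‖∂_u f‖` in `L^∞([0,T] × Ω × [-U,U])` with `U = ‖u‖` in `L^∞([0,T] × Ω)`. As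
`∂_u f` is continuous, the norm is written as a supremum, which is also meaningful for `U = 0`. -/
def lipConst {N : ℕ} (T : ℝ) (Ω : Set (Space N)) (f : ℝ → Space N → ℝ → Space N)
    (u : ℝ → Space N → ℝ) : ℝ :=
  sSup ((fun p : ℝ × Space N × ℝ => ‖stateDeriv f p.1 p.2.1 p.2.2‖) ''
    (Icc 0 T ×ˢ Ω ×ˢ Icc (-supNorm T Ω u) (supNorm T Ω u)))

/-! ### Regular entropy solutions -/

/-- Boundary entropy--entropy flux pairs `(H,Q)` with respect to `f`. -/
structure IsBoundaryEntropyPair {N : ℕ} (T : ℝ) (Ω : Set (Space N))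
    (f : ℝ → Space N → ℝ → Space N) (H : ℝ → ℝ → ℝ) (Q : ℝ → Space N → ℝ → ℝ → Space N) :
    Prop where
  contDiff : ContDiff ℝ 2 (fun p : ℝ × ℝ => H p.1 p.2)
  contDiffOn : ContDiffOn ℝ 2 (fun p : ℝ × Space N × ℝ × ℝ => Q p.1 p.2.1 p.2.2.1 p.2.2.2)
    (Icc 0 T ×ˢ closure Ω ×ˢ univ ×ˢ univ)
  convex : ∀ w, ConvexOn ℝ univ (fun z => H z w)
  compatible : ∀ t ∈ Icc 0 T, ∀ x ∈ closure Ω, ∀ z w : ℝ,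
    deriv (fun y => Q t x y w) z = deriv (fun y => H y w) z • stateDeriv f t x z
  entropy_diag : ∀ w, H w w = 0
  flux_diag : ∀ t ∈ Icc 0 T, ∀ x ∈ closure Ω, ∀ w : ℝ, Q t x w w = 0
  deriv_diag : ∀ w, deriv (fun y => H y w) w = 0

/-- Regular entropy solutions (RE-solutions) on `[0,T]` of the initial--boundary value problem
`∂_t u + div f(t,x,u) = F(t,x,u)`, `u(0,·) = u₀` on `Ω`, `u = u_b` on `∂Ω`. -/
structure IsRESolution {N : ℕ} (T : ℝ) (Ω : Set (Space N)) (f : ℝ → Space N → ℝ → Space N)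
    (F : ℝ → Space N → ℝ → ℝ) (u₀ : Space N → ℝ) (ub : ℝ → Space N → ℝ)
    (u : ℝ → Space N → ℝ) : Prop where
  memLp : MemLp (Function.uncurry u) ∞ (cylinderMeasure T Ω)
  entropy_ineq : ∀ (H : ℝ → ℝ → ℝ) (Q : ℝ → Space N → ℝ → ℝ → Space N),
    IsBoundaryEntropyPair T Ω f H Q → ∀ (k : ℝ) (φ : ℝ × Space N → ℝ), IsTestFunction T φ →
    0 ≤ (∫ p, (H (u p.1 p.2) k * timeDeriv φ p
            + inner ℝ (Q p.1 p.2 (u p.1 p.2) k) (spaceGrad φ p)) ∂(cylinderMeasure T Ω))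
      + (∫ p, deriv (fun z => H z k) (u p.1 p.2)
            * (F p.1 p.2 (u p.1 p.2) - divergence (fun y => f p.1 y (u p.1 p.2)) p.2)
            * φ p ∂(cylinderMeasure T Ω))
      + (∫ p, divergence (fun y => Q p.1 y (u p.1 p.2) k) p.2 * φ p ∂(cylinderMeasure T Ω))
      + (∫ x in Ω, H (u₀ x) k * φ (0, x))
      + lipConst T Ω f u * ∫ p, H (ub p.1 p.2) k * φ p ∂(lateralMeasure T Ω)

/-! ### Semi-entropy solutions -/

/-- `sgn⁺`. -/
def sgnPlus (s : ℝ) : ℝ := if 0 < s then 1 else 0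

/-- `sgn⁻`. -/
def sgnMinus (s : ℝ) : ℝ := if s < 0 then -1 else 0

/-- `s⁺`. -/
def plusPart (s : ℝ) : ℝ := max s 0

/-- `s⁻`. -/
def minusPart (s : ℝ) : ℝ := max (-s) 0

/-- The integral inequality of semi-entropy solutions, for one choice of sign: `part` is
`s ↦ s^±` and `sg` is `sgn^±`. -/
def SemiEntropyInequality {N : ℕ} (part sg : ℝ → ℝ) (T : ℝ) (Ω : Set (Space N))
    (f : ℝ → Space N → ℝ → Space N) (F : ℝ → Space N → ℝ → ℝ) (u₀ : Space N → ℝ)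
    (ub : ℝ → Space N → ℝ) (u : ℝ → Space N → ℝ) (k : ℝ) (φ : ℝ × Space N → ℝ) : Prop :=
  0 ≤ (∫ p, part (u p.1 p.2 - k) * timeDeriv φ p ∂(cylinderMeasure T Ω))
    + (∫ p, sg (u p.1 p.2 - k)
          * inner ℝ (f p.1 p.2 (u p.1 p.2) - f p.1 p.2 k) (spaceGrad φ p) ∂(cylinderMeasure T Ω))
    + (∫ p, sg (u p.1 p.2 - k)
          * (F p.1 p.2 (u p.1 p.2) - divergence (fun y => f p.1 y k) p.2)
          * φ p ∂(cylinderMeasure T Ω))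
    + (∫ x in Ω, part (u₀ x - k) * φ (0, x))
    + lipConst T Ω f u * ∫ p, part (ub p.1 p.2 - k) * φ p ∂(lateralMeasure T Ω)

/-- Semi-entropy solutions (MV-solutions) on `[0,T]` of the same initial--boundary value
problem. -/
structure IsMVSolution {N : ℕ} (T : ℝ) (Ω : Set (Space N)) (f : ℝ → Space N → ℝ → Space N)
    (F : ℝ → Space N → ℝ → ℝ) (u₀ : Space N → ℝ) (ub : ℝ → Space N → ℝ)
    (u : ℝ → Space N → ℝ) : Prop where
  memLp : MemLp (Function.uncurry u) ∞ (cylinderMeasure T Ω)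
  plus_ineq : ∀ (k : ℝ) (φ : ℝ × Space N → ℝ), IsTestFunction T φ →
    SemiEntropyInequality plusPart sgnPlus T Ω f F u₀ ub u k φ
  minus_ineq : ∀ (k : ℝ) (φ : ℝ × Space N → ℝ), IsTestFunction T φ →
    SemiEntropyInequality minusPart sgnMinus T Ω f F u₀ ub u k φ

/-! ### The boundary flux and the essential limit -/

/-- The function `𝓕(t,x,z,w,k)`, defined by the relative order of `z`, `w` and `k`; the six
cases overlap consistently, see `boundaryFlux_cases`. -/
def boundaryFlux {N : ℕ} (f : ℝ → Space N → ℝ → Space N) (t : ℝ) (x : Space N) (z w k : ℝ) :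
    Space N :=
  if z ≤ w ∧ w ≤ k then f t x w - f t x z
  else if w ≤ z ∧ z ≤ k then 0
  else if w ≤ k ∧ k ≤ z then f t x z - f t x k
  else if z ≤ k ∧ k ≤ w then f t x k - f t x z
  else if k ≤ z ∧ z ≤ w then 0
  else f t x z - f t x w

/-- The filter of the essential limit `ρ → 0+`: right neighbourhoods of `0` up to null sets. -/
def essRightZero : Filter ℝ := 𝓝[>] (0 : ℝ) ⊓ ae (volume : Measure ℝ)

/-! ### Consistency of the definitions -/

theorem boundaryFlux_cases {N : ℕ} (f : ℝ → Space N → ℝ → Space N) (t : ℝ) (x : Space N)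
    (z w k : ℝ) :
    (z ≤ w → w ≤ k → boundaryFlux f t x z w k = f t x w - f t x z) ∧
    (w ≤ z → z ≤ k → boundaryFlux f t x z w k = 0) ∧
    (w ≤ k → k ≤ z → boundaryFlux f t x z w k = f t x z - f t x k) ∧
    (z ≤ k → k ≤ w → boundaryFlux f t x z w k = f t x k - f t x z) ∧
    (k ≤ z → z ≤ w → boundaryFlux f t x z w k = 0) ∧
    (k ≤ w → w ≤ z → boundaryFlux f t x z w k = f t x z - f t x w) := by
  refine ⟨?_, ?_, ?_, ?_, ?_, ?_⟩ <;> intro h₁ h₂ <;> unfold boundaryFlux <;>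
    split_ifs <;> grind

theorem eventually_neg_of_inner_neg {N : ℕ} {g : Space N → ℝ} {ξ v : Space N}
    (hg : DifferentiableAt ℝ g ξ) (h0 : g ξ = 0) (hv : inner ℝ (gradient g ξ) v < 0) :
    ∀ᶠ s in 𝓝[>] (0 : ℝ), g (ξ + s • v) < 0 := by
  have h1 : HasDerivAt (fun s : ℝ => g (ξ + s • v)) (inner ℝ (gradient g ξ) v) 0 := by
    have h2 : HasFDerivAt g (InnerProductSpace.toDual ℝ (Space N) (gradient g ξ))
        (ξ + (0 : ℝ) • v) := by
      simpa using hg.hasGradientAt.hasFDerivAt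
    have h3 : HasDerivAt (fun s : ℝ => ξ + s • v) v 0 := by
      simpa using ((hasDerivAt_id (0 : ℝ)).smul_const v).const_add ξ
    have h5 := h2.comp_hasDerivAt (0 : ℝ) h3
    rw [InnerProductSpace.toDual_apply_apply] at h5
    exact h5
  have h4 := h1.tendsto_slope_zero_right
  filter_upwards [h4.eventually_lt_const hv, self_mem_nhdsWithin] with s hs hpos
  simp only [zero_add, zero_smul, add_zero, h0, sub_zero, smul_eq_mul] at hs
  have hpos : 0 < s := hpos
  by_contra hcon
  have : 0 ≤ s⁻¹ * g (ξ + s • v) := mul_nonneg (inv_nonneg.2 hpos.le) (not_lt.1 hcon)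
  linarith

theorem IsDefiningFunctionAt.eq_zero {N : ℕ} {Ω : Set (Space N)} (hΩ : IsOpen Ω) {ξ : Space N}
    (hξ : ξ ∈ frontier Ω) {g : Space N → ℝ} (hg : IsDefiningFunctionAt Ω ξ g) : g ξ = 0 := by
  obtain ⟨hg1, -, hg3⟩ := hg
  apply le_antisymm
  · by_contra! hcon
    have h1 : ∀ᶠ x in 𝓝 ξ, 0 < g x := hg1.continuous.continuousAt.eventually_const_lt hcon
    have h2 := mem_closure_iff_frequently.1 hξ.1
    obtain ⟨x, hx, hx1, hx2⟩ := (h2.and_eventually (h1.and hg3)).exists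
    exact absurd (hx2.1 hx) (not_lt.2 hx1.le)
  · have h1 : ξ ∉ Ω := by
      have := hξ.2
      rwa [hΩ.interior_eq] at this
    exact not_lt.1 fun h => h1 (hg3.self_of_nhds.2 h)

/-- The exterior normal does not depend on the defining function. -/
theorem outerNormal_eq {N : ℕ} {Ω : Set (Space N)} (hΩ : IsOpen Ω) {ξ : Space N}
    (hξ : ξ ∈ frontier Ω) {g : Space N → ℝ} (hg : IsDefiningFunctionAt Ω ξ g) :
    outerNormal Ω ξ = ‖gradient g ξ‖⁻¹ • gradient g ξ := by
  have hex : ξ ∈ frontier Ω ∧ ∃ g, IsDefiningFunctionAt Ω ξ g := ⟨hξ, g, hg⟩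
  rw [outerNormal, dif_pos hex]
  have hh := hex.2.choose_spec
  set h := hex.2.choose
  set a := gradient h ξ with ha
  set b := gradient g ξ with hb
  have ha0 : 0 < ‖a‖ := norm_pos_iff.2 hh.2.1
  have hb0 : 0 < ‖b‖ := norm_pos_iff.2 hg.2.1
  have key : ∀ v : Space N, inner ℝ a v < 0 → 0 ≤ inner ℝ b (-v) := by
    intro v hv
    by_contra! hcon
    have hcon' : 0 < inner ℝ b v := by
      rw [inner_neg_right] at hcon
      linarith
    have h1 := eventually_neg_of_inner_neg (hh.1.differentiable (by simp) ξ)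
      (hh.eq_zero hΩ hξ) hv
    have hgd := hg.1.differentiable (by simp) ξ
    have hgrad : gradient (fun x => -g x) ξ = -b := by
      have h3 : HasGradientAt g b ξ := hgd.hasGradientAt
      have h4 : HasGradientAt (fun x => -g x) (-b) ξ := by
        rw [hasGradientAt_iff_hasFDerivAt] at h3 ⊢
        rw [map_neg]
        exact h3.neg
      exact h4.gradient
    have h2 := eventually_neg_of_inner_neg (g := fun x => -g x) (v := v) hgd.neg
      (by simp [hg.eq_zero hΩ hξ]) (by rw [hgrad, inner_neg_left]; linarith)
    have ht : Tendsto (fun s : ℝ => ξ + s • v) (𝓝[>] 0) (𝓝 ξ) := by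
      have : Continuous fun s : ℝ => ξ + s • v := by fun_prop
      have h5 := this.tendsto 0
      simp only [zero_smul, add_zero] at h5
      exact h5.mono_left nhdsWithin_le_nhds
    obtain ⟨s, hs1, hs2, hs3, hs4⟩ :=
      (h1.and (h2.and ((ht.eventually hh.2.2).and (ht.eventually hg.2.2)))).exists
    have := hs4.1 (hs3.2 hs1)
    linarith
  by_contra hne
  have hna : ‖‖a‖⁻¹ • a‖ = 1 := by rw [norm_smul, norm_inv, norm_norm, inv_mul_cancel₀ ha0.ne']
  have hnb : ‖‖b‖⁻¹ • b‖ = 1 := by rw [norm_smul, norm_inv, norm_norm, inv_mul_cancel₀ hb0.ne']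
  have hlt : inner ℝ (‖a‖⁻¹ • a) (‖b‖⁻¹ • b) < 1 := (inner_lt_one_iff_real_of_norm_eq_one hna hnb).2 hne
  set a' := ‖a‖⁻¹ • a with ha'
  set b' := ‖b‖⁻¹ • b with hb'
  have ea : a = ‖a‖ • a' := by rw [ha', smul_smul, mul_inv_cancel₀ ha0.ne', one_smul]
  have eb : b = ‖b‖ • b' := by rw [hb', smul_smul, mul_inv_cancel₀ hb0.ne', one_smul]
  have h1 : inner ℝ a (b' - a') < 0 := by
    rw [ea, inner_smul_left, inner_sub_right, real_inner_self_eq_norm_sq, hna]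
    simp only [conj_trivial]
    exact mul_neg_of_pos_of_neg ha0 (by linarith)
  have h2 := key _ h1
  rw [eb, inner_smul_left, inner_neg_right, inner_sub_right, real_inner_self_eq_norm_sq, hnb,
    real_inner_comm] at h2
  simp only [conj_trivial] at h2
  have h3 : ‖b‖ * -(1 ^ 2 - inner ℝ a' b') < 0 := mul_neg_of_pos_of_neg hb0 (by linarith)
  linarith

end IBVP

end

open scoped NNReal

noncomputable section

namespace IBVP

/-! Fix a level `c` and a sign, and write `q = sgn^±(u-c)(f(u)-f(c))`. Tested away from `t = 0`, the
entropy inequality says that, in the sense of distributions and up to bounded terms, `div q` is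
bounded above, with boundary contribution `L (u_b-c)^±`. In normal coordinates `(y, s)` near the
boundary, `s` being the distance along the inner normal, take test functions `κ(t,y) χ(s)`. The
weighted normal flux `G(s) = ∫ κ q·∇s` then satisfies a one-sided Lipschitz condition: `G(s) - C s`
is essentially nonincreasing and bounded above by `L ∫ (u_b-c)^± κ`. Hence `G` has an essential
limit at `0+` with the same upper bound (`exists_tendsto_of_forall_integral_nonneg`, applied in
`IsBoundaryChart.exists_tendsto_chartFlux`).

Since `∇s = -ν` on the boundary, a weight `γ ≥ 0` living where `(u_b-c)^± = 0` makes the datum term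
disappear, whatever the size of `L`. What remains is that `q·ν`, weighted by `γ`, has a nonnegative
essential limit (`hasNonnegTrace_part`). Weights are first `C¹` and then arbitrary in `L¹`, by
density.

The function `𝓕` splits into two such fluxes (`boundaryFlux_eq`): the `+` flux at level `max(w,k)`
and the `-` flux at level `min(w,k)`. With `w = u_b` these levels depend on the boundary point, but
always `(u_b - max(u_b,k))^+ = 0` and `(u_b - min(u_b,k))^- = 0`. Rounding the first level up and
the second down to a finite grid keeps these identities, and on each level set the fixed-level
result applies with `γ = β` restricted to that set (`hasNonnegTrace_sum`). Uniform continuity of `f`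
controls the rounding error, and limits survive uniform approximation (`HasNonnegTrace.of_approx`).

For an MV-solution the semi-entropies are available directly. For an RE-solution they are
approximated by smooth convex functions `h(z-w)` vanishing exactly where `s^±` does. Their fluxes
form admissible pairs (`isBoundaryEntropyPair_smoothFlux`), the delicate point being `C²` regularity
up to `∂Ω`, and are uniformly close to the `sgn^±` fluxes (`IsSmoothPart.norm_smoothFlux_sub_le`).
-/

/-- The parameter space of a hypersurface of `ℝ^N`. -/
abbrev BaseSpace (N : ℕ) := EuclideanSpace ℝ (Fin (N - 1))

/-! ### Normal coordinates near a boundary point -/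

theorem exists_equiv_hasFDerivAt {X Y : Type*} [NormedAddCommGroup X] [NormedSpace ℝ X]
    [FiniteDimensional ℝ X] [NormedAddCommGroup Y] [NormedSpace ℝ Y] [FiniteDimensional ℝ Y]
    (hXY : Module.finrank ℝ X = Module.finrank ℝ Y) {f : X → Y} {f' : X →L[ℝ] Y} {a : X}
    (hf : HasFDerivAt f f' a) (hinj : Function.Injective f') :
    ∃ e : X ≃L[ℝ] Y, HasFDerivAt f (e : X →L[ℝ] Y) a := by
  let e := (LinearEquiv.ofInjectiveOfFinrankEq (f' : X →ₗ[ℝ] Y) hinj hXY).toContinuousLinearEquiv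
  refine ⟨e, ?_⟩
  have : (e : X →L[ℝ] Y) = f' := by ext x; rfl
  rwa [this]

theorem inner_gradient_eq_fderiv {N : ℕ} {g : Space N → ℝ} {x : Space N}
    (v : Space N) :
    inner ℝ (gradient g x) v = fderiv ℝ g x v := by
  rw [gradient, InnerProductSpace.toDual_symm_apply]

theorem finrank_baseSpace_prod {N : ℕ} (hN : 1 ≤ N) :
    Module.finrank ℝ (BaseSpace N × ℝ) = Module.finrank ℝ (Space N) := by
  simp [Module.finrank_prod]; omega

/-- Inverse function theorem for `x ↦ (P x, g x)`, where `P` is the projection along the gradient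
onto the tangent hyperplane. The differential is injective because the kernel of `P` is spanned by
the gradient, on which the differential of `g` does not vanish. Setting the last coordinate to `0`
parametrizes the zero set. -/
theorem exists_levelSet_parametrization {N : ℕ} (hN : 1 ≤ N) {g : Space N → ℝ} {ξ : Space N}
    (hg : ContDiff ℝ ∞ g) (hξ : g ξ = 0) (hgrad : gradient g ξ ≠ 0) :
    ∃ (Φ : BaseSpace N → Space N) (y₀ : BaseSpace N), ContDiffAt ℝ 2 Φ y₀ ∧ Φ y₀ = ξ ∧
      (∀ᶠ y in 𝓝 y₀, g (Φ y) = 0) ∧ Function.Injective (fderiv ℝ Φ y₀) := by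
  set K : Submodule ℝ (Space N) := (ℝ ∙ gradient g ξ)ᗮ with hK
  have hfr : Module.finrank ℝ K = Module.finrank ℝ (BaseSpace N) := by
    have : Fact (Module.finrank ℝ (Space N) = (N - 1) + 1) := ⟨by simp; omega⟩
    rw [hK, Submodule.finrank_orthogonal_span_singleton (n := N - 1) hgrad]
    simp
  let L : K ≃L[ℝ] BaseSpace N := ContinuousLinearEquiv.ofFinrankEq hfr
  let P : Space N →L[ℝ] BaseSpace N := (L : K →L[ℝ] BaseSpace N) ∘L K.orthogonalProjectionOnto
  have hP : ∀ v, P v = 0 → ∃ c : ℝ, v = c • gradient g ξ := by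
    intro v hv
    have h1 : K.orthogonalProjectionOnto v = 0 := by
      apply L.injective
      simpa [P] using hv
    have h2 : v ∈ Kᗮ := (Submodule.orthogonalProjectionOnto_eq_zero_iff).1 h1
    rw [hK, Submodule.orthogonal_orthogonal] at h2
    obtain ⟨c, hc⟩ := Submodule.mem_span_singleton.1 h2
    exact ⟨c, hc.symm⟩
  let θ : Space N → BaseSpace N × ℝ := fun x => (P x, g x)
  have hθ : ContDiff ℝ 2 θ := P.contDiff.prodMk (hg.of_le ENat.LEInfty.out)
  have hgd : DifferentiableAt ℝ g ξ := hg.differentiable (by simp) ξ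
  have hθ' : HasFDerivAt θ (P.prod (fderiv ℝ g ξ)) ξ := P.hasFDerivAt.prodMk hgd.hasFDerivAt
  have hinj : Function.Injective (P.prod (fderiv ℝ g ξ)) := by
    rw [injective_iff_map_eq_zero]
    intro v hv
    have h1 : P v = 0 := congrArg Prod.fst hv
    have h2 : fderiv ℝ g ξ v = 0 := congrArg Prod.snd hv
    obtain ⟨c, rfl⟩ := hP v h1
    rw [← inner_gradient_eq_fderiv, inner_smul_right, real_inner_self_eq_norm_sq] at h2
    have : c = 0 := by
      rcases mul_eq_zero.1 h2 with h | h
      · exact h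
      · exact absurd (norm_eq_zero.1 (pow_eq_zero_iff (by norm_num) |>.1 h)) hgrad
    simp [this]
  obtain ⟨e, he⟩ := exists_equiv_hasFDerivAt (finrank_baseSpace_prod hN).symm hθ' hinj
  have hθ2 : ContDiffAt ℝ 2 θ ξ := hθ.contDiffAt
  let Θ := hθ2.localInverse he (by norm_num)
  have hΘ : ContDiffAt ℝ 2 Θ (θ ξ) := hθ2.to_localInverse he (by norm_num)
  have hΘξ : Θ (θ ξ) = ξ := hθ2.localInverse_apply_image he (by norm_num)
  have hright : ∀ᶠ z in 𝓝 (θ ξ), θ (Θ z) = z :=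
    (hθ2.hasStrictFDerivAt' he (by norm_num)).eventually_right_inverse
  have hι : ContDiff ℝ 2 (fun y : BaseSpace N => (y, (0 : ℝ))) := by fun_prop
  have hθξ : θ ξ = (P ξ, 0) := by simp [θ, hξ]
  have hΦ : ContDiffAt ℝ 2 (fun y => Θ (y, 0)) (P ξ) := by
    rw [hθξ] at hΘ
    exact ContDiffAt.comp (P ξ) (f := fun y : BaseSpace N => (y, (0 : ℝ))) hΘ hι.contDiffAt
  have hev : ∀ᶠ y in 𝓝 (P ξ), θ (Θ (y, 0)) = (y, 0) := by
    rw [hθξ] at hright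
    exact (hι.continuous.tendsto (P ξ)).eventually hright
  refine ⟨fun y => Θ (y, 0), P ξ, hΦ, by simpa [hθξ] using hΘξ, ?_, ?_⟩
  · filter_upwards [hev] with y hy
    exact congrArg Prod.snd hy
  -- `P ∘ Φ` is the identity near the base point, so the derivative of `Φ` has a left inverse.
  · have h1 : HasFDerivAt (fun y => P (Θ (y, 0))) (P ∘L fderiv ℝ (fun y => Θ (y, 0)) (P ξ)) (P ξ) :=
      P.hasFDerivAt.comp _ (hΦ.differentiableAt (by norm_num)).hasFDerivAt
    have h2 : HasFDerivAt (fun y => P (Θ (y, 0))) (ContinuousLinearMap.id ℝ _) (P ξ) := by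
      refine (hasFDerivAt_id (P ξ)).congr_of_eventuallyEq ?_
      filter_upwards [hev] with y hy
      exact congrArg Prod.fst hy
    have h3 := h1.unique h2
    intro v w hvw
    have h4 := congrArg (fun A => A v) h3
    have h5 := congrArg (fun A => A w) h3
    simp only [ContinuousLinearMap.comp_apply, ContinuousLinearMap.id_apply] at h4 h5
    rw [← h4, ← h5, hvw]

/-- A normal coordinate chart of `Ω` near a boundary point: `e (y, s) = e (y, 0) - s • ν` and
Lebesgue measure has the density `J` in the coordinates `(y, s)`. -/
structure IsBoundaryChart {N : ℕ} (Ω : Set (Space N))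
    (e : OpenPartialHomeomorph (BaseSpace N × ℝ) (Space N)) (B : Set (BaseSpace N)) (r : ℝ)
    (J : BaseSpace N × ℝ → ℝ) (M : ℝ) : Prop where
  r_pos : 0 < r
  isOpen_base : IsOpen B
  convex_base : Convex ℝ B
  isBounded_base : Bornology.IsBounded B
  source_eq : e.source = B ×ˢ Ioo (-r) r
  contDiffOn : ContDiffOn ℝ 2 e e.source
  contDiffOn_symm : ContDiffOn ℝ 2 e.symm e.target
  norm_fderiv_le : ∀ z ∈ e.source, ‖fderiv ℝ e z‖ ≤ M
  norm_fderiv_symm_le : ∀ x ∈ e.target, ‖fderiv ℝ e.symm x‖ ≤ M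
  mem_iff : ∀ z ∈ e.source, e z ∈ Ω ↔ 0 < z.2
  mem_frontier_iff : ∀ z ∈ e.source, e z ∈ frontier Ω ↔ z.2 = 0
  ray : ∀ z ∈ e.source, e z = e (z.1, 0) - z.2 • outerNormal Ω (e (z.1, 0))
  fderiv_symm_snd : ∀ y ∈ B, ∀ w, (fderiv ℝ e.symm (e (y, 0)) w).2 =
    -inner ℝ (outerNormal Ω (e (y, 0))) w
  continuousOn_density : ContinuousOn J e.source
  le_density : ∀ z ∈ e.source, M⁻¹ ≤ J z
  density_le : ∀ z ∈ e.source, J z ≤ M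
  map_volume : Measure.map e
    ((volume.restrict (B ×ˢ Ioo 0 r)).withDensity (fun z => ENNReal.ofReal (J z))) =
    volume.restrict (e '' (B ×ˢ Ioo 0 r))

/-- Change of variables between two different spaces: compose with a linear identification `A` to
obtain a self-map with a determinant. The constant `c` is the ratio of the two Haar measures under
`A`. Its value is irrelevant later; only positivity and continuity of the density are used. -/
theorem exists_map_withDensity_det_eq {Z E : Type*} [NormedAddCommGroup Z] [NormedSpace ℝ Z]
    [FiniteDimensional ℝ Z] [MeasureSpace Z] [BorelSpace Z]
    [(volume : Measure Z).IsAddHaarMeasure]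
    [NormedAddCommGroup E] [NormedSpace ℝ E] [FiniteDimensional ℝ E] [MeasureSpace E]
    [BorelSpace E] [(volume : Measure E).IsAddHaarMeasure] (A : Z ≃L[ℝ] E) :
    ∃ c : ℝ, 0 < c ∧ ∀ (f : Z → E) (f' : Z → Z →L[ℝ] E) (s : Set Z), MeasurableSet s →
      (∀ z ∈ s, HasFDerivAt f (f' z) z) → InjOn f s →
      Measure.map f ((volume.restrict s).withDensity
        (fun z => ENNReal.ofReal (c * |((A.symm : E →L[ℝ] Z) ∘L f' z).det|))) =
      volume.restrict (f '' s) := by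
  have hμ : ((volume : Measure E).map A.symm).IsAddHaarMeasure :=
    ContinuousLinearEquiv.isAddHaarMeasure_map A.symm volume
  have hsm := Measure.isAddLeftInvariant_eq_smul ((volume : Measure E).map A.symm)
    (volume : Measure Z)
  set k : ℝ≥0 := ((volume : Measure E).map A.symm).addHaarScalarFactor (volume : Measure Z)
  have hk : 0 < k := by
    rw [pos_iff_ne_zero]
    intro h0
    rw [h0, zero_smul] at hsm
    exact hμ.toIsOpenPosMeasure.open_pos univ isOpen_univ univ_nonempty (by rw [hsm]; rfl)
  refine ⟨k, by exact_mod_cast hk, fun f f' s hs hf hinj => ?_⟩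
  have hcont : ContinuousOn f s := fun z hz => (hf z hz).continuousAt.continuousWithinAt
  have hfm : AEMeasurable f ((volume.restrict s).withDensity
        (fun z => ENNReal.ofReal (k * |((A.symm : E →L[ℝ] Z) ∘L f' z).det|))) :=
    (hcont.aemeasurable hs).mono_ac (withDensity_absolutelyContinuous _ _)
  have hA : ∀ T : Set E, MeasurableSet T → volume T = k * volume (A ⁻¹' T) := by
    intro T hT
    have h1 : (volume : Measure E).map A.symm (A ⁻¹' T) = volume T := by
      rw [Measure.map_apply A.symm.continuous.measurable (A.continuous.measurable hT)]
      congr 1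
      ext x
      simp
    rw [← h1, hsm]
    rfl
  have hAf : ∀ z ∈ s, HasFDerivWithinAt (fun z => A.symm (f z))
      ((A.symm : E →L[ℝ] Z) ∘L f' z) s z := fun z hz =>
    ((A.symm : E →L[ℝ] Z).hasFDerivAt.comp z (hf z hz)).hasFDerivWithinAt
  have hAinj : InjOn (fun z => A.symm (f z)) s := fun x hx y hy hxy =>
    hinj hx hy (A.symm.injective hxy)
  have hkm : (fun z => ENNReal.ofReal (k * |((A.symm : E →L[ℝ] Z) ∘L f' z).det|)) =
      fun z => (k : ℝ≥0∞) * ENNReal.ofReal |((A.symm : E →L[ℝ] Z) ∘L f' z).det| := by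
    ext z
    rw [ENNReal.ofReal_mul k.coe_nonneg, ENNReal.ofReal_coe_nnreal]
  have himg : MeasurableSet (f '' s) := by
    have h1 := measurable_image_of_fderivWithin hs hAf hAinj
    have h2 : f '' s = A.symm ⁻¹' ((fun z => A.symm (f z)) '' s) := by
      ext x
      simp
    rw [h2]
    exact A.symm.continuous.measurable h1
  ext T hT
  rw [Measure.map_apply_of_aemeasurable hfm hT, Measure.restrict_apply hT, hkm]
  have hnull : NullMeasurableSet (f ⁻¹' T) (volume.restrict s) :=
    (hcont.aemeasurable hs).nullMeasurableSet_preimage hT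
  have h2 := lintegral_image_eq_lintegral_abs_det_fderiv_mul volume hs hAf hAinj
    ((A ⁻¹' T).indicator 1)
  rw [lintegral_indicator_one (A.continuous.measurable hT),
    Measure.restrict_apply (A.continuous.measurable hT)] at h2
  rw [hA _ (hT.inter himg)]
  have h3 : A ⁻¹' (T ∩ f '' s) = A ⁻¹' T ∩ (fun z => A.symm (f z)) '' s := by
    ext z
    simp only [mem_preimage, mem_inter_iff, mem_image, ContinuousLinearEquiv.symm_apply_eq]
  rw [h3, h2, withDensity_apply₀ _ (by exact hnull.mono_ac Measure.AbsolutelyContinuous.rfl),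
    ← lintegral_const_mul' _ _ ENNReal.coe_ne_top,
    ← lintegral_indicator₀ hnull]
  refine lintegral_congr fun z => ?_
  by_cases hz : f z ∈ T
  · simp [indicator, hz]
  · simp [indicator, hz]

theorem contDiffAt_unitGradient {N : ℕ} {g : Space N → ℝ} (hg : ContDiff ℝ ∞ g) {x : Space N}
    (hx : gradient g x ≠ 0) : ContDiffAt ℝ 2 (fun x => ‖gradient g x‖⁻¹ • gradient g x) x := by
  have h1 : ContDiff ℝ 2 (gradient g) := by
    unfold gradient
    exact (InnerProductSpace.toDual ℝ (Space N)).symm.toContinuousLinearEquiv.contDiff.comp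
      (hg.fderiv_right (m := 2) (by norm_num; exact ENat.LEInfty.out))
  exact ((h1.contDiffAt.norm ℝ hx).inv (norm_ne_zero_iff.2 hx)).smul h1.contDiffAt

/-- An open condition, so that a single `g` serves all boundary points of a chart. -/
theorem IsDefiningFunctionAt.eventually {N : ℕ} {Ω : Set (Space N)} {ξ : Space N}
    {g : Space N → ℝ} (hg : IsDefiningFunctionAt Ω ξ g) :
    ∀ᶠ x in 𝓝 ξ, IsDefiningFunctionAt Ω x g := by
  have h1 : Continuous (gradient g) := by
    unfold gradient
    exact (InnerProductSpace.toDual ℝ (Space N)).symm.continuous.comp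
      (hg.1.continuous_fderiv (by simp))
  filter_upwards [h1.continuousAt.eventually_ne hg.2.1, hg.2.2.eventually_nhds] with x h2 h3
  exact ⟨hg.1, h2, h3⟩

/-- The derivative of the normal parametrization `(y, s) ↦ Φ y - s • n (Φ y)` on `s = 0`. -/
theorem hasFDerivAt_normalParametrization {Y E : Type*} [NormedAddCommGroup Y] [NormedSpace ℝ Y]
    [NormedAddCommGroup E] [NormedSpace ℝ E] {Φ : Y → E} {n : E → E} {y : Y}
    (hΦ : DifferentiableAt ℝ Φ y) (hn : DifferentiableAt ℝ n (Φ y)) :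
    HasFDerivAt (fun z : Y × ℝ => Φ z.1 - z.2 • n (Φ z.1))
      (fderiv ℝ Φ y ∘L ContinuousLinearMap.fst ℝ Y ℝ -
        (ContinuousLinearMap.snd ℝ Y ℝ).smulRight (n (Φ y))) (y, 0) := by
  have h1 : HasFDerivAt (fun z : Y × ℝ => Φ z.1) (fderiv ℝ Φ y ∘L ContinuousLinearMap.fst ℝ Y ℝ)
      (y, 0) := HasFDerivAt.comp (y, (0 : ℝ)) (f := Prod.fst) hΦ.hasFDerivAt hasFDerivAt_fst
  have h2 : HasFDerivAt (fun z : Y × ℝ => n (Φ z.1))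
      (fderiv ℝ n (Φ y) ∘L (fderiv ℝ Φ y ∘L ContinuousLinearMap.fst ℝ Y ℝ)) (y, 0) :=
    HasFDerivAt.comp (y, (0 : ℝ)) (f := fun z : Y × ℝ => Φ z.1) hn.hasFDerivAt h1
  have h3 : HasFDerivAt (fun z : Y × ℝ => z.2) (ContinuousLinearMap.snd ℝ Y ℝ) (y, 0) :=
    hasFDerivAt_snd
  have h4 := h1.sub (h3.smul h2)
  convert! h4 using 1
  ext <;> simp

/-- The map `(y, s) ↦ Φ y - s n(Φ y)` is a local diffeomorphism at `s = 0`, because `n` is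
transversal to the tangent space. All required properties are open conditions at the base point, so
they hold together on a small box. Along each normal segment `g` is strictly monotone, hence its
sign, and so membership in `Ω` or `∂Ω`, is read off from the sign of `s`. -/
theorem exists_isBoundaryChart {N : ℕ} (hN : 1 ≤ N) {Ω : Set (Space N)} (hΩ : IsOpen Ω)
    {ξ : Space N} (hξ : ξ ∈ frontier Ω) {g : Space N → ℝ} (hg : IsDefiningFunctionAt Ω ξ g) :
    ∃ e B r J M, IsBoundaryChart Ω e B r J M ∧ ξ ∈ e.target := by
  have hgξ : g ξ = 0 := hg.eq_zero hΩ hξ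
  obtain ⟨Φ, y₀, hΦ, rfl, hgΦ, hΦinj⟩ := exists_levelSet_parametrization hN hg.1 hgξ hg.2.1
  have hgdiff : Differentiable ℝ g := hg.1.differentiable (by simp)
  set n : Space N → Space N := fun x => ‖gradient g x‖⁻¹ • gradient g x with hn
  have hgn : ∀ x, gradient g x ≠ 0 → fderiv ℝ g x (n x) = ‖gradient g x‖ := by
    intro x hx
    have : ‖gradient g x‖ ≠ 0 := norm_ne_zero_iff.2 hx
    rw [← inner_gradient_eq_fderiv, hn]
    simp only
    rw [inner_smul_right, real_inner_self_eq_norm_sq]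
    field_simp
  have hinn : ∀ x, gradient g x ≠ 0 → inner ℝ (n x) (n x) = (1 : ℝ) := by
    intro x hx
    have : ‖gradient g x‖ ≠ 0 := norm_ne_zero_iff.2 hx
    rw [real_inner_self_eq_norm_sq, hn]
    simp only
    rw [norm_smul, norm_inv, norm_norm, inv_mul_cancel₀ this, one_pow]
  -- tangential vectors are orthogonal to the normal
  have htan : ∀ y, DifferentiableAt ℝ Φ y → (∀ᶠ y' in 𝓝 y, g (Φ y') = 0) → ∀ v,
      fderiv ℝ g (Φ y) (fderiv ℝ Φ y v) = 0 := by
    intro y hy hev v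
    have h1 : HasFDerivAt (fun y => g (Φ y)) (fderiv ℝ g (Φ y) ∘L fderiv ℝ Φ y) y :=
      (hgdiff (Φ y)).hasFDerivAt.comp y hy.hasFDerivAt
    have h2 : HasFDerivAt (fun y => g (Φ y)) (0 : BaseSpace N →L[ℝ] ℝ) y :=
      (hasFDerivAt_const 0 y).congr_of_eventuallyEq hev
    exact congrArg (fun A => A v) (h1.unique h2)
  have hncd : ContDiffAt ℝ 2 n (Φ y₀) := contDiffAt_unitGradient hg.1 hg.2.1
  set Ψ : BaseSpace N × ℝ → Space N := fun z => Φ z.1 - z.2 • n (Φ z.1) with hΨ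
  set z₀ : BaseSpace N × ℝ := (y₀, 0) with hz₀
  have hΦ1 : ContDiffAt ℝ 2 (fun z : BaseSpace N × ℝ => Φ z.1) z₀ :=
    ContDiffAt.comp z₀ (f := Prod.fst) hΦ contDiffAt_fst
  have hΨ2 : ContDiffAt ℝ 2 Ψ z₀ :=
    hΦ1.sub (contDiffAt_snd.smul (ContDiffAt.comp z₀ (f := fun z : BaseSpace N × ℝ => Φ z.1)
      hncd hΦ1))
  have hΨz₀ : Ψ z₀ = Φ y₀ := by simp [hΨ, hz₀]
  have hΨ' := hasFDerivAt_normalParametrization (hΦ.differentiableAt (by norm_num))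
    (hncd.differentiableAt (by norm_num))
  have hinj : Function.Injective (fderiv ℝ Φ y₀ ∘L ContinuousLinearMap.fst ℝ (BaseSpace N) ℝ -
        (ContinuousLinearMap.snd ℝ (BaseSpace N) ℝ).smulRight (n (Φ y₀))) := by
    rw [injective_iff_map_eq_zero]
    rintro ⟨v, s⟩ hvs
    simp only [sub_apply, ContinuousLinearMap.comp_apply,
      ContinuousLinearMap.coe_fst', ContinuousLinearMap.smulRight_apply,
      ContinuousLinearMap.coe_snd'] at hvs
    have h1 := congrArg (fderiv ℝ g (Φ y₀)) hvs
    rw [map_sub, map_smul, htan y₀ (hΦ.differentiableAt (by norm_num)) hgΦ, hgn _ hg.2.1, map_zero,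
      zero_sub, smul_eq_mul, neg_eq_zero, mul_eq_zero] at h1
    have hs : s = 0 := h1.resolve_right (norm_ne_zero_iff.2 hg.2.1)
    rw [hs, zero_smul, sub_zero] at hvs
    have hv : v = 0 := hΦinj (by rw [hvs, map_zero])
    rw [hv, hs]
    rfl
  obtain ⟨e', he'⟩ := exists_equiv_hasFDerivAt (finrank_baseSpace_prod hN) hΨ' hinj
  let e₀ := hΨ2.toOpenPartialHomeomorph Ψ he' (by norm_num)
  have hz₀s : z₀ ∈ e₀.source := hΨ2.mem_toOpenPartialHomeomorph_source he' (by norm_num)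
  have hsymm2 : ContDiffAt ℝ 2 e₀.symm (e₀ z₀) := by
    have := hΨ2.to_localInverse he' (by norm_num)
    exact this
  let A : (BaseSpace N × ℝ) ≃L[ℝ] Space N :=
    ContinuousLinearEquiv.ofFinrankEq (finrank_baseSpace_prod hN)
  have : (volume : Measure (BaseSpace N × ℝ)).IsAddHaarMeasure :=
    inferInstanceAs ((volume : Measure (BaseSpace N)).prod (volume : Measure ℝ)).IsAddHaarMeasure
  obtain ⟨c, hc, hA⟩ := exists_map_withDensity_det_eq A
  set J : BaseSpace N × ℝ → ℝ := fun z =>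
    c * |((A.symm : Space N →L[ℝ] BaseSpace N × ℝ) ∘L fderiv ℝ Ψ z).det| with hJ
  have hJc : ∀ z, ContDiffAt ℝ 2 Ψ z → ContinuousAt J z := by
    intro z hz
    have h1 : ContinuousAt (fderiv ℝ Ψ) z := (hz.fderiv_right (m := 1) (by norm_num)).continuousAt
    have h2 : ContinuousAt (fun z => (A.symm : Space N →L[ℝ] BaseSpace N × ℝ) ∘L fderiv ℝ Ψ z) z :=
      continuousAt_const.clm_comp h1
    exact continuousAt_const.mul (ContinuousAt.abs
      (ContinuousLinearMap.continuous_det.continuousAt.comp h2))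
  have hJ0 : 0 < J z₀ := by
    have : fderiv ℝ Ψ z₀ = e' := he'.fderiv
    refine mul_pos hc (abs_pos.2 ?_)
    rw [this]
    have h2 : (A.symm : Space N →L[ℝ] BaseSpace N × ℝ) ∘L (e' : BaseSpace N × ℝ →L[ℝ] Space N) =
      ((e'.trans A.symm : (BaseSpace N × ℝ) ≃L[ℝ] BaseSpace N × ℝ) :
        BaseSpace N × ℝ →L[ℝ] BaseSpace N × ℝ) := rfl
    rw [h2]
    exact ((e'.trans A.symm).toLinearEquiv.isUnit_det').ne_zero
  -- bounds on the derivatives and the density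
  obtain ⟨M, hM0, hMΨ, hMs, hMJ, hMJ'⟩ : ∃ M : ℝ, 0 < M ∧ ‖fderiv ℝ Ψ z₀‖ < M ∧
      ‖fderiv ℝ e₀.symm (e₀ z₀)‖ < M ∧ J z₀ < M ∧ M⁻¹ < J z₀ := by
    refine ⟨‖fderiv ℝ Ψ z₀‖ + ‖fderiv ℝ e₀.symm (e₀ z₀)‖ + J z₀ + (J z₀)⁻¹ + 1, ?_, ?_, ?_, ?_, ?_⟩
    any_goals
      have := inv_pos.2 hJ0
      have := norm_nonneg (fderiv ℝ Ψ z₀)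
      have := norm_nonneg (fderiv ℝ e₀.symm (e₀ z₀))
      first | linarith | positivity
    refine inv_lt_of_inv_lt₀ hJ0 ?_
    have := inv_pos.2 hJ0
    have := norm_nonneg (fderiv ℝ Ψ z₀)
    have := norm_nonneg (fderiv ℝ e₀.symm (e₀ z₀))
    linarith
  have hfst : Tendsto (Prod.fst : BaseSpace N × ℝ → BaseSpace N) (𝓝 z₀) (𝓝 y₀) :=
    continuous_fst.tendsto z₀
  have hΨt : Tendsto Ψ (𝓝 z₀) (𝓝 (Φ y₀)) := by
    have := hΨ2.continuousAt
    rwa [ContinuousAt, hΨz₀] at this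
  have hgc : Continuous (fderiv ℝ g) := hg.1.continuous_fderiv (by simp)
  have ev1 : ∀ᶠ z in 𝓝 z₀, ContDiffAt ℝ 2 Ψ z := hΨ2.eventually (by norm_num)
  have ev2 : ∀ᶠ z in 𝓝 z₀, z ∈ e₀.source := e₀.open_source.mem_nhds hz₀s
  have ev3 : ∀ᶠ z in 𝓝 z₀, ContDiffAt ℝ 2 e₀.symm (e₀ z) := by
    have := hsymm2.eventually (by norm_num)
    exact (e₀.continuousAt hz₀s).eventually this
  have ev4 : ∀ᶠ z in 𝓝 z₀, ‖fderiv ℝ Ψ z‖ < M :=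
    ((hΨ2.fderiv_right (m := 1) (by norm_num)).continuousAt.norm).eventually_lt_const hMΨ
  have ev5 : ∀ᶠ z in 𝓝 z₀, ‖fderiv ℝ e₀.symm (e₀ z)‖ < M :=
    (e₀.continuousAt hz₀s).eventually
      (((hsymm2.fderiv_right (m := 1) (by norm_num)).continuousAt.norm).eventually_lt_const hMs)
  have ev6 : ∀ᶠ z in 𝓝 z₀, J z < M := (hJc z₀ hΨ2).eventually_lt_const hMJ
  have ev7 : ∀ᶠ z in 𝓝 z₀, M⁻¹ < J z := (hJc z₀ hΨ2).eventually_const_lt hMJ'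
  have ev8 : ∀ᶠ z in 𝓝 z₀, IsDefiningFunctionAt Ω (Ψ z) g := hΨt.eventually hg.eventually
  have ev9 : ∀ᶠ z in 𝓝 z₀, ∀ᶠ y in 𝓝 z.1, g (Φ y) = 0 := hfst.eventually hgΦ.eventually_nhds
  have ev10 : ∀ᶠ z in 𝓝 z₀, ContDiffAt ℝ 2 Φ z.1 :=
    hfst.eventually (hΦ.eventually (by norm_num))
  have ev11 : ∀ᶠ z in 𝓝 z₀, ContDiffAt ℝ 2 n (Φ z.1) :=
    hΦ1.continuousAt.eventually (hncd.eventually (by norm_num))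
  have ev12 : ∀ᶠ z in 𝓝 z₀, 0 < fderiv ℝ g (Ψ z) (n (Φ z.1)) := by
    have h1 : ContinuousAt (fun z => fderiv ℝ g (Ψ z) (n (Φ z.1))) z₀ :=
      (hgc.continuousAt.comp hΨ2.continuousAt).clm_apply
        (ContinuousAt.comp (x := z₀) (f := fun z : BaseSpace N × ℝ => Φ z.1) (g := n)
          hncd.continuousAt hΦ1.continuousAt)
    refine h1.eventually_const_lt ?_
    show 0 < fderiv ℝ g (Ψ z₀) (n (Φ y₀))
    rw [hΨz₀, hgn _ hg.2.1]
    exact norm_pos_iff.2 hg.2.1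
  obtain ⟨r, hr, hball⟩ := Metric.eventually_nhds_iff_ball.1 (ev1.and (ev2.and (ev3.and (ev4.and
    (ev5.and (ev6.and (ev7.and (ev8.and (ev9.and (ev10.and (ev11.and ev12)))))))))))
  -- The product carries the sup metric, so a ball is already a box.
  have hbox : Metric.ball z₀ r = Metric.ball y₀ r ×ˢ Ioo (-r) r := by
    rw [hz₀, ← ball_prod_same, Real.ball_eq_Ioo, zero_sub, zero_add]
  rw [hbox] at hball
  set B := Metric.ball y₀ r
  have hopen : IsOpen (B ×ˢ Ioo (-r) r) := Metric.isOpen_ball.prod isOpen_Ioo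
  let e := e₀.restrOpen (B ×ˢ Ioo (-r) r) hopen
  have he : ∀ z, e z = Ψ z := fun _ => rfl
  have hsrc : e.source = B ×ˢ Ioo (-r) r := by
    rw [e₀.restrOpen_source]
    exact inter_eq_right.2 fun z hz => (hball z hz).2.1
  have hmem0 : ∀ z ∈ B ×ˢ Ioo (-r) r, (z.1, (0 : ℝ)) ∈ B ×ˢ Ioo (-r) r := fun z hz =>
    ⟨hz.1, by constructor <;> simp [hr]⟩
  have hΨ0 : ∀ y, Ψ (y, 0) = Φ y := fun y => by simp [hΨ]
  -- the sign of `g`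
  have hsign : ∀ y ∈ B, StrictAntiOn (fun s => g (Ψ (y, s))) (Ioo (-r) r) := by
    intro y hy
    have hder : ∀ s ∈ Ioo (-r) r, HasDerivAt (fun s => g (Ψ (y, s)))
        (-fderiv ℝ g (Ψ (y, s)) (n (Φ y))) s := by
      intro s hs
      have h1 : HasDerivAt (fun s : ℝ => Ψ (y, s)) (-n (Φ y)) s := by
        have := ((hasDerivAt_id s).smul_const (n (Φ y))).const_sub (Φ y)
        simpa using this
      have h2 := (hgdiff (Ψ (y, s))).hasFDerivAt.comp_hasDerivAt s h1
      rw [map_neg] at h2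
      exact h2
    refine strictAntiOn_of_deriv_neg (convex_Ioo _ _)
      (fun s hs => (hder s hs).continuousAt.continuousWithinAt) ?_
    intro s hs
    rw [interior_Ioo] at hs
    rw [(hder s hs).deriv, neg_lt_zero]
    exact (hball (y, s) ⟨hy, hs⟩).2.2.2.2.2.2.2.2.2.2.2
  have hg0 : ∀ y ∈ B, g (Ψ (y, 0)) = 0 := by
    intro y hy
    rw [hΨ0]
    exact ((hball (y, 0) (hmem0 (y, 0) ⟨hy, by constructor <;> simp [hr]⟩)).2.2.2.2.2.2.2.2.1).self_of_nhds
  have h0mem : (0 : ℝ) ∈ Ioo (-r) r := by constructor <;> simp [hr]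
  have hmemΩ : ∀ z ∈ B ×ˢ Ioo (-r) r, Ψ z ∈ Ω ↔ 0 < z.2 := by
    rintro ⟨y, s⟩ hz
    have := (hsign y hz.1).lt_iff_gt hz.2 h0mem
    simp only [hg0 y hz.1] at this
    rw [((hball _ hz).2.2.2.2.2.2.2.1).2.2.self_of_nhds, this]
  have hfront : ∀ z ∈ B ×ˢ Ioo (-r) r, Ψ z ∈ frontier Ω ↔ z.2 = 0 := by
    rintro ⟨y, s⟩ hz
    constructor
    · intro hzf
      have hgz : g (Ψ (y, s)) = 0 := ((hball _ hz).2.2.2.2.2.2.2.1).eq_zero hΩ hzf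
      exact (hsign y hz.1).injOn hz.2 h0mem (by rw [hgz, hg0 y hz.1])
    · rintro (rfl : s = 0)
      refine ⟨?_, ?_⟩
      · have h1 : ContinuousAt (fun s : ℝ => Ψ (y, s)) 0 := by
          have : Continuous (fun s : ℝ => Ψ (y, s)) := by
            simp only [hΨ]
            fun_prop
          exact this.continuousAt
        refine mem_closure_of_tendsto (b := 𝓝[>] (0 : ℝ))
          (h1.tendsto.mono_left nhdsWithin_le_nhds) ?_
        filter_upwards [Ioo_mem_nhdsGT hr] with s hs
        exact (hmemΩ (y, s) ⟨hz.1, by constructor <;> linarith [hs.1, hs.2]⟩).2 hs.1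
      · rw [hΩ.interior_eq, hmemΩ _ hz]
        exact lt_irrefl 0
  have hnormal : ∀ y ∈ B, outerNormal Ω (Ψ (y, 0)) = n (Φ y) := by
    intro y hy
    have hz : (y, (0 : ℝ)) ∈ B ×ˢ Ioo (-r) r := ⟨hy, h0mem⟩
    rw [outerNormal_eq hΩ ((hfront _ hz).2 rfl) (hball _ hz).2.2.2.2.2.2.2.1, hΨ0]
  refine ⟨e, B, r, J, M, ⟨hr, Metric.isOpen_ball, convex_ball _ _, Metric.isBounded_ball, hsrc,
    ?_, ?_, ?_, ?_, ?_, ?_, ?_, ?_, ?_, ?_, ?_, ?_⟩, ?_⟩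
  · intro z hz
    rw [hsrc] at hz
    exact (hball z hz).1.contDiffWithinAt
  · intro x hx
    have hz := e.map_target hx
    rw [hsrc] at hz
    have := (hball _ hz).2.2.1
    have h2 : e₀ (e.symm x) = x := e.right_inv hx
    rw [h2] at this
    exact this.contDiffWithinAt
  · intro z hz
    rw [hsrc] at hz
    exact (hball z hz).2.2.2.1.le
  · intro x hx
    have hz := e.map_target hx
    rw [hsrc] at hz
    have := (hball _ hz).2.2.2.2.1.le
    have h2 : e₀ (e.symm x) = x := e.right_inv hx
    rw [h2] at this
    exact this
  · rw [hsrc]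
    exact hmemΩ
  · rw [hsrc]
    exact hfront
  · rw [hsrc]
    rintro ⟨y, s⟩ hz
    rw [he, he, hnormal y hz.1, hΨ0]
  · intro y hy w
    have hz : (y, (0 : ℝ)) ∈ B ×ˢ Ioo (-r) r := ⟨hy, h0mem⟩
    obtain ⟨a1, a2, a3, -, -, -, -, a8, a9, a10, a11, -⟩ := hball _ hz
    have hD := hasFDerivAt_normalParametrization (a10.differentiableAt (by norm_num))
      (a11.differentiableAt (by norm_num))
    set D := fderiv ℝ Φ y ∘L ContinuousLinearMap.fst ℝ (BaseSpace N) ℝ -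
        (ContinuousLinearMap.snd ℝ (BaseSpace N) ℝ).smulRight (n (Φ y)) with hDdef
    have hS : HasFDerivAt e₀.symm (fderiv ℝ e₀.symm (e₀ (y, 0))) (e₀ (y, 0)) :=
      (a3.differentiableAt (by norm_num)).hasFDerivAt
    have h1 : HasFDerivAt (fun z => e₀.symm (e₀ z)) (fderiv ℝ e₀.symm (e₀ (y, 0)) ∘L D) (y, 0) :=
      hS.comp _ hD
    have h2 : HasFDerivAt (fun z => e₀.symm (e₀ z)) (ContinuousLinearMap.id ℝ _) (y, 0) := by
      refine (hasFDerivAt_id _).congr_of_eventuallyEq ?_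
      filter_upwards [e₀.open_source.mem_nhds a2] with z hz
      exact e₀.left_inv hz
    have h3 := h1.unique h2
    have h1' : HasFDerivAt (fun x => e₀ (e₀.symm x)) (D ∘L fderiv ℝ e₀.symm (e₀ (y, 0)))
        (e₀ (y, 0)) := by
      refine HasFDerivAt.comp (g := e₀) (f := e₀.symm) (e₀ (y, 0)) ?_ hS
      rw [e₀.left_inv a2]
      exact hD
    have h2' : HasFDerivAt (fun x => e₀ (e₀.symm x)) (ContinuousLinearMap.id ℝ _) (e₀ (y, 0)) := by
      refine (hasFDerivAt_id _).congr_of_eventuallyEq ?_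
      filter_upwards [e₀.open_target.mem_nhds (e₀.map_source a2)] with x hx
      exact e₀.right_inv hx
    -- With `v` the image of `w` under the inverse differential, `w = DΦ v.1 - v.2 • n`. The first
    -- term is tangential, so pairing with the unit vector `n` leaves `-v.2`.
    have h4 := congrArg (fun T => T w) (h1'.unique h2')
    simp only [ContinuousLinearMap.comp_apply, ContinuousLinearMap.id_apply] at h4
    show (fderiv ℝ e₀.symm (e₀ (y, 0)) w).2 = -inner ℝ (outerNormal Ω (Ψ (y, 0))) w
    set v := fderiv ℝ e₀.symm (e₀ (y, 0)) w with hv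
    have hgr : gradient g (Φ y) ≠ 0 := by
      have := a8.2.1
      rwa [hΨ0] at this
    rw [hnormal y hy, ← h4, hDdef]
    simp only [sub_apply, ContinuousLinearMap.comp_apply,
      ContinuousLinearMap.coe_fst', ContinuousLinearMap.smulRight_apply,
      ContinuousLinearMap.coe_snd']
    rw [inner_sub_right, inner_smul_right, hinn _ hgr]
    have h5 : inner ℝ (n (Φ y)) (fderiv ℝ Φ y v.1) = (0 : ℝ) := by
      simp only [hn]
      rw [inner_smul_left, inner_gradient_eq_fderiv,
        htan y (a10.differentiableAt (by norm_num)) a9, mul_zero]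
    rw [h5]
    ring
  · intro z hz
    rw [hsrc] at hz
    exact (hJc z (hball z hz).1).continuousWithinAt
  · intro z hz
    rw [hsrc] at hz
    exact (hball z hz).2.2.2.2.2.2.1.le
  · intro z hz
    rw [hsrc] at hz
    exact (hball z hz).2.2.2.2.2.1.le
  · have hsub : B ×ˢ Ioo 0 r ⊆ B ×ˢ Ioo (-r) r := prod_mono_right (Ioo_subset_Ioo_left (by linarith))
    refine hA Ψ (fderiv ℝ Ψ) (B ×ˢ Ioo 0 r) (Metric.isOpen_ball.measurableSet.prod measurableSet_Ioo)
      (fun z hz => ((hball z (hsub hz)).1.differentiableAt (by norm_num)).hasFDerivAt) ?_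
    refine e.injOn.mono ?_
    rw [hsrc]
    exact hsub
  · have : z₀ ∈ e.source := by
      rw [hsrc, ← hbox]
      exact Metric.mem_ball_self hr
    have := e.map_source this
    rwa [he, hΨz₀] at this

/-! ### Essential limits and traces -/

/-- Every interval `(0, u)` has positive measure, so removing a null set cannot empty it. -/
instance essRightZero_neBot : essRightZero.NeBot := by
  rw [essRightZero, inf_neBot_iff]
  intro s hs t ht
  obtain ⟨u, hu, hsub⟩ := mem_nhdsGT_iff_exists_Ioo_subset.1 hs
  have hpos : 0 < volume (Ioo (0 : ℝ) u) := by simpa using hu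
  have h2 : 0 < volume (Ioo (0 : ℝ) u ∩ t) := by
    rwa [measure_inter_conull ht]
  obtain ⟨x, hx⟩ := nonempty_of_measure_ne_zero h2.ne'
  exact ⟨x, hsub hx.1, hx.2⟩

theorem eventually_essRightZero_of_ae {r : ℝ} (hr : 0 < r) {P : ℝ → Prop}
    (h : ∀ᵐ s ∂(volume.restrict (Ioo 0 r)), P s) : ∀ᶠ s in essRightZero, P s := by
  rw [ae_restrict_iff' measurableSet_Ioo] at h
  have h1 : ∀ᶠ s in essRightZero, s ∈ Ioo 0 r := mem_inf_of_left (Ioo_mem_nhdsGT hr)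
  have h2 : ∀ᶠ s in essRightZero, s ∈ Ioo 0 r → P s := mem_inf_of_right h
  filter_upwards [h1, h2] with s hs hs' using hs' hs

theorem eventually_essRightZero_mem_Ioo {r : ℝ} (hr : 0 < r) :
    ∀ᶠ s in essRightZero, s ∈ Ioo 0 r := mem_inf_of_left (Ioo_mem_nhdsGT hr)

/-- The integrals of `A p (v ρ p)` have a nonnegative essential limit as `ρ → 0+`. -/
def HasNonnegTrace {X : Type*} [MeasurableSpace X] (m : Measure X) (v : ℝ → X → ℝ)
    (A : X → ℝ → ℝ) : Prop :=
  (∀ᶠ ρ in essRightZero, Integrable (fun p => A p (v ρ p)) m) ∧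
    ∃ ℓ : ℝ, 0 ≤ ℓ ∧ Tendsto (fun ρ => ∫ p, A p (v ρ p) ∂m) essRightZero (𝓝 ℓ)

section Trace

variable {X : Type*} [MeasurableSpace X] {m : Measure X} {v : ℝ → X → ℝ}

theorem HasNonnegTrace.zero : HasNonnegTrace m v (fun _ _ => 0) :=
  ⟨by simp, 0, le_rfl, by simp⟩

theorem HasNonnegTrace.add {A A' : X → ℝ → ℝ} (h : HasNonnegTrace m v A)
    (h' : HasNonnegTrace m v A') : HasNonnegTrace m v (fun p z => A p z + A' p z) := by
  obtain ⟨hi, ℓ, hℓ, ht⟩ := h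
  obtain ⟨hi', ℓ', hℓ', ht'⟩ := h'
  refine ⟨by filter_upwards [hi, hi'] with ρ h1 h2 using h1.add h2, ℓ + ℓ', add_nonneg hℓ hℓ', ?_⟩
  refine (ht.add ht').congr' ?_
  filter_upwards [hi, hi'] with ρ h1 h2
  exact (integral_add h1 h2).symm

theorem HasNonnegTrace.sum {ι : Type*} (s : Finset ι) {A : ι → X → ℝ → ℝ}
    (h : ∀ i ∈ s, HasNonnegTrace m v (A i)) :
    HasNonnegTrace m v (fun p z => ∑ i ∈ s, A i p z) := by
  classical
  induction s using Finset.induction_on with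
  | empty => simpa using HasNonnegTrace.zero
  | insert i s hi ih =>
    simp only [Finset.sum_insert hi]
    exact (h i (Finset.mem_insert_self i s)).add
      (ih fun j hj => h j (Finset.mem_insert_of_mem hj))

/-- Used to move a trace from the parameter domain of a chart to the lateral boundary, where both
the measure and the state change. -/
theorem HasNonnegTrace.congr {A : X → ℝ → ℝ} {Y : Type*} [MeasurableSpace Y]
    {m' : Measure Y} {w : ℝ → Y → ℝ} {D : Y → ℝ → ℝ}
    (h : HasNonnegTrace m v A)
    (hint : ∀ᶠ ρ in essRightZero, Integrable (fun p => A p (v ρ p)) m →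
      Integrable (fun p => D p (w ρ p)) m' ∧ ∫ p, D p (w ρ p) ∂m' = ∫ p, A p (v ρ p) ∂m) :
    HasNonnegTrace m' w D := by
  obtain ⟨hi, ℓ, hℓ, ht⟩ := h
  refine ⟨by filter_upwards [hi, hint] with ρ h1 h2 using (h2 h1).1, ℓ, hℓ, ht.congr' ?_⟩
  filter_upwards [hi, hint] with ρ h1 h2 using (h2 h1).2.symm

theorem HasNonnegTrace.congr_ae {A A' : X → ℝ → ℝ} (h : HasNonnegTrace m v A)
    (hA : ∀ᵐ p ∂m, ∀ z, A p z = A' p z) : HasNonnegTrace m v A' := by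
  refine h.congr (Eventually.of_forall fun ρ hi => ?_)
  have : (fun p => A p (v ρ p)) =ᵐ[m] fun p => A' p (v ρ p) := by
    filter_upwards [hA] with p hp using hp _
  exact ⟨hi.congr this, (integral_congr_ae this).symm⟩

/-- An integrand that is approximated, uniformly over the values `S` of the state, with an error of
small integral has integrals eventually close to a fixed nonnegative number. As the error is
arbitrary, these integrals form a Cauchy filter, and the limit inherits the sign. -/
theorem HasNonnegTrace.of_approx {A : X → ℝ → ℝ} {S : Set ℝ}
    (hv : ∀ᶠ ρ in essRightZero, ∀ᵐ p ∂m, v ρ p ∈ S)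
    (hA : ∀ᶠ ρ in essRightZero, AEStronglyMeasurable (fun p => A p (v ρ p)) m)
    (happ : ∀ ε > 0, ∃ (A' : X → ℝ → ℝ) (e : X → ℝ), HasNonnegTrace m v A' ∧ Integrable e m ∧
      ∫ p, e p ∂m ≤ ε ∧ ∀ᵐ p ∂m, ∀ z ∈ S, |A p z - A' p z| ≤ e p) :
    HasNonnegTrace m v A := by
  have hclose : ∀ ε > 0, ∃ ℓ : ℝ, 0 ≤ ℓ ∧ ∀ᶠ ρ in essRightZero,
      Integrable (fun p => A p (v ρ p)) m ∧ |∫ p, A p (v ρ p) ∂m - ℓ| ≤ 2 * ε := by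
    intro ε hε
    obtain ⟨A', e, ⟨hi, ℓ, hℓ, ht⟩, he, heε, hae⟩ := happ ε hε
    refine ⟨ℓ, hℓ, ?_⟩
    filter_upwards [hv, hA, hi, Metric.tendsto_nhds.1 ht ε hε] with ρ h1 h2 h3 h4
    have hle : ∀ᵐ p ∂m, ‖A p (v ρ p) - A' p (v ρ p)‖ ≤ e p := by
      filter_upwards [h1, hae] with p hp hp' using hp' _ hp
    have hd : Integrable (fun p => A p (v ρ p) - A' p (v ρ p)) m :=
      he.mono' (h2.sub h3.1) hle
    have hAi : Integrable (fun p => A p (v ρ p)) m := by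
      refine (hd.add h3).congr (Eventually.of_forall fun p => ?_)
      simp
    refine ⟨hAi, ?_⟩
    have h5 : |∫ p, A p (v ρ p) ∂m - ∫ p, A' p (v ρ p) ∂m| ≤ ε := by
      rw [← integral_sub hAi h3]
      exact (norm_integral_le_of_norm_le he hle).trans heε
    rw [Real.dist_eq] at h4
    calc |∫ p, A p (v ρ p) ∂m - ℓ|
        ≤ |∫ p, A p (v ρ p) ∂m - ∫ p, A' p (v ρ p) ∂m| + |∫ p, A' p (v ρ p) ∂m - ℓ| :=
          abs_sub_le _ _ _
      _ ≤ 2 * ε := by linarith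
  have hcauchy : Cauchy (map (fun ρ => ∫ p, A p (v ρ p) ∂m) essRightZero) := by
    refine Metric.cauchy_iff.2 ⟨inferInstance, fun ε hε => ?_⟩
    obtain ⟨ℓ, -, hev⟩ := hclose (ε / 8) (by positivity)
    refine ⟨_, image_mem_map hev, ?_⟩
    rintro _ ⟨ρ, hρ, rfl⟩ _ ⟨ρ', hρ', rfl⟩
    have h1 := hρ.2
    have h2 := hρ'.2
    rw [Real.dist_eq]
    rw [abs_le] at h1 h2
    rw [abs_lt]
    constructor <;> linarith [h1.1, h1.2, h2.1, h2.2]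
  obtain ⟨ℓ, hℓ⟩ := cauchy_map_iff_exists_tendsto.1 hcauchy
  refine ⟨?_, ℓ, ?_, hℓ⟩
  · obtain ⟨ℓ', -, hev⟩ := hclose 1 one_pos
    filter_upwards [hev] with ρ h using h.1
  · refine le_of_forall_pos_le_add fun ε hε => ?_
    obtain ⟨ℓ', hℓ', hev⟩ := hclose (ε / 2) (by positivity)
    have : ∀ᶠ ρ in essRightZero, -ε ≤ ∫ p, A p (v ρ p) ∂m := by
      filter_upwards [hev] with ρ h
      linarith [(abs_le.1 h.2).1]
    linarith [ge_of_tendsto hℓ this]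

end Trace

/-! ### One-dimensional one-sided Lipschitz functions -/

/-- A mollified Heaviside function: differences of its translates are smooth approximations of
indicators of intervals. -/
theorem exists_contDiff_primitive_normed (φ : ContDiffBump (0 : ℝ)) :
    ∃ Θ : ℝ → ℝ, (∀ x, HasDerivAt Θ (φ.normed volume x) x) ∧ Monotone Θ ∧
      (∀ x ≤ -φ.rOut, Θ x = 0) ∧ (∀ x, φ.rOut ≤ x → Θ x = 1) := by
  have hc : Continuous (φ.normed volume) := φ.continuous_normed
  have hz : ∀ x, φ.rOut ≤ |x| → φ.normed volume x = 0 := by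
    intro x hx
    have : x ∉ Function.support (φ.normed volume) := by
      rw [φ.support_normed_eq]
      simpa using hx
    simpa using this
  have hder : ∀ x, HasDerivAt (fun x => ∫ s in (-φ.rOut)..x, φ.normed volume s)
      (φ.normed volume x) x := fun x =>
    intervalIntegral.integral_hasDerivAt_right (hc.intervalIntegrable _ _)
      (hc.stronglyMeasurableAtFilter _ _) hc.continuousAt
  refine ⟨fun x => ∫ s in (-φ.rOut)..x, φ.normed volume s, hder, ?_, ?_, ?_⟩
  · refine monotone_of_deriv_nonneg (fun x => (hder x).differentiableAt) fun x => ?_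
    rw [(hder x).deriv]
    exact φ.nonneg_normed x
  · intro x hx
    simp only
    rw [intervalIntegral.integral_symm, neg_eq_zero]
    refine intervalIntegral.integral_zero_ae (Eventually.of_forall fun s hs => hz s ?_)
    rw [uIoc_of_le hx] at hs
    rw [le_abs]
    right
    linarith [hs.2]
  · intro x hx
    have h1 : ∫ s, φ.normed volume s = 1 := φ.integral_normed
    have hp := φ.rOut_pos
    simp only
    rw [← h1, intervalIntegral.integral_of_le (by linarith)]
    refine setIntegral_eq_integral_of_forall_compl_eq_zero fun s hs => hz s ?_
    by_contra! hcon
    rw [abs_lt] at hcon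
    exact hs ⟨hcon.1, by linarith [hcon.2]⟩

-- For `χ` close to the indicator of `[a, b]` with `0 < a`, the hypothesis reads `G b - C b ≤ G a -
-- C a` at almost all points. For `a < 0` it reads `G b - C b ≤ c₀`. So `G s - C s` is essentially
-- nonincreasing and bounded above, and its limit at `0+` is its essential supremum.
open scoped Convolution in
theorem exists_tendsto_of_forall_integral_nonneg {r C c₀ : ℝ} (hr : 0 < r) (hC : 0 ≤ C)
    {G : ℝ → ℝ} (hG : IntegrableOn G (Ioo 0 r))
    (h : ∀ χ : ℝ → ℝ, ContDiff ℝ 1 χ → HasCompactSupport χ → (∀ s, 0 ≤ χ s) →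
      tsupport χ ⊆ Ioo (-r) r → 0 ≤ (∫ s in Ioo 0 r, deriv χ s * G s) +
        C * (∫ s in Ioo 0 r, χ s) + c₀ * χ 0) :
    ∃ ℓ ≤ c₀, Tendsto G essRightZero (𝓝 ℓ) := by
  -- The fixed ratio `rOut = 2 * rIn` is what the almost everywhere convergence of the
  -- mollifications requires (`K := 2`).
  let φ : ℕ → ContDiffBump (0 : ℝ) := fun n =>
    { rIn := 1 / (2 * (n + 1)), rOut := 1 / (n + 1), rIn_pos := by positivity,
      rIn_lt_rOut := by
        rw [div_lt_div_iff_of_pos_left one_pos (by positivity) (by positivity)]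
        have : (0 : ℝ) ≤ n := n.cast_nonneg
        linarith }
  have hφout : Tendsto (fun n => (φ n).rOut) atTop (𝓝 0) := tendsto_one_div_add_atTop_nhds_zero_nat
  set Gt : ℝ → ℝ := (Ioo 0 r).indicator G with hGt
  have hGti : Integrable Gt := (integrable_indicator_iff measurableSet_Ioo).2 hG
  have hconv := ContDiffBump.ae_convolution_tendsto_right_of_locallyIntegrable (μ := volume)
    (K := 2) hφout (Eventually.of_forall fun n => le_of_eq (by
      show (1 : ℝ) / (n + 1) = 2 * (1 / (2 * (n + 1)))
      field_simp)) hGti.locallyIntegrable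
  -- The mollification of `G`, extended by zero, at `x`. The bump is even, so its argument may be `t
  -- - x`, which is the form in which `deriv χ` produces it.
  set c : ℕ → ℝ → ℝ := fun n x => ∫ t in Ioo 0 r, (φ n).normed volume (t - x) * G t with hc
  have hcc : ∀ n x, ((φ n).normed volume ⋆[ContinuousLinearMap.lsmul ℝ ℝ, volume] Gt) x = c n x := by
    intro n x
    rw [convolution_eq_swap, hc]
    simp only [ContinuousLinearMap.lsmul_apply, smul_eq_mul]
    rw [← integral_indicator measurableSet_Ioo]
    refine integral_congr_ae (Eventually.of_forall fun t => ?_)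
    have : (φ n).normed volume (x - t) = (φ n).normed volume (t - x) := by
      rw [← (φ n).normed_neg, neg_sub]
    simp only [hGt, this]
    by_cases ht : t ∈ Ioo 0 r <;> simp [ht]
  simp only [hcc] at hconv
  choose Θ hΘd hΘm hΘ0 hΘ1 using fun n => exists_contDiff_primitive_normed (φ n)
  have hΘle : ∀ n x, Θ n x ≤ 1 := fun n x => by
    rw [← hΘ1 n (max x (φ n).rOut) (le_max_right _ _)]
    exact hΘm n (le_max_left _ _)
  have hΘge : ∀ n x, 0 ≤ Θ n x := fun n x => by
    rw [← hΘ0 n (min x (-(φ n).rOut)) (min_le_right _ _)]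
    exact hΘm n (min_le_left _ _)
  have hΘC : ∀ n, ContDiff ℝ 1 (Θ n) := fun n => by
    rw [contDiff_one_iff_deriv]
    refine ⟨fun x => (hΘd n x).differentiableAt, ?_⟩
    have : deriv (Θ n) = (φ n).normed volume := funext fun x => (hΘd n x).deriv
    rw [this]
    exact (φ n).continuous_normed
  -- The hypothesis for the smoothed indicator of `[a, b]`. Only its part in `(0, r)` has length to
  -- pay for, whence `max a 0`; the smoothing adds at most `rOut` at each end. This one form covers
  -- both signs of `a`.
  have key : ∀ a b, -r < a → a ≤ b → 0 < b → b < r → ∀ᶠ n in atTop,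
      0 ≤ (c n a - c n b) + C * (b - max a 0 + 2 * (φ n).rOut) +
        c₀ * (Θ n (0 - a) - Θ n (0 - b)) := by
    intro a b ha hab hb0 hb
    have e1 : ∀ᶠ n in atTop, (φ n).rOut < min (a + r) (r - b) :=
      hφout.eventually_lt_const (lt_min (by linarith) (by linarith))
    filter_upwards [e1] with n hn
    have hn1 := hn.trans_le (min_le_left _ _)
    have hn2 := hn.trans_le (min_le_right _ _)
    have hpos := (φ n).rOut_pos
    set δ := (φ n).rOut
    set χ : ℝ → ℝ := fun s => Θ n (s - a) - Θ n (s - b) with hχ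
    have hχ0 : ∀ s, 0 ≤ χ s := fun s => sub_nonneg.2 (hΘm n (by linarith))
    have hχ1 : ∀ s, χ s ≤ 1 := fun s => by
      have h1 := hΘle n (s - a)
      have h2 := hΘge n (s - b)
      simp only [hχ]
      linarith
    have hχC : ContDiff ℝ 1 χ := by
      refine ContDiff.sub ?_ ?_
      · exact (hΘC n).comp (contDiff_id.sub contDiff_const)
      · exact (hΘC n).comp (contDiff_id.sub contDiff_const)
    have hsupp : Function.support χ ⊆ Icc (a - δ) (b + δ) := by
      intro s hs
      by_contra hcon
      refine hs ?_
      simp only [mem_Icc, not_and_or, not_le] at hcon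
      rcases hcon with h1 | h1
      · simp only [hχ]
        rw [hΘ0 n _ (by linarith), hΘ0 n _ (by linarith), sub_zero]
      · simp only [hχ]
        rw [hΘ1 n _ (by linarith), hΘ1 n _ (by linarith), sub_self]
    have hts : tsupport χ ⊆ Icc (a - δ) (b + δ) := closure_minimal hsupp isClosed_Icc
    have hcs : HasCompactSupport χ := isCompact_Icc.of_isClosed_subset isClosed_closure hts
    have hmain := h χ hχC hcs hχ0
      (hts.trans (Icc_subset_Ioo (by linarith) (by linarith)))
    have hderiv : ∀ s, deriv χ s = (φ n).normed volume (s - a) - (φ n).normed volume (s - b) := by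
      intro s
      have h1 : HasDerivAt (fun s => Θ n (s - a)) ((φ n).normed volume (s - a)) s := by
        exact (hΘd n (s - a)).comp_sub_const s a
      have h2 : HasDerivAt (fun s => Θ n (s - b)) ((φ n).normed volume (s - b)) s := by
        exact (hΘd n (s - b)).comp_sub_const s b
      exact (h1.sub h2).deriv
    have hint : ∀ x, IntegrableOn (fun t => (φ n).normed volume (t - x) * G t) (Ioo 0 r) := by
      intro x
      obtain ⟨K, hK⟩ : ∃ K, ∀ t, ‖(φ n).normed volume t‖ ≤ K :=
        (φ n).hasCompactSupport_normed.exists_bound_of_continuous (φ n).continuous_normed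
      refine Integrable.bdd_mul (c := K) hG ?_ (Eventually.of_forall fun t => hK _)
      exact ((φ n).continuous_normed.comp (continuous_id.sub continuous_const)).aestronglyMeasurable
    have e2 : ∫ s in Ioo 0 r, deriv χ s * G s = c n a - c n b := by
      rw [hc]
      simp only
      rw [← integral_sub (hint a) (hint b)]
      refine integral_congr_ae (Eventually.of_forall fun s => ?_)
      simp only [hderiv]
      ring
    have e3 : ∫ s in Ioo 0 r, χ s ≤ b - max a 0 + 2 * δ := by
      have h1 : ∫ s in Ioo 0 r, χ s ≤ ∫ s in Ioo 0 r, (Icc (max a 0 - δ) (b + δ)).indicator 1 s := by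
        refine setIntegral_mono_on (hχC.continuous.integrable_of_hasCompactSupport hcs).integrableOn
          ?_ measurableSet_Ioo ?_
        · refine Integrable.integrableOn ?_
          refine (integrable_indicator_iff measurableSet_Icc).2 ?_
          exact integrableOn_const (by simp)
        · intro s hs
          by_cases hsχ : s ∈ Function.support χ
          · have h2 := hsupp hsχ
            have h4 : s ∈ Icc (max a 0 - δ) (b + δ) := by
              refine ⟨?_, h2.2⟩
              rcases max_choice a 0 with h3 | h3 <;> rw [h3]
              · exact h2.1
              · linarith [hs.1]
            rw [indicator_of_mem h4]
            exact hχ1 s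
          · rw [Function.notMem_support.1 hsχ]
            exact indicator_nonneg (fun _ _ => zero_le_one) _
      refine h1.trans ?_
      rw [setIntegral_indicator measurableSet_Icc]
      simp only [Pi.one_apply, integral_const, smul_eq_mul, mul_one, MeasurableSet.univ,
        measureReal_restrict_apply, univ_inter]
      refine (measureReal_mono inter_subset_right (by simp)).trans ?_
      rw [Real.volume_real_Icc]
      refine max_le (by linarith) ?_
      rcases max_choice a 0 with h3 | h3 <;> rw [h3] <;> linarith
    have e4 := mul_le_mul_of_nonneg_left e3 hC
    rw [e2] at hmain
    simp only [hχ] at hmain e4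
    linarith
  have hΛ : ∀ᶠ x in essRightZero, x ∈ Ioo 0 r ∧ Tendsto (fun n => c n x) atTop (𝓝 (G x)) := by
    have h1 : ∀ᶠ x in essRightZero, Tendsto (fun n => c n x) atTop (𝓝 (Gt x)) :=
      mem_inf_of_right hconv
    filter_upwards [eventually_essRightZero_mem_Ioo hr, h1] with x hx h2
    refine ⟨hx, ?_⟩
    rwa [hGt, indicator_of_mem hx] at h2
  set Λ := {x | x ∈ Ioo 0 r ∧ Tendsto (fun n => c n x) atTop (𝓝 (G x))} with hΛdef
  have hzero : ∀ x, 0 < x → ∀ᶠ n in atTop, Θ n (0 - x) = 0 := by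
    intro x hx
    filter_upwards [hφout.eventually_lt_const hx] with n hn
    exact hΘ0 n _ (by linarith)
  have hmono : ∀ a ∈ Λ, ∀ b ∈ Λ, a ≤ b → G b - C * b ≤ G a - C * a := by
    intro a ha b hb hab
    have h1 : Tendsto (fun n => (c n a - c n b) + C * (b - max a 0 + 2 * (φ n).rOut)) atTop
        (𝓝 ((G a - G b) + C * (b - max a 0 + 2 * 0))) :=
      (ha.2.sub hb.2).add (((hφout.const_mul 2).const_add _).const_mul C)
    have h2 := ge_of_tendsto h1 (b := 0) (by
      filter_upwards [key a b (by linarith [ha.1.1]) hab hb.1.1 hb.1.2, hzero a ha.1.1,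
        hzero b hb.1.1] with n h3 h4 h5
      rw [h4, h5] at h3
      linarith)
    rw [max_eq_left ha.1.1.le] at h2
    linarith
  have hbdd : ∀ b ∈ Λ, G b - C * b ≤ c₀ := by
    intro b hb
    have h1 : Tendsto (fun n => (0 - c n b) + C * (b + 2 * (φ n).rOut) + c₀) atTop
        (𝓝 ((0 - G b) + C * (b + 2 * 0) + c₀)) :=
      ((tendsto_const_nhds.sub hb.2).add (((hφout.const_mul 2).const_add _).const_mul C)).add_const _
    -- For `a = -(r / 2)` the mollifier around `a` eventually misses `(0, r)`, so the contribution
    -- of `G` at `a` is zero, while `χ 0 = 1` brings in `c₀`.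
    have h2 := ge_of_tendsto h1 (b := 0) (by
      filter_upwards [key (-(r / 2)) b (by linarith) (by linarith [hb.1.1]) hb.1.1 hb.1.2,
        hφout.eventually_lt_const (half_pos hr), hzero b hb.1.1] with n h3 h4 h5
      have h6 : c n (-(r / 2)) = 0 := by
        refine setIntegral_eq_zero_of_forall_eq_zero fun t ht => ?_
        have : t - -(r / 2) ∉ Function.support ((φ n).normed volume) := by
          rw [(φ n).support_normed_eq, mem_ball_zero_iff, Real.norm_eq_abs, not_lt]
          exact le_trans (by linarith [ht.1]) (le_abs_self _)
        rw [Function.notMem_support.1 this, zero_mul]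
      rw [h5, h6, max_eq_right (by linarith), hΘ1 n _ (by linarith)] at h3
      linarith)
    linarith
  obtain ⟨x₀, hx₀⟩ := hΛ.exists
  set S := (fun s => G s - C * s) '' Λ with hS
  have hSb : BddAbove S := ⟨c₀, by rintro _ ⟨b, hb, rfl⟩; exact hbdd b hb⟩
  have hSn : S.Nonempty := ⟨_, x₀, hx₀, rfl⟩
  refine ⟨sSup S, csSup_le hSn (by rintro _ ⟨b, hb, rfl⟩; exact hbdd b hb), ?_⟩
  have hK : Tendsto (fun s => G s - C * s) essRightZero (𝓝 (sSup S)) := by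
    refine tendsto_order.2 ⟨fun y hy => ?_, fun y hy => ?_⟩
    · obtain ⟨_, ⟨a, ha, rfl⟩, hya⟩ := exists_lt_of_lt_csSup hSn hy
      filter_upwards [hΛ, eventually_essRightZero_mem_Ioo ha.1.1] with s hs hsa
      exact hya.trans_le (hmono s hs a ha hsa.2.le)
    · filter_upwards [hΛ] with s hs
      exact (le_csSup hSb ⟨s, hs, rfl⟩).trans_lt hy
  have hid : Tendsto (fun s : ℝ => C * s) essRightZero (𝓝 0) := by
    have h1 : Tendsto (fun s : ℝ => C * s) (𝓝 0) (𝓝 (C * 0)) := tendsto_id.const_mul C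
    rw [mul_zero] at h1
    exact h1.mono_left (inf_le_left.trans nhdsWithin_le_nhds)
  simpa using hK.add hid

/-! ### Parametric integrals on convex sets -/

theorem continuousOn_intervalIntegral {X F : Type} [TopologicalSpace X] [FirstCountableTopology X]
    [NormedAddCommGroup F] [NormedSpace ℝ F] {s : Set X} {G : X × ℝ → F}
    (hG : ContinuousOn G (s ×ˢ univ)) :
    ContinuousOn (fun p => ∫ θ in (0 : ℝ)..1, G (p, θ)) s := by
  rw [continuousOn_iff_continuous_domRestrict]
  have h1 : Continuous (fun q : s × ℝ => G (q.1, q.2)) := by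
    refine hG.comp_continuous (by fun_prop) fun q => ⟨q.1.2, mem_univ _⟩
  exact intervalIntegral.continuous_parametric_intervalIntegral_of_continuous'
    (f := fun (p : s) θ => G (p, θ)) h1 0 1

/-- By compactness of `[0, 1]`, `G'` is close to its value at `p` uniformly in `θ` near `p`. The
mean value inequality on the convex set `s ∩ ball p δ` then gives an error `ε ‖q - p‖` uniform in
`θ`. This is where convexity of `s` enters: one-sided derivatives at boundary points of `s` are
allowed. -/
theorem hasFDerivWithinAt_intervalIntegral {X F : Type} [NormedAddCommGroup X] [NormedSpace ℝ X]
    [NormedAddCommGroup F] [NormedSpace ℝ F] [CompleteSpace F] {s : Set X} (hs : Convex ℝ s)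
    {G : X × ℝ → F}
    {G' : X × ℝ → X →L[ℝ] F} (hG : ContinuousOn G (s ×ˢ univ)) (hG' : ContinuousOn G' (s ×ˢ univ))
    (hd : ∀ p ∈ s, ∀ θ, HasFDerivWithinAt (fun q => G (q, θ)) (G' (p, θ)) s p) {p : X}
    (hp : p ∈ s) :
    HasFDerivWithinAt (fun p => ∫ θ in (0 : ℝ)..1, G (p, θ)) (∫ θ in (0 : ℝ)..1, G' (p, θ)) s p := by
  have hslice : ∀ {H : Type} [NormedAddCommGroup H] {g : X × ℝ → H}, ContinuousOn g (s ×ˢ univ) →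
      ∀ q ∈ s, Continuous fun θ => g (q, θ) := by
    intro H _ g hg q hq
    exact hg.comp_continuous (by fun_prop) fun θ => ⟨hq, mem_univ _⟩
  rw [hasFDerivWithinAt_iff_isLittleO, Asymptotics.isLittleO_iff]
  intro ε hε
  have htube : ∀ᶠ q in 𝓝 p, ∀ θ ∈ Icc (0 : ℝ) 1, q ∈ s → ‖G' (q, θ) - G' (p, θ)‖ ≤ ε := by
    refine isCompact_Icc.eventually_forall_of_forall_eventually fun θ _ => ?_
    have h1 := Metric.continuousWithinAt_iff.1 (hG' (p, θ) ⟨hp, mem_univ _⟩) (ε / 2) (half_pos hε)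
    obtain ⟨δ, hδ, h2⟩ := h1
    filter_upwards [Metric.ball_mem_nhds (p, θ) hδ] with z hz hzs
    have h3 := h2 (x := z) ⟨hzs, mem_univ _⟩ hz
    have h4 := h2 (x := (p, z.2)) ⟨hp, mem_univ _⟩ (by
      rw [Metric.mem_ball, Prod.dist_eq, max_lt_iff] at hz
      rw [Prod.dist_eq, max_lt_iff]
      simpa [hδ] using hz.2)
    rw [← dist_eq_norm]
    calc dist (G' (z.1, z.2)) (G' (p, z.2))
        ≤ dist (G' (z.1, z.2)) (G' (p, θ)) + dist (G' (p, z.2)) (G' (p, θ)) :=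
          dist_triangle_right _ _ _
      _ ≤ ε := by linarith
  obtain ⟨δ, hδ, hball⟩ := Metric.eventually_nhds_iff_ball.1 htube
  filter_upwards [self_mem_nhdsWithin, mem_nhdsWithin_of_mem_nhds (Metric.ball_mem_nhds p hδ)]
    with q hq hqδ
  have hi : ∀ q ∈ s, IntervalIntegrable (fun θ => G (q, θ)) volume 0 1 := fun q hq =>
    (hslice hG q hq).intervalIntegrable _ _
  have hi' : IntervalIntegrable (fun θ => G' (p, θ)) volume 0 1 :=
    (hslice hG' p hp).intervalIntegrable _ _
  have hi'' : IntervalIntegrable (fun θ => G' (p, θ) (q - p)) volume 0 1 :=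
    ((hslice hG' p hp).clm_apply continuous_const).intervalIntegrable _ _
  rw [ContinuousLinearMap.intervalIntegral_apply hi', ← intervalIntegral.integral_sub (hi q hq) (hi p hp),
    ← intervalIntegral.integral_sub ((hi q hq).sub (hi p hp)) hi'']
  have hb : ∀ θ ∈ uIoc (0 : ℝ) 1, ‖G (q, θ) - G (p, θ) - G' (p, θ) (q - p)‖ ≤ ε * ‖q - p‖ := by
    intro θ hθ
    rw [uIoc_of_le zero_le_one] at hθ
    refine (hs.inter (convex_ball p δ)).norm_image_sub_le_of_norm_hasFDerivWithin_le'
      (f := fun q => G (q, θ)) (f' := fun q => G' (q, θ))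
      (fun x hx => (hd x hx.1 θ).mono inter_subset_left) (fun x hx => ?_)
      ⟨hp, Metric.mem_ball_self hδ⟩ ⟨hq, hqδ⟩
    exact hball x hx.2 θ ⟨hθ.1.le, hθ.2⟩ hx.1
  simpa using intervalIntegral.norm_integral_le_of_norm_le_const hb

/-- Induction on the order, the derivative being again an integral of this kind with values in `X
→L[ℝ] F`. This is why `F` varies inside the induction and shares a universe with `X`. Convexity with
nonempty interior gives uniqueness of derivatives. -/
theorem contDiffOn_intervalIntegral (n : ℕ) : ∀ {X F : Type} [NormedAddCommGroup X]
    [NormedSpace ℝ X] [NormedAddCommGroup F] [NormedSpace ℝ F] [CompleteSpace F] {s : Set X}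
    (_ : Convex ℝ s) (_ : (interior s).Nonempty) {G : X × ℝ → F}
    (_ : ContDiffOn ℝ n G (s ×ˢ univ)),
    ContDiffOn ℝ n (fun p => ∫ θ in (0 : ℝ)..1, G (p, θ)) s := by
  induction n with
  | zero =>
    intro X F _ _ _ _ _ s _ _ G hG
    simp only [Nat.cast_zero, contDiffOn_zero] at hG ⊢
    exact continuousOn_intervalIntegral hG
  | succ n ih =>
    intro X F _ _ _ _ _ s hs hsi G hG
    have hu : UniqueDiffOn ℝ s := uniqueDiffOn_convex hs hsi
    have hu2 : UniqueDiffOn ℝ (s ×ˢ (univ : Set ℝ)) := hu.prod uniqueDiffOn_univ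
    push_cast at hG ⊢
    obtain ⟨-, D, hD, hGD⟩ := (contDiffOn_succ_iff_hasFDerivWithinAt_of_uniqueDiffOn hu2).1 hG
    refine (contDiffOn_succ_iff_hasFDerivWithinAt_of_uniqueDiffOn hu).2 ⟨by simp,
      fun p => ∫ θ in (0 : ℝ)..1, D (p, θ) ∘L ContinuousLinearMap.inl ℝ X ℝ, ?_, ?_⟩
    · exact ih hs hsi (G := fun q => D q ∘L ContinuousLinearMap.inl ℝ X ℝ)
        (hD.clm_comp contDiffOn_const)
    · intro p hp
      refine hasFDerivWithinAt_intervalIntegral hs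
        (G' := fun q => D q ∘L ContinuousLinearMap.inl ℝ X ℝ) hG.continuousOn
        (hD.continuousOn.clm_comp continuousOn_const) ?_ hp
      intro q hq θ
      have h1 : HasFDerivWithinAt (fun q : X => (q, θ)) (ContinuousLinearMap.inl ℝ X ℝ) s q := by
        exact (hasFDerivWithinAt_id q s).prodMk (hasFDerivWithinAt_const θ q s)
      exact HasFDerivWithinAt.comp q (hGD (q, θ) ⟨hq, mem_univ _⟩) h1
        fun x hx => ⟨hx, mem_univ _⟩

/-- `∫_w^z k(y - w) f(t, x, y) dy`, with the integration variable normalised to `[0, 1]`. -/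
def fluxPrimitive {N : ℕ} (f : ℝ → Space N → ℝ → Space N) (k : ℝ → ℝ) (t : ℝ) (x : Space N)
    (z w : ℝ) : Space N :=
  ∫ θ in (0 : ℝ)..1, ((z - w) * k (θ * (z - w))) • f t x (w + θ * (z - w))

theorem fluxPrimitive_eq {N : ℕ} (f : ℝ → Space N → ℝ → Space N) (k : ℝ → ℝ) (t : ℝ) (x : Space N)
    (z w : ℝ) : fluxPrimitive f k t x z w = ∫ y in w..z, k (y - w) • f t x y := by
  have h1 := intervalIntegral.smul_integral_comp_add_mul (a := 0) (b := 1)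
    (fun y => k (y - w) • f t x y) (z - w) w
  simp only [mul_zero, add_zero, mul_one, add_sub_cancel, add_sub_cancel_left] at h1
  rw [← h1, fluxPrimitive, ← intervalIntegral.integral_smul]
  refine intervalIntegral.integral_congr fun θ _ => ?_
  simp only [smul_smul]
  rw [mul_comm θ (z - w)]

/-- `closure Ω` is not convex, so the parametric integral is differentiated after pulling `x` back
to a convex set `C` by `a`, and the result is carried back by the local inverse `b`. -/
theorem contDiffWithinAt_fluxPrimitive_of_chart {N : ℕ} {T : ℝ} (hT : 0 < T) {Ω : Set (Space N)}
    {f : ℝ → Space N → ℝ → Space N} (hf : IsFlux T Ω f) {k : ℝ → ℝ} (hk : ContDiff ℝ 2 k)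
    {Z : Type} [NormedAddCommGroup Z] [NormedSpace ℝ Z] {C : Set Z} (hC : Convex ℝ C)
    (hCi : (interior C).Nonempty) {a : Z → Space N} (ha : ContDiffOn ℝ 2 a C)
    (haC : MapsTo a C (closure Ω)) {b : Space N → Z} {V : Set (Space N)}
    (hb : ContDiffOn ℝ 2 b (closure Ω ∩ V)) (hbC : MapsTo b (closure Ω ∩ V) C)
    (hab : ∀ x ∈ closure Ω ∩ V, a (b x) = x) {x : Space N} (hV : V ∈ 𝓝 x) {t z w : ℝ}
    (ht : t ∈ Icc 0 T) (hx : x ∈ closure Ω) :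
    ContDiffWithinAt ℝ 2
      (fun p : ℝ × Space N × ℝ × ℝ => fluxPrimitive f k p.1 p.2.1 p.2.2.1 p.2.2.2)
      (Icc 0 T ×ˢ closure Ω ×ˢ univ ×ˢ univ) (t, x, z, w) := by
  set S : Set (ℝ × Z × ℝ × ℝ) := Icc 0 T ×ˢ C ×ˢ univ ×ˢ univ with hS
  have hSc : Convex ℝ S := (convex_Icc 0 T).prod (hC.prod (convex_univ.prod convex_univ))
  have hSi : (interior S).Nonempty := by
    rw [hS, interior_prod_eq, interior_prod_eq, interior_prod_eq, interior_Icc, interior_univ]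
    exact (nonempty_Ioo.2 hT).prod (hCi.prod (univ_nonempty.prod univ_nonempty))
  have hG : ContDiffOn ℝ 2 (fun q : (ℝ × Z × ℝ × ℝ) × ℝ =>
      ((q.1.2.2.1 - q.1.2.2.2) * k (q.2 * (q.1.2.2.1 - q.1.2.2.2))) •
        f q.1.1 (a q.1.2.1) (q.1.2.2.2 + q.2 * (q.1.2.2.1 - q.1.2.2.2))) (S ×ˢ univ) := by
    refine ContDiffOn.fun_smul (ContDiff.contDiffOn (𝕜 := ℝ) ?_) ?_
    · have h1 : ContDiff ℝ 2 (fun q : (ℝ × Z × ℝ × ℝ) × ℝ => q.1.2.2.1 - q.1.2.2.2) := by fun_prop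
      have h2 : ContDiff ℝ 2 (fun q : (ℝ × Z × ℝ × ℝ) × ℝ =>
        q.2 * (q.1.2.2.1 - q.1.2.2.2)) := by fun_prop
      exact h1.mul (hk.comp h2)
    · refine hf.contDiffOn.comp (f := fun q : (ℝ × Z × ℝ × ℝ) × ℝ =>
        (q.1.1, a q.1.2.1, q.1.2.2.2 + q.2 * (q.1.2.2.1 - q.1.2.2.2))) ?_ ?_
      · refine ContDiffOn.prodMk (by fun_prop) (ContDiffOn.prodMk ?_ (by fun_prop))
        exact ha.comp (f := fun q : (ℝ × Z × ℝ × ℝ) × ℝ => q.1.2.1) (by fun_prop)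
          fun q hq => hq.1.2.1
      · intro q hq
        exact ⟨hq.1.1, haC hq.1.2.1, mem_univ _⟩
  have hK := contDiffOn_intervalIntegral 2 hSc hSi hG
  set U : Set (ℝ × Space N × ℝ × ℝ) := Icc 0 T ×ˢ (closure Ω ∩ V) ×ˢ univ ×ˢ univ with hU
  have hcomp : ContDiffOn ℝ 2
      (fun p : ℝ × Space N × ℝ × ℝ => fluxPrimitive f k p.1 p.2.1 p.2.2.1 p.2.2.2) U := by
    have h1 : ContDiffOn ℝ 2 (fun p : ℝ × Space N × ℝ × ℝ => (p.1, b p.2.1, p.2.2.1, p.2.2.2)) U := by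
      refine ContDiffOn.prodMk (by fun_prop) (ContDiffOn.prodMk ?_ (by fun_prop))
      exact hb.comp (f := fun q : ℝ × Space N × ℝ × ℝ => q.2.1) (by fun_prop) fun q hq => hq.2.1
    refine (hK.comp h1 fun p hp => ⟨hp.1, hbC hp.2.1, mem_univ _, mem_univ _⟩).congr ?_
    intro p hp
    simp only [Function.comp, fluxPrimitive, hab _ hp.2.1]
  refine (hcomp (t, x, z, w) ⟨ht, ⟨hx, mem_of_mem_nhds hV⟩, mem_univ _, mem_univ _⟩).mono_of_mem_nhdsWithin ?_
  have h2 : (fun p : ℝ × Space N × ℝ × ℝ => p.2.1) ⁻¹' V ∈ 𝓝 (t, x, z, w) :=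
    (continuous_fst.comp continuous_snd).continuousAt.preimage_mem_nhds hV
  filter_upwards [self_mem_nhdsWithin, mem_nhdsWithin_of_mem_nhds h2] with p hp hpV
  exact ⟨hp.1, ⟨hp.2.1, hpV⟩, hp.2.2⟩

/-- At interior points a ball and the identity serve as chart. At boundary points the half-box `B ×ˢ
Ico 0 r` corresponds to `closure Ω`, and it is convex. -/
theorem contDiffOn_fluxPrimitive {N : ℕ} (hN : 1 ≤ N) {T : ℝ} (hT : 0 < T) {Ω : Set (Space N)}
    (hΩ : IsOpen Ω) (hsm : HasSmoothBoundary Ω)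
    {f : ℝ → Space N → ℝ → Space N} (hf : IsFlux T Ω f) {k : ℝ → ℝ} (hk : ContDiff ℝ 2 k) :
    ContDiffOn ℝ 2
      (fun p : ℝ × Space N × ℝ × ℝ => fluxPrimitive f k p.1 p.2.1 p.2.2.1 p.2.2.2)
      (Icc 0 T ×ˢ closure Ω ×ˢ univ ×ˢ univ) := by
  rintro ⟨t, x, z, w⟩ ⟨ht, hx, -⟩
  have hcl : closure Ω = Ω ∪ frontier Ω := closure_eq_self_union_frontier Ω
  have hx' : x ∈ Ω ∪ frontier Ω := hcl ▸ hx
  rcases hx' with hxΩ | hxf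
  · obtain ⟨δ, hδ, hball⟩ := Metric.isOpen_iff.1 hΩ x hxΩ
    refine contDiffWithinAt_fluxPrimitive_of_chart hT hf hk (C := Metric.ball x δ)
      (convex_ball x δ) ?_ (a := id) contDiffOn_id (fun y hy => subset_closure (hball hy))
      (b := id) (V := Metric.ball x δ) contDiffOn_id (fun y hy => hy.2) (fun _ _ => rfl)
      (Metric.ball_mem_nhds x hδ) ht hx
    rw [Metric.isOpen_ball.interior_eq]
    exact Metric.nonempty_ball.2 hδ
  · obtain ⟨g, hg⟩ := hsm x hxf
    obtain ⟨e, B, r, J, M, he, hxe⟩ := exists_isBoundaryChart hN hΩ hxf hg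
    have hz := e.map_target hxe
    have hsub : B ×ˢ Ico 0 r ⊆ e.source := by
      rw [he.source_eq]
      exact prod_mono_right fun s hs => ⟨by linarith [hs.1, he.r_pos], hs.2⟩
    refine contDiffWithinAt_fluxPrimitive_of_chart hT hf hk (C := B ×ˢ Ico 0 r)
      (he.convex_base.prod (convex_Ico 0 r)) ?_ (a := e) (he.contDiffOn.mono hsub) ?_
      (b := e.symm) (V := e.target) (he.contDiffOn_symm.mono inter_subset_right) ?_
      (fun y hy => e.right_inv hy.2) (e.open_target.mem_nhds hxe) ht hx
    · rw [interior_prod_eq, he.isOpen_base.interior_eq, interior_Ico]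
      rw [he.source_eq] at hz
      exact Nonempty.prod ⟨_, hz.1⟩ (nonempty_Ioo.2 he.r_pos)
    · intro q hq
      rw [hcl]
      rcases hq.2.1.eq_or_lt with h0 | h0
      · exact Or.inr ((he.mem_frontier_iff q (hsub hq)).2 h0.symm)
      · exact Or.inl ((he.mem_iff q (hsub hq)).2 h0)
    · rintro y ⟨hy, hye⟩
      have hyz := e.map_target hye
      have hyz' := hyz
      rw [he.source_eq] at hyz'
      refine ⟨hyz'.1, ?_, hyz'.2.2⟩
      rw [hcl] at hy
      rcases hy with hy | hy
      · have := (he.mem_iff _ hyz).1 (by rwa [e.right_inv hye])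
        exact this.le
      · have := (he.mem_frontier_iff _ hyz).1 (by rwa [e.right_inv hye])
        exact this.ge

/-! ### Regularised semi-entropies -/

/-- A smooth convex approximation of `s^±` that agrees with it up to a constant for `|s| ≥ ε`. -/
structure IsSmoothPart (ε : ℝ) (sg h : ℝ → ℝ) : Prop where
  contDiff : ContDiff ℝ 4 h
  convex : ConvexOn ℝ univ h
  zero : h 0 = 0
  deriv_zero : deriv h 0 = 0
  deriv_deriv_nonneg : ∀ s, 0 ≤ deriv (deriv h) s
  abs_deriv_le : ∀ s, |deriv h s| ≤ 1
  abs_sub_le : ∀ s, |deriv h s - sg s| ≤ 1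
  deriv_eq : ∀ s, ε ≤ |s| → deriv h s = sg s
  deriv_deriv_eq : ∀ s, ε ≤ |s| → deriv (deriv h) s = 0

/-- The entropy flux of the entropy `(z, w) ↦ h (z - w)`. -/
def smoothFlux {N : ℕ} (f : ℝ → Space N → ℝ → Space N) (h : ℝ → ℝ) (t : ℝ) (x : Space N)
    (z w : ℝ) : Space N :=
  deriv h (z - w) • f t x z - fluxPrimitive f (deriv (deriv h)) t x z w

theorem IsFlux.hasDerivAt {N : ℕ} {T : ℝ} {Ω : Set (Space N)} {f : ℝ → Space N → ℝ → Space N}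
    (hf : IsFlux T Ω f) {t : ℝ} (ht : t ∈ Icc 0 T) {x : Space N} (hx : x ∈ closure Ω) (z : ℝ) :
    HasDerivAt (fun y => f t x y) (stateDeriv f t x z) z := by
  have h1 : ContDiff ℝ 2 (fun y => f t x y) := by
    rw [← contDiffOn_univ]
    exact hf.contDiffOn.comp (f := fun y : ℝ => (t, x, y)) (by fun_prop)
      fun y _ => ⟨ht, hx, mem_univ _⟩
  exact (h1.differentiable (by norm_num) z).hasDerivAt

/-- Integrating `h'(y-w) ∂_u f` by parts in `y` gives a flux containing no derivative of `f`, so `Q`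
is as regular as `f` itself. In the compatibility relation the term `h'' f` from the product rule
cancels against the derivative of the integral. -/
theorem isBoundaryEntropyPair_smoothFlux {N : ℕ} (hN : 1 ≤ N) {T : ℝ} (hT : 0 < T)
    {Ω : Set (Space N)} (hΩ : IsOpen Ω) (hsm : HasSmoothBoundary Ω)
    {f : ℝ → Space N → ℝ → Space N} (hf : IsFlux T Ω f) {h : ℝ → ℝ} {ε : ℝ} {sg : ℝ → ℝ}
    (hh : IsSmoothPart ε sg h) :
    IsBoundaryEntropyPair T Ω f (fun z w => h (z - w)) (smoothFlux f h) := by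
  have hd1 : ContDiff ℝ 3 (deriv h) := by
    have := hh.contDiff
    exact (contDiff_succ_iff_deriv (n := 3)).1 this |>.2.2
  have hd2 : ContDiff ℝ 2 (deriv (deriv h)) :=
    ((contDiff_succ_iff_deriv (n := 2)).1 hd1).2.2
  have hdh : ∀ z w, HasDerivAt (fun y => h (y - w)) (deriv h (z - w)) z := fun z w =>
    (hh.contDiff.differentiable (by norm_num) (z - w)).hasDerivAt.comp_sub_const z w
  refine ⟨?_, ?_, ?_, ?_, ?_, ?_, ?_⟩
  · exact (hh.contDiff.of_le (by norm_num)).comp (contDiff_fst.sub contDiff_snd)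
  · have hsub : ContDiff ℝ 2 (fun q : ℝ × Space N × ℝ × ℝ => q.2.2.1 - q.2.2.2) := by fun_prop
    have h1 : ContDiff ℝ 2 (fun q : ℝ × Space N × ℝ × ℝ => deriv h (q.2.2.1 - q.2.2.2)) :=
      (hd1.of_le (by norm_num)).comp hsub
    refine (h1.contDiffOn.smul ?_).sub (contDiffOn_fluxPrimitive hN hT hΩ hsm hf hd2)
    · exact hf.contDiffOn.comp (f := fun q : ℝ × Space N × ℝ × ℝ => (q.1, q.2.1, q.2.2.1))
        (by fun_prop) fun q hq => ⟨hq.1, hq.2.1, mem_univ _⟩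
  · intro w
    have := hh.convex.comp_affineMap (AffineMap.id ℝ ℝ - AffineMap.const ℝ ℝ w)
    simpa [Function.comp_def] using this
  · intro t ht x hx z w
    have hfd := hf.hasDerivAt ht hx
    have hfc : Continuous (fun y => f t x y) :=
      continuous_iff_continuousAt.2 fun y => (hfd y).continuousAt
    have hic : Continuous (fun y => deriv (deriv h) (y - w) • f t x y) :=
      (hd2.continuous.comp (continuous_id.sub continuous_const)).smul hfc
    have h1 : HasDerivAt (fun y => deriv h (y - w)) (deriv (deriv h) (z - w)) z :=
      (hd1.differentiable (by norm_num) (z - w)).hasDerivAt.comp_sub_const z w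
    have h2 : HasDerivAt (fun y => fluxPrimitive f (deriv (deriv h)) t x y w)
        (deriv (deriv h) (z - w) • f t x z) z := by
      simp only [fluxPrimitive_eq]
      exact intervalIntegral.integral_hasDerivAt_right (hic.intervalIntegrable _ _)
        (hic.stronglyMeasurableAtFilter _ _) hic.continuousAt
    have h3 := (h1.smul (hfd z)).sub h2
    rw [(hdh z w).deriv]
    have h4 : HasDerivAt (fun y => smoothFlux f h t x y w) (deriv h (z - w) • stateDeriv f t x z) z := by
      convert! h3 using 1
      rw [add_sub_cancel_right]
    exact h4.deriv
  · intro w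
    simp [hh.zero]
  · intro t _ x _ w
    simp [smoothFlux, fluxPrimitive, hh.deriv_zero]
  · intro w
    rw [(hdh w w).deriv, sub_self, hh.deriv_zero]

/-- The difference is `(h' - sg)(z-c)` times `f z - f c`, minus the integral of `h''(y-c)(f y - f
c)`. Both see only states within `ε` of `c`, where `f` varies by at most `δ`, and `h''` has total
mass `|h'| ≤ 1`. -/
theorem IsSmoothPart.norm_smoothFlux_sub_le {N : ℕ} {f : ℝ → Space N → ℝ → Space N} {h : ℝ → ℝ}
    {ε : ℝ} {sg : ℝ → ℝ} (hh : IsSmoothPart ε sg h) {t : ℝ} {x : Space N} {c z δ : ℝ}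
    (hfc : Continuous (fun y => f t x y)) (hδ : 0 ≤ δ)
    (hmod : ∀ y ∈ uIcc c z, |y - c| ≤ ε → ‖f t x y - f t x c‖ ≤ δ) :
    ‖smoothFlux f h t x z c - sg (z - c) • (f t x z - f t x c)‖ ≤ 2 * δ := by
  have hd1 : ContDiff ℝ 3 (deriv h) := (contDiff_succ_iff_deriv (n := 3)).1 hh.contDiff |>.2.2
  have hd2 : ContDiff ℝ 2 (deriv (deriv h)) :=
    ((contDiff_succ_iff_deriv (n := 2)).1 hd1).2.2
  have hkc : Continuous (fun y => deriv (deriv h) (y - c)) :=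
    hd2.continuous.comp (continuous_id.sub continuous_const)
  have hint : ∫ y in c..z, deriv (deriv h) (y - c) = deriv h (z - c) := by
    have h1 : ∀ y ∈ uIcc c z, HasDerivAt (fun y => deriv h (y - c)) (deriv (deriv h) (y - c)) y :=
      fun y _ => (hd1.differentiable (by norm_num) (y - c)).hasDerivAt.comp_sub_const y c
    rw [intervalIntegral.integral_eq_sub_of_hasDerivAt h1 (hkc.intervalIntegrable _ _), sub_self,
      hh.deriv_zero, sub_zero]
  have heq : smoothFlux f h t x z c - sg (z - c) • (f t x z - f t x c) =
      (deriv h (z - c) - sg (z - c)) • (f t x z - f t x c) -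
        ∫ y in c..z, deriv (deriv h) (y - c) • (f t x y - f t x c) := by
    have h1 : ∫ y in c..z, deriv (deriv h) (y - c) • (f t x y - f t x c) =
        fluxPrimitive f (deriv (deriv h)) t x z c - deriv h (z - c) • f t x c := by
      rw [fluxPrimitive_eq, ← hint, ← intervalIntegral.integral_smul_const,
        ← intervalIntegral.integral_sub ((hkc.fun_smul hfc).intervalIntegrable _ _)
          ((hkc.fun_smul continuous_const).intervalIntegrable _ _)]
      simp only [smul_sub]
    rw [h1, smoothFlux, sub_smul, smul_sub, smul_sub]
    abel
  rw [heq]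
  have hA : ‖(deriv h (z - c) - sg (z - c)) • (f t x z - f t x c)‖ ≤ δ := by
    rw [norm_smul, Real.norm_eq_abs]
    rcases le_total |z - c| ε with hle | hle
    · have h1 := mul_le_mul (hh.abs_sub_le (z - c)) (hmod z right_mem_uIcc hle) (norm_nonneg _)
        zero_le_one
      rwa [one_mul] at h1
    · rw [hh.deriv_eq _ hle, sub_self, abs_zero, zero_mul]
      exact hδ
  have hB : ‖∫ y in c..z, deriv (deriv h) (y - c) • (f t x y - f t x c)‖ ≤ δ := by
    have h1 : ‖∫ y in c..z, deriv (deriv h) (y - c) • (f t x y - f t x c)‖ ≤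
        |∫ y in c..z, deriv (deriv h) (y - c) * δ| := by
      refine intervalIntegral.norm_integral_le_abs_of_norm_le
        ((ae_restrict_mem measurableSet_uIoc).mono fun y hy => ?_)
        ((hkc.mul continuous_const).intervalIntegrable _ _)
      rw [norm_smul, Real.norm_eq_abs, abs_of_nonneg (hh.deriv_deriv_nonneg _)]
      rcases le_total |y - c| ε with hle | hle
      · exact mul_le_mul_of_nonneg_left (hmod y (uIoc_subset_uIcc hy) hle) (hh.deriv_deriv_nonneg _)
      · rw [hh.deriv_deriv_eq _ hle, zero_mul, zero_mul]
    rw [intervalIntegral.integral_mul_const, hint, abs_mul, abs_of_nonneg hδ] at h1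
    calc _ ≤ _ := h1
      _ ≤ 1 * δ := mul_le_mul_of_nonneg_right (hh.abs_deriv_le _) hδ
      _ = δ := one_mul _
  linarith [norm_sub_le ((deriv h (z - c) - sg (z - c)) • (f t x z - f t x c))
    (∫ y in c..z, deriv (deriv h) (y - c) • (f t x y - f t x c))]

/-- The primitive of a smooth step rising from `0` to `1` on `[0, ε]`. The transition lies to the
right of `0`, so that the approximation vanishes wherever `s⁺` does; otherwise the boundary datum
would not drop out. -/
theorem exists_isSmoothPart_sgnPlus {ε : ℝ} (hε : 0 < ε) :
    ∃ h, IsSmoothPart ε sgnPlus h ∧ ∀ s ≤ 0, h s = 0 := by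
  set η : ℝ → ℝ := fun s => Real.smoothTransition (s / ε) with hη
  have hηC : ContDiff ℝ 3 η := Real.smoothTransition.contDiff.comp (contDiff_id.div_const ε)
  have hηm : Monotone η := fun a b hab =>
    Real.smoothTransition.monotone (div_le_div_of_nonneg_right hab hε.le)
  have hη0 : ∀ s ≤ 0, η s = 0 := fun s hs =>
    Real.smoothTransition.zero_of_nonpos (div_nonpos_of_nonpos_of_nonneg hs hε.le)
  have hη1 : ∀ s, ε ≤ s → η s = 1 := fun s hs =>
    Real.smoothTransition.one_of_one_le ((one_le_div hε).2 hs)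
  set h : ℝ → ℝ := fun s => ∫ y in (0 : ℝ)..s, η y with hh
  have hd : ∀ s, HasDerivAt h (η s) s := fun s =>
    intervalIntegral.integral_hasDerivAt_right (hηC.continuous.intervalIntegrable _ _)
      (hηC.continuous.stronglyMeasurableAtFilter _ _) hηC.continuous.continuousAt
  have hdh : deriv h = η := funext fun s => (hd s).deriv
  have hηd : Differentiable ℝ η := hηC.differentiable (by norm_num)
  refine ⟨h, ⟨?_, ?_, by simp [hh], ?_, ?_, ?_, ?_, ?_, ?_⟩, ?_⟩
  · refine (contDiff_succ_iff_deriv (n := 3)).2 ⟨fun s => (hd s).differentiableAt, by norm_num, ?_⟩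
    rw [hdh]
    exact hηC
  · refine Monotone.convexOn_univ_of_deriv (fun s => (hd s).differentiableAt) ?_
    rw [hdh]
    exact hηm
  · rw [hdh, hη0 0 le_rfl]
  · intro s
    rw [hdh]
    exact hηm.deriv_nonneg
  · intro s
    rw [hdh, abs_of_nonneg (Real.smoothTransition.nonneg _)]
    exact Real.smoothTransition.le_one _
  · intro s
    have h0 : 0 ≤ η s := Real.smoothTransition.nonneg _
    have h1 : η s ≤ 1 := Real.smoothTransition.le_one _
    rw [hdh, sgnPlus, abs_le]
    split_ifs <;> constructor <;> linarith
  · intro s hs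
    rw [hdh, sgnPlus]
    split_ifs with hpos
    · exact hη1 s (by rwa [abs_of_pos hpos] at hs)
    · exact hη0 s (not_lt.1 hpos)
  -- Outside the open transition zone the step attains its extreme values `0` or `1`, so its
  -- derivative vanishes there, including at `s = ε`.
  · intro s hs
    rw [hdh]
    rcases le_total 0 s with h0 | h0
    · rw [abs_of_nonneg h0] at hs
      refine IsLocalMax.deriv_eq_zero (Eventually.of_forall fun y => ?_)
      rw [hη1 s hs]
      exact Real.smoothTransition.le_one _
    · refine IsLocalMin.deriv_eq_zero (Eventually.of_forall fun y => ?_)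
      rw [hη0 s h0]
      exact Real.smoothTransition.nonneg _
  · intro s hs
    refine intervalIntegral.integral_zero_ae (Eventually.of_forall fun y hy => hη0 y ?_)
    rw [uIoc_of_ge hs] at hy
    exact hy.2

theorem exists_isSmoothPart_sgnMinus {ε : ℝ} (hε : 0 < ε) :
    ∃ h, IsSmoothPart ε sgnMinus h ∧ ∀ s, 0 ≤ s → h s = 0 := by
  obtain ⟨h, hh, h0⟩ := exists_isSmoothPart_sgnPlus hε
  have hd1 : deriv (fun s => h (-s)) = fun s => -deriv h (-s) := funext fun s => deriv_comp_neg h s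
  have hd2 : deriv (deriv (fun s => h (-s))) = fun s => deriv (deriv h) (-s) := by
    rw [hd1]
    funext s
    rw [deriv.fun_neg, deriv_comp_neg, neg_neg]
  have hsg : ∀ s, sgnMinus s = -sgnPlus (-s) := by
    intro s
    simp only [sgnMinus, sgnPlus, neg_pos]
    split_ifs <;> simp
  refine ⟨fun s => h (-s), ⟨?_, ?_, ?_, ?_, ?_, ?_, ?_, ?_, ?_⟩, fun s hs => h0 _ (by linarith)⟩
  · exact hh.contDiff.comp contDiff_neg
  · have := hh.convex.comp_linearMap (-LinearMap.id : ℝ →ₗ[ℝ] ℝ)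
    simpa [Function.comp_def] using this
  · simp [hh.zero]
  · simp [hd1, hh.deriv_zero]
  · intro s
    rw [hd2]
    exact hh.deriv_deriv_nonneg _
  · intro s
    rw [hd1, abs_neg]
    exact hh.abs_deriv_le _
  · intro s
    rw [hd1, hsg, ← neg_sub_neg, neg_neg, neg_neg, abs_sub_comm, abs_sub_comm]
    exact (abs_sub_comm _ _).trans_le (hh.abs_sub_le _)
  · intro s hs
    rw [hd1, hsg]
    simp only [hh.deriv_eq (-s) (by rwa [abs_neg])]
  · intro s hs
    simp only [hd2, hh.deriv_deriv_eq (-s) (by rwa [abs_neg])]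

/-! ### Volume and surface measure in collar coordinates -/

theorem measurePreserving_withDensity_comp {α β : Type*} [MeasurableSpace α] [MeasurableSpace β]
    {μ : Measure α} {ν : Measure β} {φ : α → β} (h : MeasurePreserving φ μ ν)
    (he : MeasurableEmbedding φ) (k : β → ℝ≥0∞) :
    MeasurePreserving φ (μ.withDensity fun x => k (φ x)) (ν.withDensity k) := by
  refine ⟨h.measurable, ?_⟩
  ext A hA
  rw [Measure.map_apply h.measurable hA, withDensity_apply _ (h.measurable hA),
    withDensity_apply _ hA]
  exact h.setLIntegral_comp_preimage_emb he k A

/-- Lebesgue measure on `[0, T] × B`. -/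
def baseMeasure {N : ℕ} (T : ℝ) (B : Set (BaseSpace N)) : Measure (ℝ × BaseSpace N) :=
  ((volume : Measure ℝ).restrict (Icc 0 T)).prod ((volume : Measure (BaseSpace N)).restrict B)

/-- The collar coordinates `((t, y), s) ↦ (t, e (y, s))`, extended by zero. -/
def collarMap {N : ℕ} (e : OpenPartialHomeomorph (BaseSpace N × ℝ) (Space N))
    (B : Set (BaseSpace N)) (r : ℝ) (p : (ℝ × BaseSpace N) × ℝ) : ℝ × Space N :=
  (p.1.1, (B ×ˢ Ioo 0 r).indicator e (p.1.2, p.2))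

/-- The coordinates `(t, ξ) ↦ (t, y)` on the part of the lateral boundary covered by a chart. -/
def footMap {N : ℕ} (e : OpenPartialHomeomorph (BaseSpace N × ℝ) (Space N))
    (p : ℝ × Space N) : ℝ × BaseSpace N :=
  (p.1, e.target.indicator (fun x => (e.symm x).1) p.2)

/-- The inverse `(t, y) ↦ (t, e (y, 0))` of `footMap`, extended by zero. -/
def liftMap {N : ℕ} (e : OpenPartialHomeomorph (BaseSpace N × ℝ) (Space N))
    (B : Set (BaseSpace N)) (p : ℝ × BaseSpace N) : ℝ × Space N :=
  (p.1, B.indicator (fun y => e (y, 0)) p.2)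

theorem measurable_indicator_of_continuousOn {α β : Type*} [TopologicalSpace α]
    [MeasurableSpace α] [OpensMeasurableSpace α] [TopologicalSpace β] [MeasurableSpace β]
    [BorelSpace β] [Zero β] {s : Set α} (hs : MeasurableSet s) {f : α → β} (hf : ContinuousOn f s) :
    Measurable (s.indicator f) := by
  classical
  rw [← piecewise_eq_indicator]
  exact hf.measurable_piecewise continuousOn_const hs

namespace IsBoundaryChart

variable {N : ℕ} {Ω : Set (Space N)} {e : OpenPartialHomeomorph (BaseSpace N × ℝ) (Space N)}
  {B : Set (BaseSpace N)} {r : ℝ} {J : BaseSpace N × ℝ → ℝ} {M : ℝ}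

theorem mk_mem_source (he : IsBoundaryChart Ω e B r J M) {y : BaseSpace N} (hy : y ∈ B) {s : ℝ}
    (hs : s ∈ Ioo (-r) r) : (y, s) ∈ e.source := by
  rw [he.source_eq]
  exact ⟨hy, hs⟩

theorem zero_mem (he : IsBoundaryChart Ω e B r J M) : (0 : ℝ) ∈ Ioo (-r) r := by
  constructor <;> linarith [he.r_pos]

theorem mk_zero_mem_source (he : IsBoundaryChart Ω e B r J M) {y : BaseSpace N} (hy : y ∈ B) :
    (y, (0 : ℝ)) ∈ e.source := he.mk_mem_source hy he.zero_mem

theorem mk_mem_source_of_pos (he : IsBoundaryChart Ω e B r J M) {y : BaseSpace N} (hy : y ∈ B)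
    {s : ℝ} (hs : s ∈ Ioo 0 r) : (y, s) ∈ e.source :=
  he.mk_mem_source hy ⟨by linarith [he.r_pos, hs.1], hs.2⟩

/-- A nonpositive bound would force the differential of the chart to vanish, although it is
invertible. -/
theorem M_pos (he : IsBoundaryChart Ω e B r J M) {z : BaseSpace N × ℝ} (hz : z ∈ e.source) :
    0 < M := by
  by_contra! hcon
  have h1 := he.norm_fderiv_le z hz
  have h2 := norm_nonneg (fderiv ℝ e z)
  have h3 : M = 0 := by linarith
  have h4 := he.norm_fderiv_symm_le _ (e.map_source hz)
  have h5 := norm_nonneg (fderiv ℝ e.symm (e z))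
  have hA : fderiv ℝ e z = 0 := norm_eq_zero.1 (by linarith)
  have hD : HasFDerivAt e (fderiv ℝ e z) z :=
    ((he.contDiffOn.contDiffAt (e.open_source.mem_nhds hz)).differentiableAt (by norm_num)).hasFDerivAt
  have hS : HasFDerivAt e.symm (fderiv ℝ e.symm (e z)) (e z) :=
    ((he.contDiffOn_symm.contDiffAt (e.open_target.mem_nhds (e.map_source hz))).differentiableAt
      (by norm_num)).hasFDerivAt
  have h6 : HasFDerivAt (fun z => e.symm (e z)) (fderiv ℝ e.symm (e z) ∘L fderiv ℝ e z) z :=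
    hS.comp z hD
  have h7 : HasFDerivAt (fun z => e.symm (e z)) (ContinuousLinearMap.id ℝ _) z := by
    refine (hasFDerivAt_id _).congr_of_eventuallyEq ?_
    filter_upwards [e.open_source.mem_nhds hz] with z hz using e.left_inv hz
  -- The normal direction is nonzero even when `N = 1` and `BaseSpace N` is trivial.
  have h8 := congrArg (fun A => (A (0, 1)).2) (h6.unique h7)
  simp [hA] at h8

theorem image_eq (he : IsBoundaryChart Ω e B r J M) : e '' (B ×ˢ Ioo 0 r) = Ω ∩ e.target := by
  ext x
  constructor
  · rintro ⟨⟨y, s⟩, ⟨hy, hs⟩, rfl⟩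
    have hz := he.mk_mem_source_of_pos hy hs
    exact ⟨(he.mem_iff _ hz).2 hs.1, e.map_source hz⟩
  · rintro ⟨hx, hxe⟩
    have hz := e.map_target hxe
    have hpos := (he.mem_iff _ hz).1 (by rwa [e.right_inv hxe])
    refine ⟨e.symm x, ?_, e.right_inv hxe⟩
    rw [he.source_eq] at hz
    exact ⟨hz.1, hpos, hz.2.2⟩

theorem measurableSet_box (he : IsBoundaryChart Ω e B r J M) : MeasurableSet (B ×ˢ Ioo 0 r) :=
  he.isOpen_base.measurableSet.prod measurableSet_Ioo

theorem box_subset (he : IsBoundaryChart Ω e B r J M) : B ×ˢ Ioo 0 r ⊆ e.source :=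
  fun _ hz => he.mk_mem_source_of_pos hz.1 hz.2

theorem measurable_collarMap (he : IsBoundaryChart Ω e B r J M) : Measurable (collarMap e B r) := by
  refine Measurable.prodMk (by fun_prop) ?_
  exact (measurable_indicator_of_continuousOn he.measurableSet_box
    (e.continuousOn.mono he.box_subset)).comp (by fun_prop)

theorem measurePreserving_collarMap (he : IsBoundaryChart Ω e B r J M) (T : ℝ) :
    MeasurePreserving (collarMap e B r)
      (((baseMeasure T B).prod ((volume : Measure ℝ).restrict (Ioo 0 r))).withDensity
        fun p => ENNReal.ofReal (J (p.1.2, p.2)))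
      ((volume : Measure (ℝ × Space N)).restrict (Icc 0 T ×ˢ (Ω ∩ e.target))) := by
  have hm : Measurable ((B ×ˢ Ioo 0 r).indicator e) :=
    measurable_indicator_of_continuousOn he.measurableSet_box (e.continuousOn.mono he.box_subset)
  have hJm : AEMeasurable (fun z => ENNReal.ofReal (J z))
      ((volume : Measure (BaseSpace N × ℝ)).restrict (B ×ˢ Ioo 0 r)) :=
    ((he.continuousOn_density.mono he.box_subset).aemeasurable he.measurableSet_box).ennreal_ofReal
  have h1 : MeasurePreserving ((B ×ˢ Ioo 0 r).indicator e)
      ((volume.restrict (B ×ˢ Ioo 0 r)).withDensity fun z => ENNReal.ofReal (J z))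
      (volume.restrict (Ω ∩ e.target)) := by
    refine ⟨hm, ?_⟩
    rw [← he.image_eq, ← he.map_volume]
    refine Measure.map_congr ?_
    refine (withDensity_absolutelyContinuous _ _).ae_le ?_
    filter_upwards [ae_restrict_mem he.measurableSet_box] with z hz
    exact indicator_of_mem hz _
  have h2 := (MeasurePreserving.id ((volume : Measure ℝ).restrict (Icc 0 T))).prod h1
  rw [prod_withDensity_right₀ hJm] at h2
  rw [Measure.volume_eq_prod ℝ (Space N), ← Measure.prod_restrict]
  have h3 : MeasurePreserving MeasurableEquiv.prodAssoc
      ((baseMeasure T B).prod ((volume : Measure ℝ).restrict (Ioo 0 r)))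
      (((volume : Measure ℝ).restrict (Icc 0 T)).prod
        ((volume : Measure (BaseSpace N × ℝ)).restrict (B ×ˢ Ioo 0 r))) := by
    have := measurePreserving_prodAssoc ((volume : Measure ℝ).restrict (Icc 0 T))
      ((volume : Measure (BaseSpace N)).restrict B) ((volume : Measure ℝ).restrict (Ioo 0 r))
    rwa [Measure.prod_restrict B, ← Measure.volume_eq_prod] at this
  exact h2.comp (measurePreserving_withDensity_comp h3
    MeasurableEquiv.prodAssoc.measurableEmbedding (fun p => ENNReal.ofReal (J p.2)))

/-- The base point of a boundary point in a chart, extended by zero. -/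
abbrev foot (e : OpenPartialHomeomorph (BaseSpace N × ℝ) (Space N)) : Space N → BaseSpace N :=
  e.target.indicator fun x => (e.symm x).1

/-- The boundary point above a base point, extended by zero. -/
abbrev lift (e : OpenPartialHomeomorph (BaseSpace N × ℝ) (Space N)) (B : Set (BaseSpace N)) :
    BaseSpace N → Space N :=
  B.indicator fun y => e (y, 0)

theorem measurable_foot (e : OpenPartialHomeomorph (BaseSpace N × ℝ) (Space N)) :
    Measurable (foot e) :=
  measurable_indicator_of_continuousOn e.open_target.measurableSet
    (continuous_fst.comp_continuousOn e.continuousOn_symm)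

theorem measurable_lift (he : IsBoundaryChart Ω e B r J M) : Measurable (lift e B) :=
  measurable_indicator_of_continuousOn he.isOpen_base.measurableSet
    (e.continuousOn.comp (by fun_prop) fun _ hy => he.mk_zero_mem_source hy)

theorem foot_mem (he : IsBoundaryChart Ω e B r J M) {x : Space N}
    (hx : x ∈ frontier Ω ∩ e.target) : foot e x ∈ B ∧ lift e B (foot e x) = x := by
  obtain ⟨hxf, hxe⟩ := hx
  have hz := e.map_target hxe
  have h0 := (he.mem_frontier_iff _ hz).1 (by rwa [e.right_inv hxe])
  rw [he.source_eq] at hz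
  have h1 : foot e x = (e.symm x).1 := indicator_of_mem hxe _
  have h2 : foot e x ∈ B := h1 ▸ hz.1
  refine ⟨h2, ?_⟩
  rw [lift, indicator_of_mem h2, h1, ← h0]
  exact e.right_inv hxe

theorem ae_mem_frontier_inter (e : OpenPartialHomeomorph (BaseSpace N × ℝ) (Space N)) :
    ∀ᵐ x ∂((surfaceMeasure Ω).restrict e.target), x ∈ frontier Ω ∩ e.target := by
  rw [surfaceMeasure, Measure.restrict_restrict e.open_target.measurableSet, inter_comm _ (frontier Ω)]
  exact ae_restrict_mem (isClosed_frontier.measurableSet.inter e.open_target.measurableSet)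

/-- The boundary parametrization `y ↦ e (y, 0)` is `M`-Lipschitz, so it enlarges `(N-1)`-dimensional
Hausdorff measure by at most `M^(N-1)`. This one-sided bound replaces the area formula: it suffices
for a bounded density, and the exact density is never needed. -/
theorem exists_map_foot_le (he : IsBoundaryChart Ω e B r J M) :
    ∃ K : ℝ≥0, Measure.map (foot e) ((surfaceMeasure Ω).restrict e.target) ≤
      (K : ℝ≥0∞) • (volume : Measure (BaseSpace N)).restrict B := by
  -- An empty chart puts no constraint on `M`, and it meets no boundary points.
  have hM : 0 ≤ M ∨ B = ∅ := by
    rcases B.eq_empty_or_nonempty with h | ⟨y, hy⟩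
    · exact Or.inr h
    · exact Or.inl (he.M_pos (he.mk_zero_mem_source hy)).le
  rcases hM with hM | hB
  · have hlip : LipschitzOnWith M.toNNReal (fun y => e (y, 0)) B := by
      refine he.convex_base.lipschitzOnWith_of_nnnorm_hasFDerivWithin_le
        (f' := fun y => fderiv ℝ e (y, 0) ∘L ContinuousLinearMap.inl ℝ _ ℝ) ?_ ?_
      · intro y hy
        have hz := he.mk_zero_mem_source hy
        have hD : HasFDerivAt e (fderiv ℝ e (y, 0)) (y, 0) :=
          ((he.contDiffOn.contDiffAt (e.open_source.mem_nhds hz)).differentiableAt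
            (by norm_num)).hasFDerivAt
        have h1 : HasFDerivAt (fun y : BaseSpace N => (y, (0 : ℝ)))
            (ContinuousLinearMap.inl ℝ (BaseSpace N) ℝ) y :=
          (hasFDerivAt_id y).prodMk (hasFDerivAt_const 0 y)
        exact (hD.comp y h1).hasFDerivWithinAt
      · intro y hy
        have hz := he.mk_zero_mem_source hy
        rw [← NNReal.coe_le_coe, coe_nnnorm, Real.coe_toNNReal _ hM]
        refine (ContinuousLinearMap.opNorm_comp_le _ _).trans ?_
        have h2 := ContinuousLinearMap.norm_inl_le_one ℝ (BaseSpace N) ℝ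
        calc ‖fderiv ℝ e (y, 0)‖ * ‖ContinuousLinearMap.inl ℝ (BaseSpace N) ℝ‖
            ≤ M * 1 := mul_le_mul (he.norm_fderiv_le _ hz) h2 (norm_nonneg _) hM
          _ = M := mul_one M
    refine ⟨M.toNNReal ^ ((N - 1 : ℕ) : ℝ), ?_⟩
    refine Measure.le_iff.2 fun S hS => ?_
    rw [Measure.map_apply (measurable_foot e) hS, Measure.smul_apply, Measure.restrict_apply hS,
      Measure.restrict_apply ((measurable_foot e) hS), surfaceMeasure,
      Measure.restrict_apply (((measurable_foot e) hS).inter e.open_target.measurableSet)]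
    have hsub : foot e ⁻¹' S ∩ e.target ∩ frontier Ω ⊆ (fun y => e (y, 0)) '' (S ∩ B) := by
      rintro x ⟨⟨hxS, hxe⟩, hxf⟩
      obtain ⟨h1, h2⟩ := he.foot_mem ⟨hxf, hxe⟩
      refine ⟨foot e x, ⟨hxS, h1⟩, ?_⟩
      rw [lift, indicator_of_mem h1] at h2
      exact h2
    refine (measure_mono hsub).trans ?_
    rw [← EuclideanSpace.euclideanHausdorffMeasure_eq_volume,
      Measure.euclideanHausdorffMeasure_def, Measure.euclideanHausdorffMeasure_def,
      Measure.smul_apply, Measure.smul_apply, smul_comm]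
    have h3 := (hlip.mono (inter_subset_right (s := S))).hausdorffMeasure_image_le
      (d := ((N - 1 : ℕ) : ℝ)) (Nat.cast_nonneg _)
    have h4 : ((M.toNNReal ^ ((N - 1 : ℕ) : ℝ) : ℝ≥0) : ℝ≥0∞) =
        (M.toNNReal : ℝ≥0∞) ^ ((N - 1 : ℕ) : ℝ) :=
      (ENNReal.coe_rpow_of_nonneg _ (Nat.cast_nonneg _))
    rw [h4]
    exact smul_le_smul_of_nonneg_left h3 (zero_le)
  · refine ⟨0, ?_⟩
    have : (surfaceMeasure Ω).restrict e.target = 0 := by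
      rw [← Measure.measure_univ_eq_zero]
      refine measure_mono_null (t := (frontier Ω ∩ e.target)ᶜ) ?_ (ae_mem_frontier_inter e)
      intro x _ hx
      have := (he.foot_mem hx).1
      rw [hB] at this
      exact this
    rw [this]
    simp

theorem surfaceMeasure_target_lt_top (he : IsBoundaryChart Ω e B r J M) :
    surfaceMeasure Ω e.target < ⊤ := by
  obtain ⟨K, hK⟩ := he.exists_map_foot_le
  have h1 := hK univ
  rw [Measure.map_apply (measurable_foot e) MeasurableSet.univ, preimage_univ,
    Measure.restrict_apply_univ, Measure.smul_apply, Measure.restrict_apply_univ] at h1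
  exact h1.trans_lt (ENNReal.mul_lt_top ENNReal.coe_lt_top he.isBounded_base.measure_lt_top)

/-- The surface measure in the coordinates of a chart has a bounded density. -/
theorem exists_density (he : IsBoundaryChart Ω e B r J M) [IsFiniteMeasure (surfaceMeasure Ω)]
    (T : ℝ) :
    ∃ (k : BaseSpace N → ℝ) (K : ℝ), Measurable k ∧ (∀ y, 0 ≤ k y) ∧ (∀ y, k y ≤ K) ∧
      MeasurePreserving (footMap e) ((lateralMeasure T Ω).restrict (univ ×ˢ e.target))
        ((baseMeasure T B).withDensity fun p => ENNReal.ofReal (k p.2)) ∧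
      MeasurePreserving (liftMap e B)
        ((baseMeasure T B).withDensity fun p => ENNReal.ofReal (k p.2))
        ((lateralMeasure T Ω).restrict (univ ×ˢ e.target)) := by
  obtain ⟨K, hK⟩ := he.exists_map_foot_le
  set σ := (surfaceMeasure Ω).restrict e.target with hσ
  set μ := Measure.map (foot e) σ with hμ
  set ν := (volume : Measure (BaseSpace N)).restrict B with hν
  have : IsFiniteMeasure ν := ⟨by
    rw [hν, Measure.restrict_apply_univ]
    exact he.isBounded_base.measure_lt_top⟩
  have hac : μ ≪ ν := (Measure.absolutelyContinuous_of_le hK).trans Measure.smul_absolutelyContinuous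
  have hle : ∀ᵐ y ∂ν, μ.rnDeriv ν y ≤ K := by
    refine ae_le_of_forall_setLIntegral_le_of_sigmaFinite (g := fun _ => (K : ℝ≥0∞))
      (Measure.measurable_rnDeriv μ ν) fun S hS _ => ?_
    refine (Measure.setLIntegral_rnDeriv_le S).trans ((hK S).trans ?_)
    rw [setLIntegral_const]
    rfl
  -- Truncation at `K` makes the bound hold everywhere and changes the density only on a null set.
  set k : BaseSpace N → ℝ := fun y => min (μ.rnDeriv ν y).toReal K with hk
  have hkm : Measurable k := (Measure.measurable_rnDeriv μ ν).ennreal_toReal.min measurable_const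
  have hμk : μ = ν.withDensity fun y => ENNReal.ofReal (k y) := by
    refine (Measure.withDensity_rnDeriv_eq μ ν hac).symm.trans (withDensity_congr_ae ?_)
    filter_upwards [hle] with y hy
    have hfin : μ.rnDeriv ν y ≠ ⊤ := (hy.trans_lt ENNReal.coe_lt_top).ne
    have h1 : (μ.rnDeriv ν y).toReal ≤ K := ENNReal.toReal_le_coe_of_le_coe hy
    rw [hk]
    simp only
    rw [min_eq_left h1, ENNReal.ofReal_toReal hfin]
  have hlat : (lateralMeasure T Ω).restrict (univ ×ˢ e.target) =
      ((volume : Measure ℝ).restrict (Icc 0 T)).prod σ := by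
    rw [lateralMeasure, hσ, ← Measure.prod_restrict, Measure.restrict_univ]
  have hbase : (baseMeasure T B).withDensity (fun p => ENNReal.ofReal (k p.2)) =
      ((volume : Measure ℝ).restrict (Icc 0 T)).prod μ := by
    rw [hμk, baseMeasure, prod_withDensity_right hkm.ennreal_ofReal]
  rw [hlat]
  have hfootmp : MeasurePreserving (foot e) σ μ := ⟨measurable_foot e, rfl⟩
  have hliftmp : MeasurePreserving (lift e B) μ σ := by
    refine ⟨he.measurable_lift, ?_⟩
    rw [hμ, Measure.map_map he.measurable_lift (measurable_foot e)]
    have h1 : (lift e B ∘ foot e) =ᵐ[σ] id := by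
      filter_upwards [ae_mem_frontier_inter e] with x hx using (he.foot_mem hx).2
    rw [Measure.map_congr h1, Measure.map_id]
  refine ⟨k, K, hkm, fun y => le_min ENNReal.toReal_nonneg K.coe_nonneg, fun y => min_le_right _ _,
    ?_, ?_⟩
  · rw [hbase]
    exact (MeasurePreserving.id ((volume : Measure ℝ).restrict (Icc 0 T))).prod hfootmp
  · rw [hbase]
    exact (MeasurePreserving.id ((volume : Measure ℝ).restrict (Icc 0 T))).prod hliftmp

end IsBoundaryChart

theorem isFiniteMeasure_surfaceMeasure {N : ℕ} (hN : 1 ≤ N) {Ω : Set (Space N)} (hΩ : IsOpen Ω)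
    (hbdd : Bornology.IsBounded Ω) (hsm : HasSmoothBoundary Ω) :
    IsFiniteMeasure (surfaceMeasure Ω) := by
  have hcomp : IsCompact (frontier Ω) :=
    Metric.isCompact_of_isClosed_isBounded isClosed_frontier
      (hbdd.closure.subset frontier_subset_closure)
  have h1 : surfaceMeasure Ω (frontier Ω) < ⊤ := by
    refine hcomp.measure_lt_top_of_nhdsWithin fun x hx => ?_
    obtain ⟨g, hg⟩ := hsm x hx
    obtain ⟨e, B, r, J, M, he, hxe⟩ := exists_isBoundaryChart hN hΩ hx hg
    exact ⟨e.target, mem_nhdsWithin_of_mem_nhds (e.open_target.mem_nhds hxe),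
      he.surfaceMeasure_target_lt_top⟩
  refine ⟨?_⟩
  have h2 : surfaceMeasure Ω univ = surfaceMeasure Ω (frontier Ω) := by
    simp [surfaceMeasure]
  rwa [h2]

/-! ### Approximation of nonnegative `L¹` weights by `C¹` weights -/

open scoped Manifold in
theorem exists_contDiff_one_on_compact {E : Type*} [NormedAddCommGroup E] [NormedSpace ℝ E]
    [FiniteDimensional ℝ E] {K O : Set E} (hK : IsCompact K) (hO : IsOpen O) (hKO : K ⊆ O) :
    ∃ θ : E → ℝ, ContDiff ℝ 1 θ ∧ HasCompactSupport θ ∧ tsupport θ ⊆ O ∧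
      (∀ x, θ x ∈ Icc 0 1) ∧ ∀ x ∈ K, θ x = 1 := by
  obtain ⟨K', hK', hKK', hK'O⟩ := exists_compact_between hK hO hKO
  obtain ⟨θ, h1, h0, h01⟩ := exists_contMDiffMap_one_nhds_of_subset_interior (n := 1)
    𝓘(ℝ, E) hK.isClosed hKK'
  have hsupp : tsupport θ ⊆ K' :=
    closure_minimal (fun x hx => by_contra fun hxK => hx (h0 x hxK)) hK'.isClosed
  exact ⟨θ, θ.contMDiff.contDiff, hK'.of_isClosed_subset isClosed_closure hsupp,
    hsupp.trans hK'O, h01, fun x hx => h1.self_of_nhdsSet x hx⟩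

/-- Approximate `γ` in `L¹` by a smooth `g`, apply a smooth version `h` of the positive part, and
multiply by a cut-off `θ`. The map `h` is 1-Lipschitz and `δ`-close to the identity on `[0, ∞)`, so
`|γ - h(g)| ≤ δ + |γ - g|` because `γ ≥ 0`. -/
theorem exists_contDiff_nonneg_integral_sub_le {E : Type*} [NormedAddCommGroup E]
    [NormedSpace ℝ E] [FiniteDimensional ℝ E] [MeasurableSpace E] [BorelSpace E] {μ : Measure E}
    [μ.Regular] {O : Set E} (hO : IsOpen O) (hμO : μ O ≠ ⊤) {γ : E → ℝ}
    (hγ : IntegrableOn γ O μ) (hγ0 : ∀ᵐ x ∂(μ.restrict O), 0 ≤ γ x) {ε : ℝ} (hε : 0 < ε) :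
    ∃ κ : E → ℝ, ContDiff ℝ 1 κ ∧ HasCompactSupport κ ∧ tsupport κ ⊆ O ∧ (∀ x, 0 ≤ κ x) ∧
      ∫ x in O, |γ x - κ x| ∂μ ≤ ε := by
  have hfin : IsFiniteMeasure (μ.restrict O) := ⟨by
    rw [Measure.restrict_apply_univ]
    exact hμO.lt_top⟩
  obtain ⟨g, hgs, hgC, hgε⟩ := MemLp.exist_eLpNorm_sub_le (μ := μ.restrict O) (p := 1) (by simp)
    le_rfl (memLp_one_iff_integrable.2 hγ) (ε := ε / 4) (by positivity)
  set m := (μ.restrict O).real univ with hm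
  have hm0 : 0 ≤ m := measureReal_nonneg
  -- Three errors of at most `ε / 4` each: `m * δ` from `h`, the `L¹` error of `g`, and the mass
  -- removed by the cut-off.
  set δ := ε / (4 * (m + 1)) with hδ
  have hδ0 : 0 < δ := by positivity
  obtain ⟨h, hh, hh0⟩ := exists_isSmoothPart_sgnPlus hδ0
  have hhd : Differentiable ℝ h := hh.contDiff.differentiable (by norm_num)
  have hlip : ∀ a b, |h a - h b| ≤ |a - b| := by
    intro a b
    have := Convex.norm_image_sub_le_of_norm_deriv_le (f := h) (C := 1) (s := univ) (x := b) (y := a)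
      (fun x _ => hhd x) (fun x _ => hh.abs_deriv_le x) convex_univ (mem_univ _) (mem_univ _)
    simpa using this
  have hmono : Monotone h := by
    refine monotone_of_deriv_nonneg hhd fun s => ?_
    have h2 : Monotone (deriv h) := monotone_of_deriv_nonneg
      (((contDiff_succ_iff_deriv (n := 3)).1 hh.contDiff).2.2.differentiable (by norm_num))
      hh.deriv_deriv_nonneg
    rcases le_total 0 s with hs | hs
    · exact hh.deriv_zero ▸ h2 hs
    · have : deriv h (min s (-δ)) = 0 := by
        rw [hh.deriv_eq _ (by
          rw [abs_of_nonpos ((min_le_left _ _).trans hs)]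
          linarith [min_le_right s (-δ)]), sgnPlus, if_neg]
        exact not_lt.2 ((min_le_left _ _).trans hs)
      exact this ▸ h2 (min_le_left _ _)
  have hnn : ∀ s, 0 ≤ h s := by
    intro s
    rcases le_total 0 s with hs | hs
    · exact hh.zero ▸ hmono hs
    · exact (hh0 s hs).ge
  -- `h` is close to the identity on the positive half-line
  have hclose : ∀ s, 0 ≤ s → |s - h s| ≤ δ := by
    intro s hs
    have hD : ∀ x, HasDerivAt (fun s => s - h s) (1 - deriv h x) x := fun x =>
      (hasDerivAt_id x).sub (hhd x).hasDerivAt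
    rcases le_total s δ with hsδ | hsδ
    · have h1 := (le_abs_self _).trans (hlip s 0)
      rw [hh.zero, sub_zero, sub_zero, abs_of_nonneg hs] at h1
      rw [abs_of_nonneg (by linarith)]
      linarith [hnn s]
    · have h1 : s - h s = δ - h δ := by
        have := Convex.norm_image_sub_le_of_norm_hasDerivWithin_le (f := fun s => s - h s)
          (f' := fun x => 1 - deriv h x) (C := 0) (s := Ici δ) (x := δ) (y := s)
          (fun x _ => (hD x).hasDerivWithinAt) (fun x hx => by
            have hx : δ ≤ x := hx
            rw [hh.deriv_eq x (by rwa [abs_of_nonneg (hδ0.le.trans hx)]), sgnPlus,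
              if_pos (hδ0.trans_le hx)]
            simp) (convex_Ici δ) self_mem_Ici hsδ
        rw [zero_mul, norm_le_zero_iff] at this
        exact sub_eq_zero.1 this
      have h2 := (le_abs_self _).trans (hlip δ 0)
      rw [hh.zero, sub_zero, sub_zero, abs_of_pos hδ0] at h2
      rw [h1, abs_of_nonneg (by linarith)]
      linarith [hnn δ]
  have hgi : Integrable g (μ.restrict O) :=
    hgC.continuous.integrable_of_hasCompactSupport hgs
  have hgγ : ∫ x in O, |γ x - g x| ∂μ ≤ ε / 4 := by
    have h1 : eLpNorm (γ - g) 1 (μ.restrict O) = ENNReal.ofReal (∫ x in O, |γ x - g x| ∂μ) := by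
      rw [eLpNorm_one_eq_lintegral_enorm]
      have := ofReal_integral_norm_eq_lintegral_enorm (hγ.sub hgi)
      simpa [Real.norm_eq_abs] using this.symm
    rw [h1] at hgε
    exact (ENNReal.ofReal_le_ofReal_iff (by positivity)).1 hgε
  have hhg : Continuous (fun x => h (g x)) := hh.contDiff.continuous.comp hgC.continuous
  have hhgs : HasCompactSupport (fun x => h (g x)) := hgs.comp_left hh.zero
  have hhgi : Integrable (fun x => h (g x)) (μ.restrict O) := hhg.integrable_of_hasCompactSupport hhgs
  obtain ⟨b, hb⟩ : ∃ b, ∀ x, ‖h (g x)‖ ≤ b := hhgs.exists_bound_of_continuous hhg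
  have hb0 : 0 ≤ b := (norm_nonneg _).trans (hb 0)
  -- cut-off
  obtain ⟨K, hKO, hK, hKμ⟩ : ∃ K ⊆ O, IsCompact K ∧ (μ (O \ K)).toReal * b ≤ ε / 4 := by
    set τ := ε / (4 * (b + 1)) with hτ
    have hτ0 : 0 < τ := by positivity
    obtain ⟨K, hKO, hK, hKlt⟩ := hO.measurableSet.exists_isCompact_sdiff_lt (μ := μ)
      hμO (ε := ENNReal.ofReal τ) (by simpa using hτ0)
    refine ⟨K, hKO, hK, ?_⟩
    have h1 : (μ (O \ K)).toReal ≤ τ := ENNReal.toReal_le_of_le_ofReal hτ0.le hKlt.le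
    calc (μ (O \ K)).toReal * b ≤ τ * (b + 1) :=
          mul_le_mul h1 (by linarith) hb0 hτ0.le
      _ = ε / 4 := by rw [hτ]; field_simp
  obtain ⟨θ, hθC, hθs, hθO, hθ01, hθ1⟩ := exists_contDiff_one_on_compact hK hO hKO
  refine ⟨fun x => θ x * h (g x), ?_, hθs.mul_right, ?_, ?_, ?_⟩
  · exact hθC.mul ((hh.contDiff.of_le (by norm_num)).comp (hgC.of_le ENat.LEInfty.out))
  · exact (closure_mono (Function.support_mul_subset_left _ _)).trans hθO
  · exact fun x => mul_nonneg (hθ01 x).1 (hnn _)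
  · have hpt : ∀ᵐ x ∂(μ.restrict O), |γ x - θ x * h (g x)| ≤
        δ + |γ x - g x| + (O \ K).indicator (fun _ => b) x := by
      filter_upwards [hγ0, ae_restrict_mem hO.measurableSet] with x hx hxO
      have e1 : |γ x - h (g x)| ≤ δ + |γ x - g x| :=
        (abs_sub_le _ (h (γ x)) _).trans (add_le_add (hclose _ hx) (hlip _ _))
      have e2 : |h (g x) - θ x * h (g x)| ≤ (O \ K).indicator (fun _ => b) x := by
        by_cases hxK : x ∈ K
        · rw [hθ1 x hxK, one_mul, sub_self, abs_zero]
          exact indicator_nonneg (fun _ _ => hb0) _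
        · rw [indicator_of_mem (show x ∈ O \ K from ⟨hxO, hxK⟩)]
          have h3 := hθ01 x
          have h4 := hb x
          rw [Real.norm_eq_abs, abs_of_nonneg (hnn _)] at h4
          have h5 : θ x * h (g x) ≤ 1 * h (g x) := mul_le_mul_of_nonneg_right h3.2 (hnn _)
          have h6 := mul_nonneg h3.1 (hnn (g x))
          rw [abs_of_nonneg (by linarith)]
          linarith
      exact (abs_sub_le _ (h (g x)) _).trans (add_le_add e1 e2)
    have hOK : MeasurableSet (O \ K) := hO.measurableSet.diff hK.isClosed.measurableSet
    have hi1 : Integrable (fun _ : E => δ) (μ.restrict O) := integrable_const δ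
    have hi2 : Integrable (fun x => |γ x - g x|) (μ.restrict O) := (hγ.sub hgi).abs
    have hi3 : Integrable ((O \ K).indicator fun _ => b) (μ.restrict O) :=
      (integrable_const b).indicator hOK
    have hκi : Integrable (fun x => |γ x - θ x * h (g x)|) (μ.restrict O) := by
      refine (hγ.sub ?_).abs
      exact (hθC.continuous.mul hhg).integrable_of_hasCompactSupport hθs.mul_right
    calc ∫ x in O, |γ x - θ x * h (g x)| ∂μ
        ≤ ∫ x in O, (δ + |γ x - g x| + (O \ K).indicator (fun _ => b) x) ∂μ :=
          integral_mono_ae hκi ((hi1.add hi2).add hi3) hpt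
      _ = m * δ + ∫ x in O, |γ x - g x| ∂μ + (μ (O \ K)).toReal * b := by
          have e1 : ∫ x in O, (δ + |γ x - g x| + (O \ K).indicator (fun _ => b) x) ∂μ =
              ∫ x in O, (δ + |γ x - g x|) ∂μ + ∫ x in O, (O \ K).indicator (fun _ => b) x ∂μ :=
            integral_add (hi1.add hi2) hi3
          rw [e1, integral_add hi1 hi2, integral_const, integral_indicator hOK, setIntegral_const,
            smul_eq_mul, smul_eq_mul, ← hm, measureReal_restrict_apply hOK,
            inter_eq_left.2 sdiff_subset]
          rfl
      _ ≤ ε := by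
          have : m * δ ≤ ε / 4 := by
            rw [hδ, mul_div_assoc', div_le_div_iff₀ (by positivity) (by positivity)]
            nlinarith
          linarith

theorem aemeasurable_comp_of_continuousOn {α β γ : Type*} [MeasurableSpace α] [TopologicalSpace β]
    [MeasurableSpace β] [OpensMeasurableSpace β] [TopologicalSpace γ] [MeasurableSpace γ]
    [BorelSpace γ] [Zero γ] {μ : Measure α} {S : Set β} {g : β → γ} {f : α → β}
    (hg : ContinuousOn g S) (hS : MeasurableSet S) (hf : AEMeasurable f μ)
    (hfS : ∀ᵐ x ∂μ, f x ∈ S) : AEMeasurable (fun x => g (f x)) μ := by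
  refine ((measurable_indicator_of_continuousOn hS hg).comp_aemeasurable hf).congr ?_
  filter_upwards [hfS] with x hx using indicator_of_mem hx g

/-! ### Test functions given in the coordinates of a chart -/

section TestFunction

variable {N : ℕ} {Ω : Set (Space N)} {e : OpenPartialHomeomorph (BaseSpace N × ℝ) (Space N)}
  {T : ℝ} {ψ : ℝ × BaseSpace N × ℝ → ℝ}

/-- The function `ψ`, given in the coordinates of a chart, as a function on `ℝ × ℝ^N`. -/
def chartTest (e : OpenPartialHomeomorph (BaseSpace N × ℝ) (Space N))
    (ψ : ℝ × BaseSpace N × ℝ → ℝ) (p : ℝ × Space N) : ℝ :=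
  ((univ : Set ℝ) ×ˢ e.target).indicator (fun p => ψ (p.1, e.symm p.2)) p

theorem chartTest_apply {p : ℝ × Space N} (hp : p.2 ∈ e.target) :
    chartTest e ψ p = ψ (p.1, e.symm p.2) :=
  indicator_of_mem (show p ∈ univ ×ˢ e.target from ⟨trivial, hp⟩) _

theorem chartTest_eq_zero {p : ℝ × Space N} (hp : p.2 ∉ e.target) : chartTest e ψ p = 0 :=
  indicator_of_notMem (fun h => hp h.2) _

theorem chartTest_nonneg (hψ : ∀ q, 0 ≤ ψ q) (p : ℝ × Space N) : 0 ≤ chartTest e ψ p :=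
  indicator_nonneg (fun _ _ => hψ _) p

theorem isCompact_tsupport_chartTest (hc : HasCompactSupport ψ)
    (hs : tsupport ψ ⊆ Ioo 0 T ×ˢ e.source) :
    IsCompact (tsupport (chartTest e ψ)) ∧ tsupport (chartTest e ψ) ⊆ Ioo 0 T ×ˢ e.target := by
  have hK : IsCompact ((fun p : ℝ × BaseSpace N × ℝ => (p.1, e p.2)) '' tsupport ψ) := by
    refine IsCompact.image_of_continuousOn hc ?_
    exact continuousOn_fst.prodMk
      (e.continuousOn.comp continuousOn_snd fun p hp => (hs hp).2)
  have hsub : tsupport (chartTest e ψ) ⊆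
      (fun p : ℝ × BaseSpace N × ℝ => (p.1, e p.2)) '' tsupport ψ := by
    refine closure_minimal (fun p hp => ?_) hK.isClosed
    have hpt : p.2 ∈ e.target := by
      by_contra hcon
      exact hp (chartTest_eq_zero hcon)
    rw [Function.mem_support, chartTest_apply hpt] at hp
    refine ⟨(p.1, e.symm p.2), subset_closure hp, ?_⟩
    simp [e.right_inv hpt]
  refine ⟨hK.of_isClosed_subset isClosed_closure hsub, hsub.trans ?_⟩
  rintro _ ⟨p, hp, rfl⟩
  exact ⟨(hs hp).1, e.map_source (hs hp).2⟩

/-- The extension by zero is smooth because the support is compact inside the range of the chart. -/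
theorem contDiff_chartTest (he : ContDiffOn ℝ 2 e.symm e.target) (hψ : ContDiff ℝ 1 ψ)
    (hc : HasCompactSupport ψ) (hs : tsupport ψ ⊆ Ioo 0 T ×ˢ e.source) :
    ContDiff ℝ 1 (chartTest e ψ) := by
  rw [contDiff_iff_contDiffAt]
  intro p
  by_cases hp : p.2 ∈ e.target
  · have h1 : ContDiffAt ℝ 1 (fun p : ℝ × Space N => ψ (p.1, e.symm p.2)) p := by
      refine hψ.contDiffAt.comp p (contDiffAt_fst.prodMk ?_)
      exact ContDiffAt.comp p ((he.contDiffAt (e.open_target.mem_nhds hp)).of_le (by norm_num))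
        contDiffAt_snd
    refine h1.congr_of_eventuallyEq ?_
    filter_upwards [continuous_snd.continuousAt.preimage_mem_nhds (e.open_target.mem_nhds hp)]
      with x hx using chartTest_apply hx
  · have h1 : p ∉ tsupport (chartTest e ψ) := fun h =>
      hp ((isCompact_tsupport_chartTest hc hs).2 h).2
    exact contDiffAt_const.congr_of_eventuallyEq (notMem_tsupport_iff_eventuallyEq.1 h1)

theorem isTestFunction_chartTest (he : ContDiffOn ℝ 2 e.symm e.target) (hψ : ContDiff ℝ 1 ψ)
    (hc : HasCompactSupport ψ) (hs : tsupport ψ ⊆ Ioo 0 T ×ˢ e.source) (h0 : ∀ q, 0 ≤ ψ q) :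
    IsTestFunction T (chartTest e ψ) where
  contDiff := contDiff_chartTest he hψ hc hs
  hasCompactSupport := (isCompact_tsupport_chartTest hc hs).1
  tsupport_subset := (isCompact_tsupport_chartTest hc hs).2.trans
    (prod_mono (fun _ h => h.2) (subset_univ _))
  nonneg := chartTest_nonneg h0

theorem timeDeriv_eq_fderiv {φ : ℝ × Space N → ℝ} {p : ℝ × Space N}
    (h : DifferentiableAt ℝ φ p) : timeDeriv φ p = fderiv ℝ φ p (1, 0) := by
  have h1 : HasDerivAt (fun s : ℝ => (s, p.2)) ((1 : ℝ), (0 : Space N)) p.1 :=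
    (hasDerivAt_id _).prodMk (hasDerivAt_const _ _)
  exact (h.hasFDerivAt.comp_hasDerivAt p.1 h1).deriv

theorem inner_spaceGrad_eq_fderiv {φ : ℝ × Space N → ℝ} {p : ℝ × Space N}
    (h : DifferentiableAt ℝ φ p) (v : Space N) :
    inner ℝ v (spaceGrad φ p) = fderiv ℝ φ p (0, v) := by
  have h1 : HasFDerivAt (fun y : Space N => (p.1, y)) (ContinuousLinearMap.inr ℝ ℝ (Space N)) p.2 :=
    (hasFDerivAt_const _ _).prodMk (hasFDerivAt_id _)
  have h2 := (h.hasFDerivAt.comp p.2 h1).fderiv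
  rw [real_inner_comm, spaceGrad, inner_gradient_eq_fderiv]
  exact congrArg (fun A => A v) h2

theorem fderiv_chartTest (he : ContDiffOn ℝ 2 e.symm e.target) (hψ : ContDiff ℝ 1 ψ)
    {p : ℝ × Space N} (hp : p.2 ∈ e.target) (v : ℝ × Space N) :
    fderiv ℝ (chartTest e ψ) p v =
      fderiv ℝ ψ (p.1, e.symm p.2) (v.1, fderiv ℝ e.symm p.2 v.2) := by
  have h1 : HasFDerivAt e.symm (fderiv ℝ e.symm p.2) p.2 :=
    ((he.contDiffAt (e.open_target.mem_nhds hp)).differentiableAt (by norm_num)).hasFDerivAt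
  have h2 : HasFDerivAt (fun p : ℝ × Space N => (p.1, e.symm p.2))
      ((ContinuousLinearMap.fst ℝ ℝ (Space N)).prod
        (fderiv ℝ e.symm p.2 ∘L ContinuousLinearMap.snd ℝ ℝ (Space N))) p :=
    hasFDerivAt_fst.prodMk (h1.comp p hasFDerivAt_snd)
  have h3 := ((hψ.differentiable (by norm_num) (p.1, e.symm p.2)).hasFDerivAt.comp p h2)
  have h4 : chartTest e ψ =ᶠ[𝓝 p] (fun p => ψ (p.1, e.symm p.2)) := by
    filter_upwards [continuous_snd.continuousAt.preimage_mem_nhds (e.open_target.mem_nhds hp)]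
      with x hx using chartTest_apply hx
  rw [h4.fderiv_eq]
  exact congrArg (fun A => A v) h3.fderiv

theorem fderiv_chartTest_eq_zero (hc : HasCompactSupport ψ)
    (hs : tsupport ψ ⊆ Ioo 0 T ×ˢ e.source) {p : ℝ × Space N} (hp : p.2 ∉ e.target) :
    fderiv ℝ (chartTest e ψ) p = 0 := by
  have h1 : p ∉ tsupport (chartTest e ψ) := fun h =>
    hp ((isCompact_tsupport_chartTest hc hs).2 h).2
  rw [(notMem_tsupport_iff_eventuallyEq.1 h1).fderiv_eq]
  exact fderiv_const_apply _

end TestFunction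

namespace IsBoundaryChart

variable {N : ℕ} {Ω : Set (Space N)} {e : OpenPartialHomeomorph (BaseSpace N × ℝ) (Space N)}
  {B : Set (BaseSpace N)} {r : ℝ} {J : BaseSpace N × ℝ → ℝ} {M T : ℝ}

theorem mem_closure (he : IsBoundaryChart Ω e B r J M) {y : BaseSpace N} (hy : y ∈ B) {s : ℝ}
    (hs : s ∈ Ico 0 r) : e (y, s) ∈ closure Ω := by
  have hz : (y, s) ∈ e.source :=
    he.mk_mem_source hy ⟨by linarith [he.r_pos, hs.1], hs.2⟩
  rcases hs.1.eq_or_lt with h | h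
  · exact frontier_subset_closure ((he.mem_frontier_iff _ hz).2 h.symm)
  · exact subset_closure ((he.mem_iff _ hz).2 h)

theorem J_pos (he : IsBoundaryChart Ω e B r J M) {z : BaseSpace N × ℝ} (hz : z ∈ e.source) :
    0 < J z := (inv_pos.2 (he.M_pos hz)).trans_le (he.le_density z hz)

theorem isFiniteMeasure_baseMeasure (he : IsBoundaryChart Ω e B r J M) (T : ℝ) :
    IsFiniteMeasure (baseMeasure T B) := by
  have : IsFiniteMeasure ((volume : Measure (BaseSpace N)).restrict B) := ⟨by
    rw [Measure.restrict_apply_univ]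
    exact he.isBounded_base.measure_lt_top⟩
  rw [baseMeasure]
  infer_instance

theorem ae_baseMeasure_mem (he : IsBoundaryChart Ω e B r J M) (T : ℝ) :
    ∀ᵐ p ∂(baseMeasure T B), p.1 ∈ Icc 0 T ∧ p.2 ∈ B := by
  rw [baseMeasure, Measure.prod_restrict]
  filter_upwards [ae_restrict_mem (measurableSet_Icc.prod he.isOpen_base.measurableSet)] with p hp
    using hp

theorem ae_collar_mem (he : IsBoundaryChart Ω e B r J M) (T : ℝ) :
    ∀ᵐ p ∂((baseMeasure T B).prod ((volume : Measure ℝ).restrict (Ioo 0 r))),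
      p.1.1 ∈ Icc 0 T ∧ p.1.2 ∈ B ∧ p.2 ∈ Ioo 0 r := by
  have h1 := Measure.quasiMeasurePreserving_fst (μ := baseMeasure T B)
    (ν := (volume : Measure ℝ).restrict (Ioo 0 r)) |>.ae (he.ae_baseMeasure_mem T)
  have h2 := Measure.quasiMeasurePreserving_snd (μ := baseMeasure T B)
    (ν := (volume : Measure ℝ).restrict (Ioo 0 r)) |>.ae (ae_restrict_mem measurableSet_Ioo)
  filter_upwards [h1, h2] with p hp1 hp2 using ⟨hp1.1, hp1.2, hp2⟩

theorem collarMap_apply {p : (ℝ × BaseSpace N) × ℝ} (hy : p.1.2 ∈ B) (hs : p.2 ∈ Ioo 0 r) :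
    collarMap e B r p = (p.1.1, e (p.1.2, p.2)) := by
  rw [collarMap, indicator_of_mem (show (p.1.2, p.2) ∈ B ×ˢ Ioo 0 r from ⟨hy, hs⟩)]

theorem aemeasurable_J (he : IsBoundaryChart Ω e B r J M) (T : ℝ) :
    AEMeasurable (fun p : (ℝ × BaseSpace N) × ℝ => J (p.1.2, p.2))
      ((baseMeasure T B).prod ((volume : Measure ℝ).restrict (Ioo 0 r))) := by
  have hf : AEMeasurable (fun p : (ℝ × BaseSpace N) × ℝ => (p.1.2, p.2))
      ((baseMeasure T B).prod ((volume : Measure ℝ).restrict (Ioo 0 r))) :=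
    Measurable.aemeasurable (by fun_prop)
  refine aemeasurable_comp_of_continuousOn (he.continuousOn_density.mono he.box_subset)
    he.measurableSet_box hf ?_
  filter_upwards [he.ae_collar_mem T] with p hp using ⟨hp.2.1, hp.2.2⟩

/-- The collar coordinates pull null sets of the cylinder back to null sets. -/
theorem quasiMeasurePreserving_collarMap (he : IsBoundaryChart Ω e B r J M) (T : ℝ) :
    Measure.QuasiMeasurePreserving (collarMap e B r)
      ((baseMeasure T B).prod ((volume : Measure ℝ).restrict (Ioo 0 r))) (cylinderMeasure T Ω) := by
  refine ⟨he.measurable_collarMap, ?_⟩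
  have h1 : (baseMeasure T B).prod ((volume : Measure ℝ).restrict (Ioo 0 r)) ≪
      ((baseMeasure T B).prod ((volume : Measure ℝ).restrict (Ioo 0 r))).withDensity
        fun p => ENNReal.ofReal (J (p.1.2, p.2)) := by
    refine withDensity_absolutelyContinuous' (he.aemeasurable_J T).ennreal_ofReal ?_
    filter_upwards [he.ae_collar_mem T] with p hp
    have := he.J_pos (he.mk_mem_source_of_pos hp.2.1 hp.2.2)
    simpa using this
  refine (h1.map he.measurable_collarMap).trans ?_
  rw [(he.measurePreserving_collarMap T).map_eq]
  exact (Measure.restrict_mono (prod_mono subset_rfl inter_subset_left) le_rfl).absolutelyContinuous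

theorem integral_collarMap (he : IsBoundaryChart Ω e B r J M) {g : ℝ × Space N → ℝ}
    (hg : AEStronglyMeasurable g (cylinderMeasure T Ω)) (h0 : ∀ p, p.2 ∉ e.target → g p = 0) :
    ∫ p, g p ∂(cylinderMeasure T Ω) = ∫ p, J (p.1.2, p.2) * g (collarMap e B r p)
      ∂((baseMeasure T B).prod ((volume : Measure ℝ).restrict (Ioo 0 r))) := by
  have hfin := he.isFiniteMeasure_baseMeasure T
  have h1 : ∫ p, g p ∂(cylinderMeasure T Ω) =
      ∫ p in Icc 0 T ×ˢ (Ω ∩ e.target), g p := by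
    have e1 : (volume : Measure (ℝ × Space N)).restrict (Icc 0 T ×ˢ (Ω ∩ e.target)) =
        (cylinderMeasure T Ω).restrict (univ ×ˢ e.target) := by
      rw [cylinderMeasure, Measure.restrict_restrict
        (MeasurableSet.univ.prod e.open_target.measurableSet), prod_inter_prod, univ_inter,
        inter_comm]
    rw [e1]
    refine (setIntegral_eq_integral_of_forall_compl_eq_zero fun p hp => h0 p fun hpt => ?_).symm
    exact hp ⟨trivial, hpt⟩
  have hg' : AEStronglyMeasurable g
      ((volume : Measure (ℝ × Space N)).restrict (Icc 0 T ×ˢ (Ω ∩ e.target))) :=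
    hg.mono_measure (Measure.restrict_mono (prod_mono subset_rfl inter_subset_left) le_rfl)
  rw [h1, ← (he.measurePreserving_collarMap T).map_eq] at *
  rw [integral_map he.measurable_collarMap.aemeasurable hg',
    integral_withDensity_eq_integral_toReal_smul₀ (he.aemeasurable_J T).ennreal_ofReal
      (Eventually.of_forall fun _ => ENNReal.ofReal_lt_top)]
  refine integral_congr_ae ?_
  filter_upwards [he.ae_collar_mem T] with p hp
  rw [ENNReal.toReal_ofReal (he.J_pos (he.mk_mem_source_of_pos hp.2.1 hp.2.2)).le, smul_eq_mul]

end IsBoundaryChart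

/-! ### The normal trace of the flux in one chart -/

/-- The weak inequality that a solution satisfies in the interior of the time interval, for the
spatial flux `q` and the boundary datum `hb`. -/
def FluxInequality {N : ℕ} (T : ℝ) (Ω : Set (Space N)) (q : ℝ → Space N → ℝ → Space N) (C L : ℝ)
    (hb : ℝ × Space N → ℝ) (u : ℝ → Space N → ℝ) : Prop :=
  ∀ φ : ℝ × Space N → ℝ, IsTestFunction T φ → tsupport φ ⊆ Ioo 0 T ×ˢ univ →
    0 ≤ (∫ p, inner ℝ (q p.1 p.2 (u p.1 p.2)) (spaceGrad φ p) ∂(cylinderMeasure T Ω))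
      + C * (∫ p, (|timeDeriv φ p| + φ p) ∂(cylinderMeasure T Ω))
      + L * ∫ p, hb p * φ p ∂(lateralMeasure T Ω)

theorem exists_norm_le_of_continuousOn {N : ℕ} {V : Type*} [NormedAddCommGroup V] {T U : ℝ}
    {Ω : Set (Space N)} (hbdd : Bornology.IsBounded Ω) {q : ℝ → Space N → ℝ → V}
    (hq : ContinuousOn (fun p : ℝ × Space N × ℝ => q p.1 p.2.1 p.2.2)
      (Icc 0 T ×ˢ closure Ω ×ˢ univ)) :
    ∃ Q, 0 ≤ Q ∧ ∀ t ∈ Icc 0 T, ∀ x ∈ closure Ω, ∀ z, |z| ≤ U → ‖q t x z‖ ≤ Q := by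
  have hK : IsCompact (Icc 0 T ×ˢ closure Ω ×ˢ Icc (-U) U) :=
    isCompact_Icc.prod (hbdd.isCompact_closure.prod isCompact_Icc)
  obtain ⟨Q, hQ⟩ := hK.exists_bound_of_continuousOn
    (hq.mono (prod_mono subset_rfl (prod_mono subset_rfl (subset_univ _))))
  refine ⟨max Q 0, le_max_right _ _, fun t ht x hx z hz => ?_⟩
  exact (hQ (t, x, z) ⟨ht, hx, abs_le.1 hz⟩).trans (le_max_left _ _)

theorem ae_cylinder_mem {N : ℕ} {T : ℝ} {Ω : Set (Space N)} (hΩ : IsOpen Ω) :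
    ∀ᵐ p ∂(cylinderMeasure T Ω), p.1 ∈ Icc 0 T ∧ p.2 ∈ Ω :=
  ae_restrict_mem (measurableSet_Icc.prod hΩ.measurableSet)

theorem aemeasurable_comp_state {N : ℕ} {T : ℝ} {Ω : Set (Space N)} {u : ℝ → Space N → ℝ}
    {V : Type*} [NormedAddCommGroup V] [MeasurableSpace V]
    [BorelSpace V] (hΩ : IsOpen Ω) {q : ℝ → Space N → ℝ → V}
    (hq : ContinuousOn (fun p : ℝ × Space N × ℝ => q p.1 p.2.1 p.2.2)
      (Icc 0 T ×ˢ closure Ω ×ˢ univ))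
    (hu : AEStronglyMeasurable (Function.uncurry u) (cylinderMeasure T Ω)) :
    AEMeasurable (fun p : ℝ × Space N => q p.1 p.2 (u p.1 p.2)) (cylinderMeasure T Ω) := by
  refine aemeasurable_comp_of_continuousOn hq
    (measurableSet_Icc.prod (isClosed_closure.measurableSet.prod .univ))
    (f := fun p : ℝ × Space N => (p.1, p.2, u p.1 p.2)) ?_ ?_
  · exact measurable_fst.aemeasurable.prodMk (measurable_snd.aemeasurable.prodMk hu.aemeasurable)
  · filter_upwards [ae_cylinder_mem hΩ] with p hp using ⟨hp.1, subset_closure hp.2, trivial⟩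

/-- The state `u`, in the collar coordinates, at distance `ρ` from the boundary. -/
def collarState {N : ℕ} (e : OpenPartialHomeomorph (BaseSpace N × ℝ) (Space N))
    (B : Set (BaseSpace N)) (r : ℝ) (u : ℝ → Space N → ℝ) (ρ : ℝ) (p : ℝ × BaseSpace N) : ℝ :=
  u (collarMap e B r (p, ρ)).1 (collarMap e B r (p, ρ)).2

/-- The component normal to the boundary of the flux `q`, in the coordinates of a chart. -/
def chartFlux {N : ℕ} (e : OpenPartialHomeomorph (BaseSpace N × ℝ) (Space N))
    (J : BaseSpace N × ℝ → ℝ) (q : ℝ → Space N → ℝ → Space N)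
    (p : ℝ × (BaseSpace N × ℝ) × ℝ) : ℝ :=
  J p.2.1 * (fderiv ℝ e.symm (e p.2.1) (q p.1 (e p.2.1) p.2.2)).2

theorem fderiv_mul_separated {E : Type*} [NormedAddCommGroup E] [NormedSpace ℝ E]
    {κ : ℝ × E → ℝ} {χ : ℝ → ℝ} (hκ : ContDiff ℝ 1 κ) (hχ : ContDiff ℝ 1 χ) (p v : ℝ × E × ℝ) :
    fderiv ℝ (fun p : ℝ × E × ℝ => κ (p.1, p.2.1) * χ p.2.2) p v =
      κ (p.1, p.2.1) * (deriv χ p.2.2 * v.2.2) +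
        χ p.2.2 * fderiv ℝ κ (p.1, p.2.1) (v.1, v.2.1) := by
  have h1 : HasFDerivAt (fun p : ℝ × E × ℝ => (p.1, p.2.1))
      ((ContinuousLinearMap.fst ℝ ℝ (E × ℝ)).prod
        (ContinuousLinearMap.fst ℝ E ℝ ∘L ContinuousLinearMap.snd ℝ ℝ (E × ℝ))) p :=
    hasFDerivAt_fst.prodMk (hasFDerivAt_fst.comp p hasFDerivAt_snd)
  have h2 : HasFDerivAt (fun p : ℝ × E × ℝ => p.2.2)
      (ContinuousLinearMap.snd ℝ E ℝ ∘L ContinuousLinearMap.snd ℝ ℝ (E × ℝ)) p :=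
    hasFDerivAt_snd.comp p hasFDerivAt_snd
  have h3 := (hκ.differentiable (by norm_num) (p.1, p.2.1)).hasFDerivAt.comp p h1
  have h4 := (hχ.differentiable (by norm_num) p.2.2).hasDerivAt.comp_hasFDerivAt p h2
  have h5 := congrArg (fun A => A v) (h3.mul h4).fderiv
  refine h5.trans ?_
  simp

namespace IsBoundaryChart

variable {N : ℕ} {Ω : Set (Space N)} {e : OpenPartialHomeomorph (BaseSpace N × ℝ) (Space N)}
  {B : Set (BaseSpace N)} {r : ℝ} {J : BaseSpace N × ℝ → ℝ} {M T : ℝ}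
  {q : ℝ → Space N → ℝ → Space N} {u : ℝ → Space N → ℝ} {U : ℝ}

theorem continuousOn_chartFlux (he : IsBoundaryChart Ω e B r J M)
    (hq : ContinuousOn (fun p : ℝ × Space N × ℝ => q p.1 p.2.1 p.2.2)
      (Icc 0 T ×ˢ closure Ω ×ˢ univ)) :
    ContinuousOn (chartFlux e J q) (Icc 0 T ×ˢ (B ×ˢ Ico 0 r) ×ˢ univ) := by
  have hsub : ∀ p ∈ Icc 0 T ×ˢ (B ×ˢ Ico 0 r) ×ˢ (univ : Set ℝ), p.2.1 ∈ e.source :=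
    fun p hp => he.mk_mem_source hp.2.1.1 ⟨by linarith [he.r_pos, hp.2.1.2.1], hp.2.1.2.2⟩
  have hz : ContinuousOn (fun p : ℝ × (BaseSpace N × ℝ) × ℝ => p.2.1)
      (Icc 0 T ×ˢ (B ×ˢ Ico 0 r) ×ˢ univ) := by fun_prop
  have he' := e.continuousOn.comp hz hsub
  have hD : ContinuousOn (fun p : ℝ × (BaseSpace N × ℝ) × ℝ => fderiv ℝ e.symm (e p.2.1))
      (Icc 0 T ×ˢ (B ×ˢ Ico 0 r) ×ˢ univ) :=
    (he.contDiffOn_symm.continuousOn_fderiv_of_isOpen e.open_target (by norm_num)).comp he'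
      fun p hp => e.map_source (hsub p hp)
  have hqe : ContinuousOn (fun p : ℝ × (BaseSpace N × ℝ) × ℝ => q p.1 (e p.2.1) p.2.2)
      (Icc 0 T ×ˢ (B ×ˢ Ico 0 r) ×ˢ univ) :=
    hq.comp (f := fun p : ℝ × (BaseSpace N × ℝ) × ℝ => (p.1, e p.2.1, p.2.2))
      (continuousOn_fst.prodMk (he'.prodMk (by fun_prop)))
      fun p hp => ⟨hp.1, he.mem_closure hp.2.1.1 hp.2.1.2, trivial⟩
  exact (he.continuousOn_density.comp hz hsub).mul (continuous_snd.comp_continuousOn (hD.clm_apply hqe))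

theorem measurableSet_chartDomain (he : IsBoundaryChart Ω e B r J M) :
    MeasurableSet (Icc 0 T ×ˢ (B ×ˢ Ico 0 r) ×ˢ (univ : Set ℝ)) :=
  measurableSet_Icc.prod ((he.isOpen_base.measurableSet.prod measurableSet_Ico).prod .univ)

theorem abs_chartFlux_le (he : IsBoundaryChart Ω e B r J M) {Q : ℝ}
    (hQ : ∀ t ∈ Icc 0 T, ∀ x ∈ closure Ω, ∀ z, |z| ≤ U → ‖q t x z‖ ≤ Q) {t : ℝ}
    (ht : t ∈ Icc 0 T) {y : BaseSpace N} (hy : y ∈ B) {s : ℝ} (hs : s ∈ Ico 0 r) {z : ℝ}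
    (hz : |z| ≤ U) : |chartFlux e J q (t, (y, s), z)| ≤ M * (M * Q) := by
  have hsrc : (y, s) ∈ e.source := he.mk_mem_source hy ⟨by linarith [he.r_pos, hs.1], hs.2⟩
  have h1 := hQ t ht _ (he.mem_closure hy hs) z hz
  have h2 : ‖fderiv ℝ e.symm (e (y, s)) (q t (e (y, s)) z)‖ ≤ M * Q :=
    ContinuousLinearMap.le_of_opNorm_le_of_le _ (he.norm_fderiv_symm_le _ (e.map_source hsrc)) h1
  rw [chartFlux, abs_mul, abs_of_pos (he.J_pos hsrc)]
  exact mul_le_mul (he.density_le _ hsrc) ((norm_snd_le _).trans h2) (abs_nonneg _)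
    (he.M_pos hsrc).le

theorem aemeasurable_collarState (he : IsBoundaryChart Ω e B r J M)
    (hu : AEStronglyMeasurable (Function.uncurry u) (cylinderMeasure T Ω)) :
    AEMeasurable (fun p : (ℝ × BaseSpace N) × ℝ => collarState e B r u p.2 p.1)
      ((baseMeasure T B).prod ((volume : Measure ℝ).restrict (Ioo 0 r))) :=
  (hu.comp_quasiMeasurePreserving (he.quasiMeasurePreserving_collarMap T)).aemeasurable

theorem ae_abs_collarState_le (he : IsBoundaryChart Ω e B r J M)
    (hU : ∀ᵐ p ∂(cylinderMeasure T Ω), |u p.1 p.2| ≤ U) :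
    ∀ᵐ p ∂((baseMeasure T B).prod ((volume : Measure ℝ).restrict (Ioo 0 r))),
      |collarState e B r u p.2 p.1| ≤ U :=
  (he.quasiMeasurePreserving_collarMap T).ae hU

theorem eventually_collarState (he : IsBoundaryChart Ω e B r J M)
    (hu : AEStronglyMeasurable (Function.uncurry u) (cylinderMeasure T Ω))
    (hU : ∀ᵐ p ∂(cylinderMeasure T Ω), |u p.1 p.2| ≤ U) :
    ∀ᶠ ρ in essRightZero, AEMeasurable (collarState e B r u ρ) (baseMeasure T B) ∧
      ∀ᵐ p ∂(baseMeasure T B), |collarState e B r u ρ p| ≤ U := by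
  have hfin := he.isFiniteMeasure_baseMeasure T
  refine eventually_essRightZero_of_ae he.r_pos ?_
  have h1 := (he.aemeasurable_collarState hu).aestronglyMeasurable.prod_swap
  have h2 : ∀ᵐ s ∂((volume : Measure ℝ).restrict (Ioo 0 r)), ∀ᵐ p ∂(baseMeasure T B),
      |collarState e B r u s p| ≤ U :=
    Measure.ae_ae_of_ae_prod (Measure.measurePreserving_swap.quasiMeasurePreserving.ae
      (he.ae_abs_collarState_le hU))
  filter_upwards [h1.prodMk_left, h2] with s hs1 hs2 using ⟨hs1.aemeasurable, hs2⟩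

theorem ae_lateral_mem [IsFiniteMeasure (surfaceMeasure Ω)] (e : OpenPartialHomeomorph (BaseSpace N × ℝ) (Space N)) :
    ∀ᵐ p ∂((lateralMeasure T Ω).restrict (univ ×ˢ e.target)),
      p.1 ∈ Icc 0 T ∧ p.2 ∈ frontier Ω ∩ e.target := by
  have hlat : (lateralMeasure T Ω).restrict (univ ×ˢ e.target) =
      ((volume : Measure ℝ).restrict (Icc 0 T)).prod ((surfaceMeasure Ω).restrict e.target) := by
    rw [lateralMeasure, ← Measure.prod_restrict, Measure.restrict_univ]
  rw [hlat]
  filter_upwards [Measure.quasiMeasurePreserving_fst.ae (ae_restrict_mem measurableSet_Icc),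
    Measure.quasiMeasurePreserving_snd.ae (ae_mem_frontier_inter e)] with p h1 h2 using ⟨h1, h2⟩

/-- The normal component of the flux, tested with `κ`, has a limit at the boundary. -/
theorem exists_tendsto_chartFlux [IsFiniteMeasure (surfaceMeasure Ω)]
    (he : IsBoundaryChart Ω e B r J M) (hΩ : IsOpen Ω)
    (hbdd : Bornology.IsBounded Ω)
    (hq : ContinuousOn (fun p : ℝ × Space N × ℝ => q p.1 p.2.1 p.2.2)
      (Icc 0 T ×ˢ closure Ω ×ˢ univ))
    (hu : AEStronglyMeasurable (Function.uncurry u) (cylinderMeasure T Ω))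
    (hU : ∀ᵐ p ∂(cylinderMeasure T Ω), |u p.1 p.2| ≤ U) {C L : ℝ} (hC : 0 ≤ C)
    {hb : ℝ × Space N → ℝ} (hineq : FluxInequality T Ω q C L hb u)
    {κ : ℝ × BaseSpace N → ℝ} (hκ : ContDiff ℝ 1 κ) (hκc : HasCompactSupport κ)
    (hκs : tsupport κ ⊆ Ioo 0 T ×ˢ B) (hκ0 : ∀ p, 0 ≤ κ p) :
    ∃ ℓ ≤ L * ∫ p, hb p * κ (footMap e p) ∂((lateralMeasure T Ω).restrict (univ ×ˢ e.target)),
      Tendsto (fun s => ∫ p, κ p * chartFlux e J q (p.1, (p.2, s), collarState e B r u s p)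
        ∂(baseMeasure T B)) essRightZero (𝓝 ℓ) := by
  have hfin := he.isFiniteMeasure_baseMeasure T
  rcases B.eq_empty_or_nonempty with hB | ⟨y₀, hy₀⟩
  · have ht : e.target = ∅ := by
      rw [← e.image_source_eq_target, he.source_eq, hB, empty_prod, image_empty]
    have h0 : baseMeasure T B = 0 := by simp [baseMeasure, hB]
    exact ⟨0, by simp [ht], by simp [h0]⟩
  have hM := he.M_pos (he.mk_zero_mem_source hy₀)
  obtain ⟨Q, hQ0, hQ⟩ := exists_norm_le_of_continuousOn (U := U) hbdd hq
  obtain ⟨k₀, hk₀⟩ : ∃ b, ∀ p, ‖κ p‖ ≤ b := hκc.exists_bound_of_continuous hκ.continuous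
  obtain ⟨k₁, hk₁⟩ : ∃ b, ∀ p, ‖fderiv ℝ κ p‖ ≤ b :=
    (hκc.fderiv ℝ).exists_bound_of_continuous (hκ.continuous_fderiv (by norm_num))
  have hk₀0 : 0 ≤ k₀ := (norm_nonneg _).trans (hk₀ 0)
  have hk₁0 : 0 ≤ k₁ := (norm_nonneg _).trans (hk₁ 0)
  set m := baseMeasure T B with hm
  set I := (volume : Measure ℝ).restrict (Ioo 0 r) with hI
  -- Integrated over the base at height `s`, this is the function `G` of one variable whose limit is
  -- sought.
  set P : (ℝ × BaseSpace N) × ℝ → ℝ := fun p =>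
    κ p.1 * chartFlux e J q (p.1.1, (p.1.2, p.2), collarState e B r u p.2 p.1) with hP
  have hws := he.aemeasurable_collarState (T := T) hu
  have hwU := he.ae_abs_collarState_le (T := T) hU
  have hmem := he.ae_collar_mem T
  have hPm : AEMeasurable P (m.prod I) := by
    refine AEMeasurable.mul ?_ ?_
    · exact (hκ.continuous.measurable.comp measurable_fst).aemeasurable
    · refine aemeasurable_comp_of_continuousOn (he.continuousOn_chartFlux hq)
        he.measurableSet_chartDomain
        (f := fun p : (ℝ × BaseSpace N) × ℝ =>
          (p.1.1, (p.1.2, p.2), collarState e B r u p.2 p.1)) ?_ ?_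
      · exact (Measurable.aemeasurable (by fun_prop)).prodMk
          ((Measurable.aemeasurable (by fun_prop)).prodMk hws)
      · filter_upwards [hmem] with p hp
        exact ⟨hp.1, ⟨hp.2.1, hp.2.2.1.le, hp.2.2.2⟩, trivial⟩
  have hPi : Integrable P (m.prod I) := by
    refine Integrable.of_bound hPm.aestronglyMeasurable (k₀ * (M * (M * Q))) ?_
    filter_upwards [hmem, hwU] with p hp hpU
    rw [hP, norm_mul]
    exact mul_le_mul (hk₀ _) (he.abs_chartFlux_le hQ hp.1 hp.2.1 ⟨hp.2.2.1.le, hp.2.2.2⟩ hpU)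
      (abs_nonneg _) hk₀0
  -- The first summand bounds the flux against the tangential derivatives of `κ`, the second the
  -- lower order terms. In both, `χ` enters without derivative.
  set C' : ℝ := (M * (k₁ * (M * Q)) + C * (M * (k₁ + k₀))) * m.real univ with hC'
  refine exists_tendsto_of_forall_integral_nonneg he.r_pos (C := C') (by positivity)
    hPi.integral_prod_right ?_
  intro χ hχ hχc hχ0 hχs
  set ψ : ℝ × BaseSpace N × ℝ → ℝ := fun p => κ (p.1, p.2.1) * χ p.2.2 with hψdef
  have hψ : ContDiff ℝ 1 ψ := (hκ.comp (by fun_prop)).mul (hχ.comp (by fun_prop))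
  have hK : IsCompact ((fun a : (ℝ × BaseSpace N) × ℝ => (a.1.1, a.1.2, a.2)) ''
      (tsupport κ ×ˢ tsupport χ)) :=
    (IsCompact.prod hκc hχc).image (by fun_prop)
  have hsub : tsupport ψ ⊆ (fun a : (ℝ × BaseSpace N) × ℝ => (a.1.1, a.1.2, a.2)) ''
      (tsupport κ ×ˢ tsupport χ) := by
    refine closure_minimal (fun p hp => ?_) hK.isClosed
    refine ⟨((p.1, p.2.1), p.2.2), ⟨subset_closure fun h => hp ?_, subset_closure fun h => hp ?_⟩,
      rfl⟩
    · simp only [hψdef, h, zero_mul]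
    · simp only [hψdef, h, mul_zero]
  have hψc : HasCompactSupport ψ := hK.of_isClosed_subset isClosed_closure hsub
  have hψs : tsupport ψ ⊆ Ioo 0 T ×ˢ e.source := by
    refine hsub.trans ?_
    rintro _ ⟨a, ⟨ha1, ha2⟩, rfl⟩
    exact ⟨(hκs ha1).1, he.mk_mem_source (hκs ha1).2 (hχs ha2)⟩
  have hψ0 : ∀ p, 0 ≤ ψ p := fun p => mul_nonneg (hκ0 _) (hχ0 _)
  set φ := chartTest e ψ with hφ
  have hφC : ContDiff ℝ 1 φ := contDiff_chartTest he.contDiffOn_symm hψ hψc hψs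
  have hφd : Differentiable ℝ φ := hφC.differentiable (by norm_num)
  have hφ' : Continuous (fderiv ℝ φ) := hφC.continuous_fderiv (by norm_num)
  have key := hineq φ (isTestFunction_chartTest he.contDiffOn_symm hψ hψc hψs hψ0)
    ((isCompact_tsupport_chartTest hψc hψs).2.trans (prod_mono subset_rfl (subset_univ _)))
  have hψ' : ∀ {p : (ℝ × BaseSpace N) × ℝ}, p.1.2 ∈ B → p.2 ∈ Ioo 0 r → ∀ v,
      fderiv ℝ φ (collarMap e B r p) v =
        κ p.1 * (deriv χ p.2 * (fderiv ℝ e.symm (e (p.1.2, p.2)) v.2).2) +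
          χ p.2 * fderiv ℝ κ p.1 (v.1, (fderiv ℝ e.symm (e (p.1.2, p.2)) v.2).1) := by
    intro p hy hs v
    have hsrc := he.mk_mem_source_of_pos hy hs
    rw [collarMap_apply hy hs, hφ, fderiv_chartTest he.contDiffOn_symm hψ (e.map_source hsrc),
      fderiv_mul_separated hκ hχ]
    simp only [e.left_inv hsrc]
  have hχi : Integrable (fun p : (ℝ × BaseSpace N) × ℝ => χ p.2) (m.prod I) := by
    obtain ⟨b, hb⟩ : ∃ b, ∀ p, ‖χ p‖ ≤ b := hχc.exists_bound_of_continuous hχ.continuous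
    exact Integrable.of_bound (hχ.continuous.comp continuous_snd).aestronglyMeasurable b
      (Eventually.of_forall fun p => hb _)
  have hχint : ∫ p, χ p.2 ∂(m.prod I) = m.real univ * ∫ s in Ioo 0 r, χ s := by
    have := integral_prod_mul (μ := m) (ν := I) (fun _ => (1 : ℝ)) χ
    simpa using this
  -- the spatial term
  have hgq : AEStronglyMeasurable
      (fun p : ℝ × Space N => inner ℝ (q p.1 p.2 (u p.1 p.2)) (spaceGrad φ p))
      (cylinderMeasure T Ω) := by
    have h1 := aemeasurable_comp_state hΩ hq hu
    have h2 : Continuous fun a : ((ℝ × Space N) →L[ℝ] ℝ) × Space N => a.1 (0, a.2) := by fun_prop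
    refine (h2.comp_aestronglyMeasurable
      (hφ'.aestronglyMeasurable.prodMk h1.aestronglyMeasurable)).congr ?_
    exact Eventually.of_forall fun p => (inner_spaceGrad_eq_fderiv (hφd p) _).symm
  have hI₁ : ∫ p, inner ℝ (q p.1 p.2 (u p.1 p.2)) (spaceGrad φ p) ∂(cylinderMeasure T Ω) ≤
      (∫ s in Ioo 0 r, deriv χ s * ∫ p, P (p, s) ∂m) +
        M * (k₁ * (M * Q)) * (m.real univ * ∫ s in Ioo 0 r, χ s) := by
    rw [he.integral_collarMap hgq]
    · set a : (ℝ × BaseSpace N) × ℝ → ℝ := fun p => J (p.1.2, p.2) *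
        inner ℝ (q (collarMap e B r p).1 (collarMap e B r p).2
          (u (collarMap e B r p).1 (collarMap e B r p).2)) (spaceGrad φ (collarMap e B r p)) with ha
      have ham : AEStronglyMeasurable a (m.prod I) :=
        (he.aemeasurable_J T).aestronglyMeasurable.mul
          (hgq.comp_quasiMeasurePreserving (he.quasiMeasurePreserving_collarMap T))
      obtain ⟨b, hb⟩ : ∃ b, ∀ s, ‖deriv χ s‖ ≤ b :=
        hχc.deriv.exists_bound_of_continuous (hχ.continuous_deriv_one)
      have hχP : Integrable (fun p : (ℝ × BaseSpace N) × ℝ => deriv χ p.2 * P p) (m.prod I) :=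
        hPi.bdd_mul ((hχ.continuous_deriv_one.comp continuous_snd).aestronglyMeasurable)
          (Eventually.of_forall fun p => hb _)
      have hle : ∀ᵐ p ∂(m.prod I), ‖a p - deriv χ p.2 * P p‖ ≤ M * (k₁ * (M * Q)) * χ p.2 := by
        filter_upwards [hmem, hwU] with p hp hpU
        have hsrc := he.mk_mem_source_of_pos hp.2.1 hp.2.2
        have hcl := collarMap_apply (e := e) hp.2.1 hp.2.2
        set v := q (collarMap e B r p).1 (collarMap e B r p).2
          (u (collarMap e B r p).1 (collarMap e B r p).2) with hv
        have hvQ : ‖v‖ ≤ Q := by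
          refine hQ _ (by rw [hcl]; exact hp.1) _ ?_ _ hpU
          rw [hcl]
          exact he.mem_closure hp.2.1 ⟨hp.2.2.1.le, hp.2.2.2⟩
        have hPv : P p = κ p.1 * (J (p.1.2, p.2) *
            (fderiv ℝ e.symm (e (p.1.2, p.2)) v).2) := by
          simp only [hP, chartFlux, collarState, hv, hcl]
        -- The part of the gradient falling on `χ` is exactly `deriv χ * P`; the remainder
        -- differentiates `κ` only and is bounded by a multiple of `χ`.
        have e1 : a p - deriv χ p.2 * P p = J (p.1.2, p.2) * (χ p.2 *
            fderiv ℝ κ p.1 (0, (fderiv ℝ e.symm (e (p.1.2, p.2)) v).1)) := by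
          rw [hPv]
          simp only [ha]
          rw [inner_spaceGrad_eq_fderiv (hφd _), hψ' hp.2.1 hp.2.2]
          ring
        have e2 : ‖fderiv ℝ e.symm (e (p.1.2, p.2)) v‖ ≤ M * Q :=
          ContinuousLinearMap.le_of_opNorm_le_of_le _
            (he.norm_fderiv_symm_le _ (e.map_source hsrc)) hvQ
        have e3 : ‖fderiv ℝ κ p.1 (0, (fderiv ℝ e.symm (e (p.1.2, p.2)) v).1)‖ ≤
            k₁ * (M * Q) := by
          refine ContinuousLinearMap.le_of_opNorm_le_of_le _ (hk₁ _) ?_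
          rw [Prod.norm_mk, norm_zero, max_eq_right (norm_nonneg _)]
          exact (norm_fst_le _).trans e2
        rw [e1, norm_mul, norm_mul, Real.norm_of_nonneg (he.J_pos hsrc).le,
          Real.norm_of_nonneg (hχ0 _)]
        calc J (p.1.2, p.2) * (χ p.2 * ‖_‖) ≤ M * (χ p.2 * (k₁ * (M * Q))) := by
              refine mul_le_mul (he.density_le _ hsrc) ?_ (by have := hχ0 p.2; positivity) hM.le
              exact mul_le_mul_of_nonneg_left e3 (hχ0 _)
          _ = _ := by ring
      have hRi : Integrable (fun p => a p - deriv χ p.2 * P p) (m.prod I) :=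
        (hχi.const_mul _).mono' (ham.sub hχP.aestronglyMeasurable) hle
      have e1 : ∫ p, a p ∂(m.prod I) = (∫ p, deriv χ p.2 * P p ∂(m.prod I)) +
          ∫ p, (a p - deriv χ p.2 * P p) ∂(m.prod I) := by
        rw [← integral_add hχP hRi]
        simp
      have e2 : ∫ p, (a p - deriv χ p.2 * P p) ∂(m.prod I) ≤
          M * (k₁ * (M * Q)) * (m.real univ * ∫ s in Ioo 0 r, χ s) := by
        rw [← hχint, ← integral_const_mul]
        exact (le_abs_self _).trans (norm_integral_le_of_norm_le (hχi.const_mul _) hle)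
      have e3 : ∫ p, deriv χ p.2 * P p ∂(m.prod I) =
          ∫ s in Ioo 0 r, deriv χ s * ∫ p, P (p, s) ∂m := by
        rw [integral_prod_symm _ hχP]
        simp only [integral_const_mul]
        rfl
      rw [e1, e3]
      linarith
    · intro p hp
      rw [inner_spaceGrad_eq_fderiv (hφd p), hφ, fderiv_chartTest_eq_zero hψc hψs hp]
      rfl
  -- the zeroth order terms
  have hI₂ : ∫ p, (|timeDeriv φ p| + φ p) ∂(cylinderMeasure T Ω) ≤
      M * (k₁ + k₀) * (m.real univ * ∫ s in Ioo 0 r, χ s) := by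
    have hg : Continuous fun p => |timeDeriv φ p| + φ p := by
      have : timeDeriv φ = fun p => fderiv ℝ φ p (1, 0) :=
        funext fun p => timeDeriv_eq_fderiv (hφd p)
      refine Continuous.add (Continuous.abs ?_) hφC.continuous
      rw [this]
      exact hφ'.clm_apply continuous_const
    rw [he.integral_collarMap hg.aestronglyMeasurable]
    · rw [← hχint, ← integral_const_mul]
      refine (Real.le_norm_self _).trans ?_
      refine norm_integral_le_of_norm_le (hχi.const_mul _) ?_
      filter_upwards [hmem] with p hp
      have hsrc := he.mk_mem_source_of_pos hp.2.1 hp.2.2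
      have e1 : φ (collarMap e B r p) = κ p.1 * χ p.2 := by
        rw [collarMap_apply hp.2.1 hp.2.2, hφ, chartTest_apply (e.map_source hsrc), hψdef]
        simp only [e.left_inv hsrc]
      have e2 : ‖fderiv ℝ κ p.1 (1, 0)‖ ≤ k₁ * 1 := by
        refine ContinuousLinearMap.le_of_opNorm_le_of_le _ (hk₁ _) ?_
        simp [Prod.norm_mk]
      have e3 : |timeDeriv φ (collarMap e B r p)| ≤ k₁ * χ p.2 := by
        rw [timeDeriv_eq_fderiv (hφd _), hψ' hp.2.1 hp.2.2]
        simp only [map_zero, Prod.snd_zero, Prod.fst_zero, mul_zero, zero_add]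
        rw [abs_mul, abs_of_nonneg (hχ0 _), mul_comm]
        exact mul_le_mul_of_nonneg_right (by simpa using e2) (hχ0 _)
      have e4 : κ p.1 ≤ k₀ := (le_abs_self _).trans (hk₀ _)
      have e5 : 0 ≤ |timeDeriv φ (collarMap e B r p)| + φ (collarMap e B r p) :=
        add_nonneg (abs_nonneg _) (chartTest_nonneg hψ0 _)
      rw [Real.norm_of_nonneg (mul_nonneg (he.J_pos hsrc).le e5), mul_assoc]
      refine mul_le_mul (he.density_le _ hsrc) ?_ e5 hM.le
      rw [e1, add_mul]
      exact add_le_add e3 (mul_le_mul_of_nonneg_right e4 (hχ0 _))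
    · intro p hp
      rw [timeDeriv_eq_fderiv (hφd p), hφ, fderiv_chartTest_eq_zero hψc hψs hp, chartTest_eq_zero hp]
      simp
  -- the boundary term
  have hI₃ : ∫ p, hb p * φ p ∂(lateralMeasure T Ω) =
      (∫ p, hb p * κ (footMap e p) ∂((lateralMeasure T Ω).restrict (univ ×ˢ e.target))) * χ 0 := by
    rw [← integral_mul_const, ← setIntegral_eq_integral_of_forall_compl_eq_zero
      (s := univ ×ˢ e.target)]
    · refine integral_congr_ae ?_
      filter_upwards [ae_lateral_mem e] with p hp
      have h0 := (he.mem_frontier_iff _ (e.map_target hp.2.2)).1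
        (by rw [e.right_inv hp.2.2]; exact hp.2.1)
      have h1 : φ p = κ (footMap e p) * χ 0 := by
        rw [hφ, chartTest_apply hp.2.2, hψdef]
        simp only [h0, footMap, indicator_of_mem hp.2.2]
      rw [h1, mul_assoc]
    · intro p hp
      rw [hφ, chartTest_eq_zero fun h => hp ⟨trivial, h⟩, mul_zero]
  rw [hI₃] at key
  have hCI := mul_le_mul_of_nonneg_left hI₂ hC
  have hPG : (∫ s in Ioo 0 r, deriv χ s * ∫ p, P (p, s) ∂m) = ∫ s in Ioo 0 r, deriv χ s *
      ∫ p, κ p * chartFlux e J q (p.1, (p.2, s), collarState e B r u s p) ∂m := rfl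
  rw [← hPG, hC']
  linarith

end IsBoundaryChart

theorem baseMeasure_eq_restrict {N : ℕ} (T : ℝ) (B : Set (BaseSpace N)) :
    baseMeasure T B = (volume : Measure (ℝ × BaseSpace N)).restrict (Ioo 0 T ×ˢ B) := by
  rw [baseMeasure, ← Measure.restrict_congr_set Ioo_ae_eq_Icc, Measure.prod_restrict,
    ← Measure.volume_eq_prod]

namespace IsBoundaryChart

variable {N : ℕ} {Ω : Set (Space N)} {e : OpenPartialHomeomorph (BaseSpace N × ℝ) (Space N)}
  {B : Set (BaseSpace N)} {r : ℝ} {J : BaseSpace N × ℝ → ℝ} {M T : ℝ}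
  {q : ℝ → Space N → ℝ → Space N} {u : ℝ → Space N → ℝ} {U : ℝ}

theorem aemeasurable_chartFlux (he : IsBoundaryChart Ω e B r J M)
    (hq : ContinuousOn (fun p : ℝ × Space N × ℝ => q p.1 p.2.1 p.2.2)
      (Icc 0 T ×ˢ closure Ω ×ˢ univ)) {w : ℝ × BaseSpace N → ℝ}
    (hw : AEMeasurable w (baseMeasure T B)) {s : ℝ} (hs : s ∈ Ico 0 r) :
    AEMeasurable (fun p => chartFlux e J q (p.1, (p.2, s), w p)) (baseMeasure T B) := by
  refine aemeasurable_comp_of_continuousOn (he.continuousOn_chartFlux hq) he.measurableSet_chartDomain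
    (f := fun p : ℝ × BaseSpace N => (p.1, (p.2, s), w p)) ?_ ?_
  · exact measurable_fst.aemeasurable.prodMk ((Measurable.aemeasurable (by fun_prop)).prodMk hw)
  · filter_upwards [he.ae_baseMeasure_mem T] with p hp using ⟨hp.1, ⟨hp.2, hs⟩, trivial⟩

/-- The state is evaluated at distance `s`, but the trace statement evaluates geometry and flux at
the boundary point. Uniform continuity of `chartFlux` allows its position to be frozen at `s = 0`,
with no continuity of the state. -/
theorem tendsto_chartFlux_sub (he : IsBoundaryChart Ω e B r J M) (hbdd : Bornology.IsBounded Ω)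
    (hq : ContinuousOn (fun p : ℝ × Space N × ℝ => q p.1 p.2.1 p.2.2)
      (Icc 0 T ×ˢ closure Ω ×ˢ univ))
    (hu : AEStronglyMeasurable (Function.uncurry u) (cylinderMeasure T Ω))
    (hU : ∀ᵐ p ∂(cylinderMeasure T Ω), |u p.1 p.2| ≤ U)
    {κ : ℝ × BaseSpace N → ℝ} (hκ : Continuous κ) (hκc : HasCompactSupport κ)
    (hκs : tsupport κ ⊆ Ioo 0 T ×ˢ B) :
    (∀ᶠ s in essRightZero, Integrable (fun p => κ p *
      chartFlux e J q (p.1, (p.2, 0), collarState e B r u s p)) (baseMeasure T B)) ∧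
    Tendsto (fun s => (∫ p, κ p * chartFlux e J q (p.1, (p.2, s), collarState e B r u s p)
        ∂(baseMeasure T B)) - ∫ p, κ p * chartFlux e J q (p.1, (p.2, 0), collarState e B r u s p)
        ∂(baseMeasure T B)) essRightZero (𝓝 0) := by
  have hfin := he.isFiniteMeasure_baseMeasure T
  obtain ⟨Q, hQ0, hQ⟩ := exists_norm_le_of_continuousOn (U := U) hbdd hq
  obtain ⟨k₀, hk₀⟩ : ∃ b, ∀ p, ‖κ p‖ ≤ b := hκc.exists_bound_of_continuous hκ
  have hk₀0 : 0 ≤ k₀ := (norm_nonneg _).trans (hk₀ 0)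
  have hint : ∀ᶠ s in essRightZero, ∀ s' ∈ Ico 0 r, Integrable (fun p => κ p *
      chartFlux e J q (p.1, (p.2, s'), collarState e B r u s p)) (baseMeasure T B) := by
    filter_upwards [he.eventually_collarState hu hU] with s hs s' hs'
    refine Integrable.of_bound (hκ.aestronglyMeasurable.mul
      (he.aemeasurable_chartFlux hq hs.1 hs').aestronglyMeasurable) (k₀ * (M * (M * Q))) ?_
    filter_upwards [hs.2, he.ae_baseMeasure_mem T] with p hpU hp
    rw [norm_mul]
    exact mul_le_mul (hk₀ _) (he.abs_chartFlux_le hQ hp.1 hp.2 hs' hpU) (abs_nonneg _) hk₀0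
  refine ⟨by filter_upwards [hint] with s hs using hs 0 ⟨le_rfl, he.r_pos⟩, ?_⟩
  -- The heights stop at `r / 2` so that the set is compact inside the half-open box.
  set D : Set (ℝ × (BaseSpace N × ℝ) × ℝ) :=
    (fun a : (ℝ × BaseSpace N) × ℝ × ℝ => (a.1.1, (a.1.2, a.2.1), a.2.2)) ''
      (tsupport κ ×ˢ Icc 0 (r / 2) ×ˢ Icc (-U) U) with hD
  have hDc : IsCompact D :=
    (IsCompact.prod hκc (isCompact_Icc.prod isCompact_Icc)).image (by fun_prop)
  have hDs : D ⊆ Icc 0 T ×ˢ (B ×ˢ Ico 0 r) ×ˢ univ := by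
    rintro _ ⟨a, ⟨ha1, ha2, -⟩, rfl⟩
    exact ⟨Ioo_subset_Icc_self (hκs ha1).1, ⟨(hκs ha1).2, ha2.1, by
      have := ha2.2
      have := he.r_pos
      simp only
      linarith⟩, trivial⟩
  have huc := Metric.uniformContinuousOn_iff.1
    (hDc.uniformContinuousOn_of_continuous ((he.continuousOn_chartFlux hq).mono hDs))
  rw [Metric.tendsto_nhds]
  intro ε hε
  set m := (baseMeasure T B).real univ with hm
  have hm0 : 0 ≤ m := measureReal_nonneg
  obtain ⟨δ, hδ, hδ'⟩ := huc (ε / (2 * (k₀ * m + 1))) (by positivity)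
  filter_upwards [hint, he.eventually_collarState hu hU,
    eventually_essRightZero_mem_Ioo (show 0 < min δ (r / 2) from lt_min hδ (half_pos he.r_pos))]
    with s hi hs hs0
  have hsδ : s < δ := hs0.2.trans_le (min_le_left _ _)
  have hsr : s < r / 2 := hs0.2.trans_le (min_le_right _ _)
  have hr := he.r_pos
  rw [dist_zero_right, ← integral_sub (hi s ⟨hs0.1.le, by linarith⟩) (hi 0 ⟨le_rfl, hr⟩)]
  have hle : ∀ᵐ p ∂(baseMeasure T B),
      ‖κ p * chartFlux e J q (p.1, (p.2, s), collarState e B r u s p) -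
        κ p * chartFlux e J q (p.1, (p.2, 0), collarState e B r u s p)‖ ≤
      k₀ * (ε / (2 * (k₀ * m + 1))) := by
    filter_upwards [hs.2] with p hp
    by_cases hpκ : p ∈ tsupport κ
    · rw [← mul_sub, norm_mul]
      refine mul_le_mul (hk₀ _) ?_ (norm_nonneg _) hk₀0
      rw [← dist_eq_norm]
      refine (hδ' _ ⟨(p, s, _), ⟨hpκ, ⟨hs0.1.le, hsr.le⟩, abs_le.1 hp⟩, rfl⟩ _
        ⟨(p, 0, _), ⟨hpκ, ⟨le_rfl, by simp only; linarith⟩, abs_le.1 hp⟩, rfl⟩ ?_).le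
      simp [Prod.dist_eq, abs_of_pos hs0.1, hsδ, hδ]
    · rw [image_eq_zero_of_notMem_tsupport hpκ]
      simp only [zero_mul, sub_self, norm_zero]
      positivity
  refine (norm_integral_le_of_norm_le_const hle).trans_lt ?_
  rw [← hm]
  calc k₀ * (ε / (2 * (k₀ * m + 1))) * m = ε / 2 * (k₀ * m / (k₀ * m + 1)) := by field_simp
    _ ≤ ε / 2 * 1 := by
        refine mul_le_mul_of_nonneg_left ?_ (by positivity)
        rw [div_le_one (by positivity)]
        linarith
    _ < ε := by linarith

/-- The upper bound for the limit of the normal flux, rewritten as one integral over the base by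
means of the density `k` of the surface measure. -/
theorem hasNonnegTrace_of_test [IsFiniteMeasure (surfaceMeasure Ω)]
    (he : IsBoundaryChart Ω e B r J M) (hΩ : IsOpen Ω) (hbdd : Bornology.IsBounded Ω)
    (hq : ContinuousOn (fun p : ℝ × Space N × ℝ => q p.1 p.2.1 p.2.2)
      (Icc 0 T ×ˢ closure Ω ×ˢ univ))
    (hu : AEStronglyMeasurable (Function.uncurry u) (cylinderMeasure T Ω))
    (hU : ∀ᵐ p ∂(cylinderMeasure T Ω), |u p.1 p.2| ≤ U) {C L : ℝ} (hC : 0 ≤ C)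
    {hb : ℝ × Space N → ℝ} (hbm : Measurable hb) {Hb : ℝ} (hbH : ∀ p, |hb p| ≤ Hb)
    (hineq : FluxInequality T Ω q C L hb u) {k : BaseSpace N → ℝ} {K : ℝ} (hk : Measurable k)
    (hk0 : ∀ y, 0 ≤ k y) (hkK : ∀ y, k y ≤ K)
    (hlift : MeasurePreserving (liftMap e B)
      ((baseMeasure T B).withDensity fun p => ENNReal.ofReal (k p.2))
      ((lateralMeasure T Ω).restrict (univ ×ˢ e.target)))
    {κ : ℝ × BaseSpace N → ℝ} (hκ : ContDiff ℝ 1 κ) (hκc : HasCompactSupport κ)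
    (hκs : tsupport κ ⊆ Ioo 0 T ×ˢ B) (hκ0 : ∀ p, 0 ≤ κ p) :
    HasNonnegTrace (baseMeasure T B) (collarState e B r u) fun p z =>
      κ p * (L * (hb (liftMap e B p) * k p.2) - chartFlux e J q (p.1, (p.2, 0), z)) := by
  have hfin := he.isFiniteMeasure_baseMeasure T
  obtain ⟨k₀, hk₀⟩ : ∃ b, ∀ p, ‖κ p‖ ≤ b := hκc.exists_bound_of_continuous hκ.continuous
  have hk₀0 : 0 ≤ k₀ := (norm_nonneg _).trans (hk₀ 0)
  obtain ⟨ℓ, hℓ, ht⟩ := he.exists_tendsto_chartFlux hΩ hbdd hq hu hU hC hineq hκ hκc hκs hκ0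
  obtain ⟨hi, ht0⟩ := he.tendsto_chartFlux_sub hbdd hq hu hU hκ.continuous hκc hκs
  have hlm : Measurable (liftMap e B) :=
    measurable_fst.prodMk (he.measurable_lift.comp measurable_snd)
  have hbi : Integrable (fun p => κ p * (L * (hb (liftMap e B p) * k p.2))) (baseMeasure T B) := by
    refine Integrable.of_bound (hκ.continuous.measurable.mul ((hbm.comp hlm).mul
      (hk.comp measurable_snd) |>.const_mul L)).aestronglyMeasurable (k₀ * (|L| * (Hb * K))) ?_
    refine Eventually.of_forall fun p => ?_
    rw [norm_mul, norm_mul, norm_mul, Real.norm_of_nonneg (hk0 _)]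
    have hK0 : 0 ≤ K := (hk0 0).trans (hkK 0)
    have hH0 : 0 ≤ Hb := (abs_nonneg _).trans (hbH 0)
    have := hk0 p.2
    have := hk₀ p
    have := hbH (liftMap e B p)
    have := hkK p.2
    rw [Real.norm_eq_abs L, Real.norm_eq_abs (hb _)]
    gcongr
  have hfoot : Measurable (footMap e) := measurable_fst.prodMk ((measurable_foot e).comp measurable_snd)
  have hc₀ : L * ∫ p, hb p * κ (footMap e p) ∂((lateralMeasure T Ω).restrict (univ ×ˢ e.target)) =
      ∫ p, κ p * (L * (hb (liftMap e B p) * k p.2)) ∂(baseMeasure T B) := by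
    rw [← hlift.map_eq, integral_map hlm.aemeasurable
      (show Measurable fun p => hb p * κ (footMap e p) from
        hbm.mul (hκ.continuous.measurable.comp hfoot)).aestronglyMeasurable,
      integral_withDensity_eq_integral_toReal_smul
        (show Measurable fun p : ℝ × BaseSpace N => ENNReal.ofReal (k p.2) from
          (hk.comp measurable_snd).ennreal_ofReal)
        (Eventually.of_forall fun _ => ENNReal.ofReal_lt_top), ← integral_const_mul]
    refine integral_congr_ae ?_
    filter_upwards [he.ae_baseMeasure_mem T] with p hp
    have hsrc := he.mk_zero_mem_source hp.2
    have e1 : footMap e (liftMap e B p) = p := by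
      refine Prod.ext rfl ?_
      simp only [footMap, liftMap, indicator_of_mem hp.2, indicator_of_mem (e.map_source hsrc),
        e.left_inv hsrc]
    rw [e1, ENNReal.toReal_ofReal (hk0 _), smul_eq_mul]
    ring
  refine ⟨?_, (L * ∫ p, hb p * κ (footMap e p)
    ∂((lateralMeasure T Ω).restrict (univ ×ˢ e.target))) - ℓ, by linarith, ?_⟩
  · filter_upwards [hi] with s hs
    refine (hbi.sub hs).congr (Eventually.of_forall fun p => ?_)
    simp only [Pi.sub_apply]
    ring
  · have h1 := tendsto_const_nhds (x := L * ∫ p, hb p * κ (footMap e p)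
      ∂((lateralMeasure T Ω).restrict (univ ×ˢ e.target))) |>.sub (ht.sub ht0)
    rw [sub_zero] at h1
    refine h1.congr' ?_
    filter_upwards [hi] with s hs
    rw [sub_sub_cancel, hc₀, ← integral_sub hbi hs]
    refine integral_congr_ae (Eventually.of_forall fun p => ?_)
    simp only
    ring

/-- For bounded states the factor of the weight is bounded by `b`, so `L¹` approximation of the
weight by `C¹` ones is enough. -/
theorem hasNonnegTrace_of_integrable [IsFiniteMeasure (surfaceMeasure Ω)]
    (he : IsBoundaryChart Ω e B r J M) (hΩ : IsOpen Ω) (hbdd : Bornology.IsBounded Ω)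
    (hq : ContinuousOn (fun p : ℝ × Space N × ℝ => q p.1 p.2.1 p.2.2)
      (Icc 0 T ×ˢ closure Ω ×ˢ univ))
    (hu : AEStronglyMeasurable (Function.uncurry u) (cylinderMeasure T Ω))
    (hU : ∀ᵐ p ∂(cylinderMeasure T Ω), |u p.1 p.2| ≤ U) {C L : ℝ} (hC : 0 ≤ C)
    {hb : ℝ × Space N → ℝ} (hbm : Measurable hb) {Hb : ℝ} (hbH : ∀ p, |hb p| ≤ Hb)
    (hineq : FluxInequality T Ω q C L hb u) {k : BaseSpace N → ℝ} {K : ℝ} (hk : Measurable k)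
    (hk0 : ∀ y, 0 ≤ k y) (hkK : ∀ y, k y ≤ K)
    (hlift : MeasurePreserving (liftMap e B)
      ((baseMeasure T B).withDensity fun p => ENNReal.ofReal (k p.2))
      ((lateralMeasure T Ω).restrict (univ ×ˢ e.target)))
    {γ : ℝ × BaseSpace N → ℝ} (hγ : Integrable γ (baseMeasure T B))
    (hγ0 : ∀ᵐ p ∂(baseMeasure T B), 0 ≤ γ p) :
    HasNonnegTrace (baseMeasure T B) (collarState e B r u) fun p z =>
      γ p * (L * (hb (liftMap e B p) * k p.2) - chartFlux e J q (p.1, (p.2, 0), z)) := by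
  have hfin := he.isFiniteMeasure_baseMeasure T
  obtain ⟨Q, hQ0, hQ⟩ := exists_norm_le_of_continuousOn (U := U) hbdd hq
  have hlm : Measurable (liftMap e B) :=
    measurable_fst.prodMk (he.measurable_lift.comp measurable_snd)
  have hK0 : 0 ≤ K := (hk0 0).trans (hkK 0)
  have hH0 : 0 ≤ Hb := (abs_nonneg _).trans (hbH 0)
  set b := |L| * (Hb * K) + |M * (M * Q)| with hb'
  have hb0 : 0 ≤ b := by positivity
  refine HasNonnegTrace.of_approx (S := {z | |z| ≤ U}) ?_ ?_ fun ε hε => ?_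
  · filter_upwards [he.eventually_collarState hu hU] with s hs using hs.2
  · filter_upwards [he.eventually_collarState hu hU] with s hs
    refine hγ.aestronglyMeasurable.mul (AEStronglyMeasurable.sub ?_ ?_)
    · exact ((hbm.comp hlm).mul (hk.comp measurable_snd) |>.const_mul L).aestronglyMeasurable
    · exact (he.aemeasurable_chartFlux hq hs.1 ⟨le_rfl, he.r_pos⟩).aestronglyMeasurable
  · have hγ' := hγ
    have hγ0' := hγ0
    rw [baseMeasure_eq_restrict] at hγ' hγ0'
    obtain ⟨κ, hκ, hκc, hκs, hκ0, hκε⟩ := exists_contDiff_nonneg_integral_sub_le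
      (isOpen_Ioo.prod he.isOpen_base) (by
        have := hfin.measure_univ_lt_top
        rw [baseMeasure_eq_restrict, Measure.restrict_apply_univ] at this
        exact this.ne) hγ' hγ0' (ε := ε / (b + 1)) (by positivity)
    rw [← baseMeasure_eq_restrict] at hκε
    have hκi : Integrable κ (baseMeasure T B) :=
      hκ.continuous.integrable_of_hasCompactSupport hκc
    refine ⟨_, fun p => |γ p - κ p| * b, he.hasNonnegTrace_of_test hΩ hbdd hq hu hU hC hbm hbH hineq
      hk hk0 hkK hlift hκ hκc hκs hκ0, (hγ.sub hκi).abs.mul_const b, ?_, ?_⟩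
    · rw [integral_mul_const]
      calc _ ≤ ε / (b + 1) * b := mul_le_mul_of_nonneg_right hκε hb0
        _ ≤ ε / (b + 1) * (b + 1) := by gcongr; linarith
        _ = ε := by field_simp
    · filter_upwards [he.ae_baseMeasure_mem T] with p hp z hz
      rw [← sub_mul, abs_mul]
      refine mul_le_mul_of_nonneg_left ?_ (abs_nonneg _)
      refine (abs_sub _ _).trans (add_le_add ?_ ?_)
      · rw [abs_mul, abs_mul, abs_of_nonneg (hk0 _)]
        have := hk0 p.2
        have := hbH (liftMap e B p)
        have := hkK p.2
        gcongr
      · exact (he.abs_chartFlux_le hQ hp.1 hp.2 ⟨le_rfl, he.r_pos⟩ hz).trans (le_abs_self _)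

/-- Local version of the trace inequality, in the range of a chart and away from the support of the
boundary datum. -/
theorem hasNonnegTrace [IsFiniteMeasure (surfaceMeasure Ω)]
    (he : IsBoundaryChart Ω e B r J M) (hΩ : IsOpen Ω) (hbdd : Bornology.IsBounded Ω)
    (hq : ContinuousOn (fun p : ℝ × Space N × ℝ => q p.1 p.2.1 p.2.2)
      (Icc 0 T ×ˢ closure Ω ×ˢ univ))
    (hu : AEStronglyMeasurable (Function.uncurry u) (cylinderMeasure T Ω))
    (hU : ∀ᵐ p ∂(cylinderMeasure T Ω), |u p.1 p.2| ≤ U) {C L : ℝ} (hC : 0 ≤ C)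
    {hb : ℝ × Space N → ℝ} (hbm : Measurable hb) {Hb : ℝ} (hbH : ∀ p, |hb p| ≤ Hb)
    (hineq : FluxInequality T Ω q C L hb u) {γ : ℝ × Space N → ℝ}
    (hγ : Integrable γ (lateralMeasure T Ω)) (hγ0 : ∀ᵐ p ∂(lateralMeasure T Ω), 0 ≤ γ p)
    (hγe : ∀ p, p.2 ∉ e.target → γ p = 0) (hbγ : ∀ p, hb p * γ p = 0) :
    HasNonnegTrace (lateralMeasure T Ω) (fun ρ p => u p.1 (p.2 - ρ • outerNormal Ω p.2))
      fun p z => inner ℝ (q p.1 p.2 z) (outerNormal Ω p.2) * γ p := by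
  have hfin := he.isFiniteMeasure_baseMeasure T
  obtain ⟨k, K, hk, hk0, hkK, hfoot, hlift⟩ := he.exists_density T
  have hkm : Measurable fun p : ℝ × BaseSpace N => ENNReal.ofReal (k p.2) :=
    (hk.comp measurable_snd).ennreal_ofReal
  have hwd : ∀ g : ℝ × BaseSpace N → ℝ, Integrable g ((baseMeasure T B).withDensity
      fun p => ENNReal.ofReal (k p.2)) ↔ Integrable (fun p => k p.2 * g p) (baseMeasure T B) := by
    intro g
    rw [integrable_withDensity_iff_integrable_smul' hkm
      (Eventually.of_forall fun _ => ENNReal.ofReal_lt_top)]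
    simp only [ENNReal.toReal_ofReal (hk0 _), smul_eq_mul]
  have hwdi : ∀ g : ℝ × BaseSpace N → ℝ, ∫ p, g p ∂((baseMeasure T B).withDensity
      fun p => ENNReal.ofReal (k p.2)) = ∫ p, k p.2 * g p ∂(baseMeasure T B) := by
    intro g
    rw [integral_withDensity_eq_integral_toReal_smul hkm
      (Eventually.of_forall fun _ => ENNReal.ofReal_lt_top)]
    simp only [ENNReal.toReal_ofReal (hk0 _), smul_eq_mul]
  have hγr : Integrable γ ((lateralMeasure T Ω).restrict (univ ×ˢ e.target)) := hγ.restrict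
  have hkγ : Integrable (fun p => k p.2 * γ (liftMap e B p)) (baseMeasure T B) :=
    (hwd _).1 (hlift.integrable_comp_of_integrable hγr)
  have hkγ0 : ∀ᵐ p ∂(baseMeasure T B), 0 ≤ k p.2 * γ (liftMap e B p) := by
    have h1 := hlift.quasiMeasurePreserving.ae (ae_restrict_of_ae hγ0)
    rw [ae_withDensity_iff hkm] at h1
    filter_upwards [h1] with p hp
    rcases (hk0 p.2).eq_or_lt with h | h
    · rw [← h, zero_mul]
    · exact mul_nonneg h.le (hp (by simpa using h))
  have hJm : AEMeasurable (fun p : ℝ × BaseSpace N => (J (p.2, 0))⁻¹) (baseMeasure T B) := by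
    refine AEMeasurable.inv ?_
    refine aemeasurable_comp_of_continuousOn he.continuousOn_density
      (by rw [he.source_eq]; exact he.isOpen_base.measurableSet.prod measurableSet_Ioo)
      (f := fun p : ℝ × BaseSpace N => (p.2, (0 : ℝ))) (Measurable.aemeasurable (by fun_prop)) ?_
    filter_upwards [he.ae_baseMeasure_mem T] with p hp using he.mk_zero_mem_source hp.2
  -- This weight is chosen so that `J⁻¹` cancels the Jacobian contained in `chartFlux`, while `k`
  -- turns Lebesgue measure on the base into surface measure.
  have hω : Integrable (fun p => (J (p.2, 0))⁻¹ * (k p.2 * γ (liftMap e B p)))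
      (baseMeasure T B) := by
    refine hkγ.bdd_mul (c := M) hJm.aestronglyMeasurable ?_
    filter_upwards [he.ae_baseMeasure_mem T] with p hp
    have hsrc := he.mk_zero_mem_source hp.2
    rw [norm_inv, Real.norm_of_nonneg (he.J_pos hsrc).le, inv_le_comm₀ (he.J_pos hsrc) (he.M_pos hsrc)]
    exact he.le_density _ hsrc
  have hω0 : ∀ᵐ p ∂(baseMeasure T B), 0 ≤ (J (p.2, 0))⁻¹ * (k p.2 * γ (liftMap e B p)) := by
    filter_upwards [hkγ0, he.ae_baseMeasure_mem T] with p hp hpB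
    exact mul_nonneg (inv_nonneg.2 (he.J_pos (he.mk_zero_mem_source hpB.2)).le) hp
  refine (he.hasNonnegTrace_of_integrable hΩ hbdd hq hu hU hC hbm hbH hineq hk hk0 hkK hlift hω
    hω0).congr ?_
  filter_upwards [eventually_essRightZero_mem_Ioo he.r_pos] with ρ hρ hi
  set a : ℝ × Space N → ℝ := fun p =>
    inner ℝ (q p.1 p.2 (u p.1 (p.2 - ρ • outerNormal Ω p.2))) (outerNormal Ω p.2) * γ p with ha
  have hae : (fun p => (J (p.2, 0))⁻¹ * (k p.2 * γ (liftMap e B p)) *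
      (L * (hb (liftMap e B p) * k p.2) - chartFlux e J q (p.1, (p.2, 0), collarState e B r u ρ p)))
      =ᵐ[baseMeasure T B] fun p => k p.2 * a (liftMap e B p) := by
    filter_upwards [he.ae_baseMeasure_mem T] with p hp
    have hsrc := he.mk_zero_mem_source hp.2
    have hsrc' := he.mk_mem_source_of_pos hp.2 hρ
    have e1 : liftMap e B p = (p.1, e (p.2, 0)) := by rw [liftMap, indicator_of_mem hp.2]
    have e2 : collarState e B r u ρ p =
        u p.1 (e (p.2, 0) - ρ • outerNormal Ω (e (p.2, 0))) := by
      rw [collarState, collarMap_apply (by exact hp.2) (by exact hρ)]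
      rw [he.ray _ hsrc']
    have e3 := hbγ (liftMap e B p)
    rw [ha, chartFlux, e2]
    simp only
    rw [he.fderiv_symm_snd _ hp.2, real_inner_comm, e1]
    rw [e1] at e3
    have hJ0 := (he.J_pos hsrc).ne'
    field_simp
    -- The coordinate derivative is `-⟨ν, ·⟩`, which turns `-chartFlux` into `+q·ν`; the datum term
    -- is a multiple of `hb * γ = 0`.
    linear_combination L * k p.2 * k p.2 * e3
  have hi' := hi.congr hae
  have hal : Integrable (fun p => a (liftMap e B p)) ((baseMeasure T B).withDensity
      fun p => ENNReal.ofReal (k p.2)) := (hwd _).2 hi'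
  have haf : (fun p => a (liftMap e B (footMap e p))) =ᵐ[(lateralMeasure T Ω).restrict
      (univ ×ˢ e.target)] a := by
    filter_upwards [ae_lateral_mem e] with p hp
    have : liftMap e B (footMap e p) = p := Prod.ext rfl (he.foot_mem hp.2).2
    rw [this]
  have har : IntegrableOn a (univ ×ˢ e.target) (lateralMeasure T Ω) :=
    (hfoot.integrable_comp_of_integrable hal).congr haf
  have ha0 : ∀ p, p ∉ (univ : Set ℝ) ×ˢ e.target → a p = 0 := by
    intro p hp
    rw [ha]
    simp only
    rw [hγe p fun h => hp ⟨trivial, h⟩, mul_zero]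
  refine ⟨har.integrable_of_forall_notMem_eq_zero ha0, ?_⟩
  rw [← setIntegral_eq_integral_of_forall_compl_eq_zero ha0, integral_congr_ae hae, ← hwdi,
    ← integral_congr_ae haf]
  rw [← hfoot.map_eq] at hal ⊢
  rw [integral_map hfoot.measurable.aemeasurable hal.aestronglyMeasurable]

end IsBoundaryChart

/-! ### From the entropy inequalities to `FluxInequality` -/

section Bounds

variable {N : ℕ} {T U : ℝ} {Ω : Set (Space N)}

/-- Near each point of `K` the definition of `C¹` provides a continuous choice of derivatives within
`S`; compactness joins the local bounds. No uniqueness of derivatives is needed: on the open set `Ω`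
any such choice restricts to the true spatial derivative. -/
theorem exists_fderivWithin_bound_of_contDiffOn {E F : Type*} [NormedAddCommGroup E]
    [NormedSpace ℝ E] [NormedAddCommGroup F] [NormedSpace ℝ F] {g : E → F} {S K : Set E}
    (hg : ContDiffOn ℝ 1 g S) (hK : IsCompact K) (hKS : K ⊆ S) :
    ∃ D : ℝ, ∀ p ∈ K, ∃ A : E →L[ℝ] F, ‖A‖ ≤ D ∧ HasFDerivWithinAt g A S p := by
  refine hK.induction_on (p := fun K => ∃ D : ℝ, ∀ p ∈ K, ∃ A : E →L[ℝ] F, ‖A‖ ≤ D ∧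
    HasFDerivWithinAt g A S p) ⟨0, by simp⟩ ?_ ?_ ?_
  · rintro s t hst ⟨D, hD⟩
    exact ⟨D, fun p hp => hD p (hst hp)⟩
  · rintro s t ⟨D, hD⟩ ⟨D', hD'⟩
    refine ⟨max D D', fun p hp => ?_⟩
    rcases hp with hp | hp
    · obtain ⟨A, hA, h⟩ := hD p hp
      exact ⟨A, hA.trans (le_max_left _ _), h⟩
    · obtain ⟨A, hA, h⟩ := hD' p hp
      exact ⟨A, hA.trans (le_max_right _ _), h⟩
  · intro p hp
    obtain ⟨v, hv, -, -, g', hg', hc⟩ :=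
      (contDiffWithinAt_succ_iff_hasFDerivWithinAt' (n := 0) (by simp)).1 (hg p (hKS hp))
    rw [insert_eq_of_mem (hKS hp)] at hv
    have h1 : ∀ᶠ y in 𝓝[S] p, ‖g' y‖ < ‖g' p‖ + 1 :=
      (hc.continuousWithinAt.norm).eventually_lt_const (by linarith)
    refine ⟨{y | y ∈ v ∧ ‖g' y‖ < ‖g' p‖ + 1}, nhdsWithin_mono p hKS (inter_mem hv h1),
      ‖g' p‖ + 1, fun y hy => ⟨g' y, hy.2.le, hg' y hy.1⟩⟩

theorem exists_abs_divergence_le (hΩ : IsOpen Ω) (hbdd : Bornology.IsBounded Ω)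
    {g : ℝ → Space N → ℝ → Space N}
    (hg : ContDiffOn ℝ 2 (fun p : ℝ × Space N × ℝ => g p.1 p.2.1 p.2.2)
      (Icc 0 T ×ˢ closure Ω ×ˢ univ)) (U : ℝ) :
    ∃ D, 0 ≤ D ∧ ∀ t ∈ Icc 0 T, ∀ x ∈ Ω, ∀ z, |z| ≤ U →
      |divergence (fun y => g t y z) x| ≤ D := by
  have hK : IsCompact (Icc 0 T ×ˢ closure Ω ×ˢ Icc (-U) U) :=
    isCompact_Icc.prod (hbdd.isCompact_closure.prod isCompact_Icc)
  obtain ⟨D, hD⟩ := exists_fderivWithin_bound_of_contDiffOn (hg.of_le (by norm_num)) hK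
    (prod_mono subset_rfl (prod_mono subset_rfl (subset_univ _)))
  refine ⟨N * |D|, by positivity, fun t ht x hx z hz => ?_⟩
  obtain ⟨A, hA, hgA⟩ := hD (t, x, z) ⟨ht, subset_closure hx, abs_le.1 hz⟩
  have h1 : HasFDerivWithinAt (fun y : Space N => (t, y, z))
      ((0 : Space N →L[ℝ] ℝ).prod ((ContinuousLinearMap.id ℝ (Space N)).prod 0)) Ω x :=
    ((hasFDerivAt_const t x).prodMk ((hasFDerivAt_id x).prodMk
      (hasFDerivAt_const z x))).hasFDerivWithinAt
  have hmaps : MapsTo (fun y : Space N => (t, y, z)) Ω (Icc 0 T ×ˢ closure Ω ×ˢ univ) :=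
    fun y hy => ⟨ht, subset_closure hy, trivial⟩
  have h2 := (hgA.comp x h1 hmaps).hasFDerivAt (hΩ.mem_nhds hx)
  have h3 : fderiv ℝ (fun y => g t y z) x = _ := h2.fderiv
  rw [divergence, h3]
  refine (Finset.abs_sum_le_sum_abs _ _).trans ?_
  calc ∑ i : Fin N, |_| ≤ ∑ i : Fin N, |D| := by
        refine Finset.sum_le_sum fun i _ => ?_
        rw [← Real.norm_eq_abs]
        refine (PiLp.norm_apply_le (p := 2) (β := fun _ : Fin N => ℝ) _ i).trans ?_
        have h4 : ‖((0 : Space N →L[ℝ] ℝ).prod ((ContinuousLinearMap.id ℝ (Space N)).prod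
            (0 : Space N →L[ℝ] ℝ))) (EuclideanSpace.single i 1)‖ ≤ 1 := by
          simp [Prod.norm_mk]
        have := A.le_of_opNorm_le_of_le (hA.trans (le_abs_self D)) h4
        simpa using this
    _ = N * |D| := by simp

end Bounds

section Solutions

variable {N : ℕ} {T U : ℝ} {Ω : Set (Space N)} {f : ℝ → Space N → ℝ → Space N}
  {F : ℝ → Space N → ℝ → ℝ} {u₀ : Space N → ℝ} {ub u : ℝ → Space N → ℝ}
  {q : ℝ → Space N → ℝ → Space N}

theorem IsTestFunction.integrable {φ : ℝ × Space N → ℝ} (hφ : IsTestFunction T φ) :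
    Integrable φ (cylinderMeasure T Ω) :=
  (hφ.contDiff.continuous.integrable_of_hasCompactSupport hφ.hasCompactSupport).restrict

theorem IsTestFunction.differentiable {φ : ℝ × Space N → ℝ} (hφ : IsTestFunction T φ) :
    Differentiable ℝ φ := hφ.contDiff.differentiable (by norm_num)

theorem IsTestFunction.integrable_timeDeriv {φ : ℝ × Space N → ℝ} (hφ : IsTestFunction T φ) :
    Integrable (timeDeriv φ) (cylinderMeasure T Ω) := by
  have h1 : timeDeriv φ = fun p => fderiv ℝ φ p (1, 0) :=
    funext fun p => timeDeriv_eq_fderiv (hφ.differentiable p)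
  have h2 : Continuous (timeDeriv φ) := by
    rw [h1]
    exact (hφ.contDiff.continuous_fderiv (by norm_num)).clm_apply continuous_const
  refine (h2.integrable_of_hasCompactSupport ?_).restrict
  rw [h1]
  exact hφ.hasCompactSupport.fderiv_apply ℝ _

theorem IsTestFunction.integrable_inner_spaceGrad {φ : ℝ × Space N → ℝ}
    (hφ : IsTestFunction T φ) {v : ℝ × Space N → Space N}
    (hv : AEStronglyMeasurable v (cylinderMeasure T Ω)) {Q : ℝ}
    (hQ : ∀ᵐ p ∂(cylinderMeasure T Ω), ‖v p‖ ≤ Q) :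
    Integrable (fun p => inner ℝ (v p) (spaceGrad φ p)) (cylinderMeasure T Ω) := by
  have h1 : ∀ p, inner ℝ (v p) (spaceGrad φ p) = fderiv ℝ φ p (0, v p) :=
    fun p => inner_spaceGrad_eq_fderiv (hφ.differentiable p) _
  have hφ' := hφ.contDiff.continuous_fderiv (by norm_num)
  have h2 : Continuous fun a : ((ℝ × Space N) →L[ℝ] ℝ) × Space N => a.1 (0, a.2) := by fun_prop
  simp only [h1]
  have h3 : Integrable (fun p => ‖fderiv ℝ φ p‖ * Q) (cylinderMeasure T Ω) :=
    ((hφ'.norm.integrable_of_hasCompactSupport (hφ.hasCompactSupport.fderiv ℝ).norm).restrict).mul_const Q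
  refine h3.mono' (h2.comp_aestronglyMeasurable (hφ'.aestronglyMeasurable.prodMk hv)) ?_
  filter_upwards [hQ] with p hp
  refine ContinuousLinearMap.le_of_opNorm_le_of_le _ le_rfl ?_
  rwa [Prod.norm_mk, norm_zero, max_eq_right (norm_nonneg _)]

theorem IsTestFunction.integral_mul_le {φ a : ℝ × Space N → ℝ} (hφ : IsTestFunction T φ) {C : ℝ}
    (ha : ∀ᵐ p ∂(cylinderMeasure T Ω), |a p| ≤ C) :
    ∫ p, a p * φ p ∂(cylinderMeasure T Ω) ≤ C * ∫ p, φ p ∂(cylinderMeasure T Ω) := by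
  rw [← integral_const_mul]
  refine (Real.le_norm_self _).trans (norm_integral_le_of_norm_le (hφ.integrable.const_mul C) ?_)
  filter_upwards [ha] with p hp
  rw [norm_mul, Real.norm_of_nonneg (hφ.nonneg p)]
  exact mul_le_mul_of_nonneg_right hp (hφ.nonneg p)

theorem IsTestFunction.integral_mul_timeDeriv_le {φ a : ℝ × Space N → ℝ} (hφ : IsTestFunction T φ)
    {C : ℝ} (ha : ∀ᵐ p ∂(cylinderMeasure T Ω), |a p| ≤ C) :
    ∫ p, a p * timeDeriv φ p ∂(cylinderMeasure T Ω) ≤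
      C * ∫ p, |timeDeriv φ p| ∂(cylinderMeasure T Ω) := by
  rw [← integral_const_mul]
  refine (Real.le_norm_self _).trans
    (norm_integral_le_of_norm_le (hφ.integrable_timeDeriv.abs.const_mul C) ?_)
  filter_upwards [ha] with p hp
  rw [norm_mul]
  exact mul_le_mul_of_nonneg_right hp (norm_nonneg _)

theorem IsTestFunction.eq_zero_initial {φ : ℝ × Space N → ℝ}
    (hs : tsupport φ ⊆ Ioo 0 T ×ˢ univ) (x : Space N) : φ (0, x) = 0 :=
  image_eq_zero_of_notMem_tsupport fun h => lt_irrefl _ (hs h).1.1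

theorem IsTestFunction.add_le {φ : ℝ × Space N → ℝ} (hφ : IsTestFunction T φ) {C₁ C₂ C₃ : ℝ}
    (h₁ : 0 ≤ C₁) (h₂ : 0 ≤ C₂) (h₃ : 0 ≤ C₃) :
    C₁ * ∫ p, |timeDeriv φ p| ∂(cylinderMeasure T Ω) + C₂ * ∫ p, φ p ∂(cylinderMeasure T Ω) +
      C₃ * ∫ p, φ p ∂(cylinderMeasure T Ω) ≤
      (C₁ + C₂ + C₃) * ∫ p, (|timeDeriv φ p| + φ p) ∂(cylinderMeasure T Ω) := by
  rw [integral_add hφ.integrable_timeDeriv.abs hφ.integrable]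
  have e1 : 0 ≤ ∫ p, |timeDeriv φ p| ∂(cylinderMeasure T Ω) :=
    integral_nonneg fun _ => abs_nonneg _
  have e2 : 0 ≤ ∫ p, φ p ∂(cylinderMeasure T Ω) := integral_nonneg hφ.nonneg
  nlinarith [mul_nonneg h₁ e2, mul_nonneg h₂ e1, mul_nonneg h₃ e1]

/-- Since `φ` vanishes near `t = 0`, the initial term drops out. For bounded `u` the time and source
terms are dominated by multiples of `∫ |∂_t φ|` and `∫ φ`, so only the spatial flux and the boundary
datum remain. -/
theorem fluxInequality_of_semiEntropy (hΩ : IsOpen Ω) (hbdd : Bornology.IsBounded Ω)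
    (hf : IsFlux T Ω f) (hF : IsSource T Ω F)
    (hU : ∀ᵐ p ∂(cylinderMeasure T Ω), |u p.1 p.2| ≤ U) {part sg : ℝ → ℝ}
    (hpart : ∀ s, |part s| ≤ |s|) (hsg : ∀ s, |sg s| ≤ 1) {c : ℝ}
    (h : ∀ φ, IsTestFunction T φ → SemiEntropyInequality part sg T Ω f F u₀ ub u c φ) :
    ∃ C, 0 ≤ C ∧ FluxInequality T Ω (fun t x z => sg (z - c) • (f t x z - f t x c)) C
      (lipConst T Ω f u) (fun p => part (ub p.1 p.2 - c)) u := by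
  obtain ⟨Q, hQ0, hQ⟩ := exists_norm_le_of_continuousOn (U := U) hbdd hF.contDiffOn.continuousOn
  obtain ⟨D, hD0, hD⟩ := exists_abs_divergence_le hΩ hbdd hf.contDiffOn |c|
  -- There are only two lower order terms here; the summand `0` fits the shape of
  -- `IsTestFunction.add_le`.
  refine ⟨|U| + |c| + (Q + D) + 0, by positivity, fun φ hφ hs => ?_⟩
  have h0 := h φ hφ
  rw [SemiEntropyInequality] at h0
  have h1 : ∀ᵐ p ∂(cylinderMeasure T Ω), |part (u p.1 p.2 - c)| ≤ |U| + |c| := by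
    filter_upwards [hU] with p hp
    exact (hpart _).trans ((abs_sub _ _).trans (add_le_add_left (hp.trans (le_abs_self U)) _))
  have h2 : ∀ᵐ p ∂(cylinderMeasure T Ω), |sg (u p.1 p.2 - c)
      * (F p.1 p.2 (u p.1 p.2) - divergence (fun y => f p.1 y c) p.2)| ≤ Q + D := by
    filter_upwards [hU, ae_cylinder_mem hΩ] with p hp hpm
    rw [abs_mul]
    have e1 := (abs_sub (F p.1 p.2 (u p.1 p.2)) (divergence (fun y => f p.1 y c) p.2)).trans
      (add_le_add (hQ _ hpm.1 _ (subset_closure hpm.2) _ hp) (hD _ hpm.1 _ hpm.2 c le_rfl))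
    calc _ ≤ 1 * (Q + D) := mul_le_mul (hsg _) e1 (abs_nonneg _) zero_le_one
      _ = _ := one_mul _
  have h3 := hφ.integral_mul_timeDeriv_le h1
  have h4 := hφ.integral_mul_le h2
  have h5 : ∫ x in Ω, part (u₀ x - c) * φ (0, x) = 0 := by
    simp [IsTestFunction.eq_zero_initial hs]
  have h6 := hφ.add_le (Ω := Ω) (show 0 ≤ |U| + |c| by positivity) (show 0 ≤ Q + D by positivity)
    le_rfl
  rw [h5] at h0
  simp only [inner_smul_left, conj_trivial]
  linarith

theorem fluxInequality_of_entropyPair (hΩ : IsOpen Ω) (hbdd : Bornology.IsBounded Ω)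
    (hf : IsFlux T Ω f) (hF : IsSource T Ω F) (hu : IsRESolution T Ω f F u₀ ub u)
    (hU : ∀ᵐ p ∂(cylinderMeasure T Ω), |u p.1 p.2| ≤ U) {H : ℝ → ℝ → ℝ}
    {Q : ℝ → Space N → ℝ → ℝ → Space N} (hHQ : IsBoundaryEntropyPair T Ω f H Q) (c : ℝ) :
    ∃ C, 0 ≤ C ∧ FluxInequality T Ω (fun t x z => Q t x z c) C
      (lipConst T Ω f u) (fun p => H (ub p.1 p.2) c) u := by
  have hQc : ContDiffOn ℝ 2 (fun p : ℝ × Space N × ℝ => Q p.1 p.2.1 p.2.2 c)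
      (Icc 0 T ×ˢ closure Ω ×ˢ univ) :=
    hHQ.contDiffOn.comp (f := fun p : ℝ × Space N × ℝ => (p.1, p.2.1, p.2.2, c))
      (by fun_prop) fun p hp => ⟨hp.1, hp.2.1, trivial, trivial⟩
  have hHc : ContDiff ℝ 2 (fun z => H z c) := hHQ.contDiff.comp (f := fun z : ℝ => (z, c))
    (by fun_prop)
  obtain ⟨B, hB0, hB⟩ := exists_norm_le_of_continuousOn (U := U) hbdd hF.contDiffOn.continuousOn
  obtain ⟨q, hq0, hq⟩ := exists_norm_le_of_continuousOn (U := U) (q := fun t x z => Q t x z c)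
    hbdd hQc.continuousOn
  obtain ⟨D, hD0, hD⟩ := exists_abs_divergence_le hΩ hbdd hf.contDiffOn U
  obtain ⟨D', hD0', hD'⟩ := exists_abs_divergence_le (g := fun t x z => Q t x z c) hΩ hbdd
    hQc U
  obtain ⟨a, ha⟩ := (isCompact_Icc (a := -U) (b := U)).exists_bound_of_continuousOn
    hHc.continuous.continuousOn
  obtain ⟨b, hb⟩ := (isCompact_Icc (a := -U) (b := U)).exists_bound_of_continuousOn
    (hHc.continuous_deriv (by norm_num)).continuousOn
  refine ⟨|a| + |b| * (B + D) + D', by positivity, fun φ hφ hs => ?_⟩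
  have h0 := hu.entropy_ineq H Q hHQ c φ hφ
  have h1 : ∀ᵐ p ∂(cylinderMeasure T Ω), |H (u p.1 p.2) c| ≤ |a| := by
    filter_upwards [hU] with p hp using (ha _ (abs_le.1 hp)).trans (le_abs_self a)
  have h2 : ∀ᵐ p ∂(cylinderMeasure T Ω), |deriv (fun z => H z c) (u p.1 p.2)
      * (F p.1 p.2 (u p.1 p.2) - divergence (fun y => f p.1 y (u p.1 p.2)) p.2)| ≤
      |b| * (B + D) := by
    filter_upwards [hU, ae_cylinder_mem hΩ] with p hp hpm
    rw [abs_mul]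
    exact mul_le_mul ((hb _ (abs_le.1 hp)).trans (le_abs_self b)) ((abs_sub _ _).trans
      (add_le_add (hB _ hpm.1 _ (subset_closure hpm.2) _ hp) (hD _ hpm.1 _ hpm.2 _ hp)))
      (abs_nonneg _) (abs_nonneg _)
  have h3 : ∀ᵐ p ∂(cylinderMeasure T Ω),
      |divergence (fun y => Q p.1 y (u p.1 p.2) c) p.2| ≤ D' := by
    filter_upwards [hU, ae_cylinder_mem hΩ] with p hp hpm using hD' _ hpm.1 _ hpm.2 _ hp
  have h4 := hφ.integral_mul_timeDeriv_le h1
  have h5 := hφ.integral_mul_le h2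
  have h6 := hφ.integral_mul_le h3
  have h7 : ∫ x in Ω, H (u₀ x) c * φ (0, x) = 0 := by
    simp [IsTestFunction.eq_zero_initial hs]
  have h8 := hφ.add_le (Ω := Ω) (abs_nonneg a) (show 0 ≤ |b| * (B + D) by positivity) hD0'
  have hum := hu.memLp.aestronglyMeasurable
  -- In the entropy inequality the time and space terms share one integral, so both must be
  -- integrable before it can be split.
  have hi1 : Integrable (fun p => H (u p.1 p.2) c * timeDeriv φ p) (cylinderMeasure T Ω) :=
    hφ.integrable_timeDeriv.bdd_mul (hHc.continuous.comp_aestronglyMeasurable hum) h1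
  have hi2 : Integrable (fun p => inner ℝ (Q p.1 p.2 (u p.1 p.2) c) (spaceGrad φ p))
      (cylinderMeasure T Ω) := by
    refine hφ.integrable_inner_spaceGrad
      (aemeasurable_comp_state (q := fun t x z => Q t x z c) hΩ
        hQc.continuousOn hum).aestronglyMeasurable (Q := q) ?_
    filter_upwards [hU, ae_cylinder_mem hΩ] with p hp hpm
    exact hq _ hpm.1 _ (subset_closure hpm.2) _ hp
  rw [integral_add hi1 hi2, h7] at h0
  linarith

theorem FluxInequality.congr {C L : ℝ} {hb hb' : ℝ × Space N → ℝ}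
    (h : FluxInequality T Ω q C L hb u) (hbb : hb =ᵐ[lateralMeasure T Ω] hb') :
    FluxInequality T Ω q C L hb' u := by
  intro φ hφ hs
  have h1 : ∫ p, hb' p * φ p ∂(lateralMeasure T Ω) = ∫ p, hb p * φ p ∂(lateralMeasure T Ω) := by
    refine integral_congr_ae ?_
    filter_upwards [hbb] with p hp
    rw [hp]
  rw [h1]
  exact h φ hφ hs

end Solutions

/-! ### Measurability of the normal and of the shifted state -/

section StateTrace

variable {N : ℕ} {T U : ℝ} {Ω : Set (Space N)} {u : ℝ → Space N → ℝ}

theorem norm_outerNormal_le (Ω : Set (Space N)) (ξ : Space N) : ‖outerNormal Ω ξ‖ ≤ 1 := by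
  rw [outerNormal]
  split_ifs with h
  · rw [norm_smul, norm_inv, norm_norm]
    exact inv_mul_le_one
  · simp

namespace IsBoundaryChart

variable {e : OpenPartialHomeomorph (BaseSpace N × ℝ) (Space N)} {B : Set (BaseSpace N)} {r : ℝ}
  {J : BaseSpace N × ℝ → ℝ} {M : ℝ}

/-- The normal is defined through a choice of defining function at each point separately. Expressing
it by the differential of the coordinate `s` exhibits its continuous dependence on the boundary
point. -/
theorem outerNormal_eq_toDual_symm (he : IsBoundaryChart Ω e B r J M) {ξ : Space N}
    (hξ : ξ ∈ frontier Ω ∩ e.target) : outerNormal Ω ξ = (InnerProductSpace.toDual ℝ (Space N)).symm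
      (-((ContinuousLinearMap.snd ℝ (BaseSpace N) ℝ) ∘L fderiv ℝ e.symm ξ)) := by
  rw [LinearIsometryEquiv.eq_symm_apply]
  ext w
  have h1 := he.foot_mem hξ
  have h2 : e (foot e ξ, 0) = ξ := by
    have := h1.2
    rwa [lift, indicator_of_mem h1.1] at this
  have h3 := he.fderiv_symm_snd _ h1.1 w
  rw [h2] at h3
  rw [InnerProductSpace.toDual_apply_apply]
  simp [h3]

theorem aemeasurable_outerNormal [IsFiniteMeasure (surfaceMeasure Ω)]
    (he : IsBoundaryChart Ω e B r J M) :
    AEMeasurable (fun p : ℝ × Space N => outerNormal Ω p.2)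
      ((lateralMeasure T Ω).restrict (univ ×ˢ e.target)) := by
  have hc : ContinuousOn (fun ξ => (InnerProductSpace.toDual ℝ (Space N)).symm
      (-((ContinuousLinearMap.snd ℝ (BaseSpace N) ℝ) ∘L fderiv ℝ e.symm ξ))) e.target := by
    refine (InnerProductSpace.toDual ℝ (Space N)).symm.continuous.comp_continuousOn
      (ContinuousOn.neg ?_)
    exact continuousOn_const.clm_comp
      (he.contDiffOn_symm.continuousOn_fderiv_of_isOpen e.open_target (by norm_num))
  refine (aemeasurable_comp_of_continuousOn hc e.open_target.measurableSet
    (f := fun p : ℝ × Space N => p.2) measurable_snd.aemeasurable ?_).congr ?_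
  · filter_upwards [ae_lateral_mem e] with p hp using hp.2.2
  · filter_upwards [ae_lateral_mem e] with p hp using (he.outerNormal_eq_toDual_symm hp.2).symm

/-- Along rays the shifted state is `collarState` composed with `footMap`, and the latter pulls
Lebesgue null sets back to surface null sets. Thus Fubini in the collar applies for almost every
small `ρ`. -/
theorem eventually_state [IsFiniteMeasure (surfaceMeasure Ω)] (he : IsBoundaryChart Ω e B r J M)
    (hu : AEStronglyMeasurable (Function.uncurry u) (cylinderMeasure T Ω))
    (hU : ∀ᵐ p ∂(cylinderMeasure T Ω), |u p.1 p.2| ≤ U) :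
    ∀ᶠ ρ in essRightZero, AEMeasurable (fun p : ℝ × Space N => u p.1 (p.2 - ρ • outerNormal Ω p.2))
        ((lateralMeasure T Ω).restrict (univ ×ˢ e.target)) ∧
      ∀ᵐ p ∂((lateralMeasure T Ω).restrict (univ ×ˢ e.target)),
        |u p.1 (p.2 - ρ • outerNormal Ω p.2)| ≤ U := by
  obtain ⟨k, K, hk, hk0, hkK, hfoot, hlift⟩ := he.exists_density T
  have hq : Measure.QuasiMeasurePreserving (footMap e)
      ((lateralMeasure T Ω).restrict (univ ×ˢ e.target)) (baseMeasure T B) :=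
    hfoot.quasiMeasurePreserving.mono_right (withDensity_absolutelyContinuous _ _)
  filter_upwards [he.eventually_collarState hu hU, eventually_essRightZero_mem_Ioo he.r_pos]
    with ρ hρ hρr
  have hae : (fun p => collarState e B r u ρ (footMap e p))
      =ᵐ[(lateralMeasure T Ω).restrict (univ ×ˢ e.target)]
      fun p : ℝ × Space N => u p.1 (p.2 - ρ • outerNormal Ω p.2) := by
    filter_upwards [ae_lateral_mem e] with p hp
    have h1 := he.foot_mem hp.2
    have h2 : e (foot e p.2, 0) = p.2 := by
      have := h1.2
      rwa [lift, indicator_of_mem h1.1] at this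
    have h3 := he.ray _ (he.mk_mem_source_of_pos h1.1 hρr)
    simp only [h2] at h3
    rw [← h3, collarState, collarMap_apply (by exact h1.1) (by exact hρr)]
    rfl
  refine ⟨(hρ.1.comp_quasiMeasurePreserving hq).congr hae, ?_⟩
  filter_upwards [hae, hq.ae hρ.2] with p h1 h2
  rwa [h1] at h2

end IsBoundaryChart

theorem exists_finset_charts (hN : 1 ≤ N) (hΩ : IsOpen Ω) (hbdd : Bornology.IsBounded Ω)
    (hsm : HasSmoothBoundary Ω) :
    ∃ (n : ℕ) (e : Fin n → OpenPartialHomeomorph (BaseSpace N × ℝ) (Space N)),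
      (∀ i, ∃ B r J M, IsBoundaryChart Ω (e i) B r J M) ∧ frontier Ω ⊆ ⋃ i, (e i).target := by
  have hcomp : IsCompact (frontier Ω) :=
    Metric.isCompact_of_isClosed_isBounded isClosed_frontier
      (hbdd.closure.subset frontier_subset_closure)
  have hex : ∀ x : frontier Ω, ∃ e : OpenPartialHomeomorph (BaseSpace N × ℝ) (Space N),
      (∃ B r J M, IsBoundaryChart Ω e B r J M) ∧ x.1 ∈ e.target := by
    intro x
    obtain ⟨g, hg⟩ := hsm x.1 x.2
    obtain ⟨e, B, r, J, M, he, hxe⟩ := exists_isBoundaryChart hN hΩ x.2 hg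
    exact ⟨e, ⟨B, r, J, M, he⟩, hxe⟩
  choose e he hxe using hex
  obtain ⟨t, ht⟩ := hcomp.elim_finite_subcover (fun x : frontier Ω => (e x).target)
    (fun x => (e x).open_target) fun x hx => mem_iUnion.2 ⟨⟨x, hx⟩, hxe _⟩
  refine ⟨t.card, fun i => e (t.equivFin.symm i), fun i => he _, fun x hx => ?_⟩
  obtain ⟨i, hi, hxi⟩ := mem_iUnion₂.1 (ht hx)
  refine mem_iUnion.2 ⟨t.equivFin ⟨i, hi⟩, ?_⟩
  simpa using hxi

theorem ae_lateralMeasure_mem [IsFiniteMeasure (surfaceMeasure Ω)] :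
    ∀ᵐ p ∂(lateralMeasure T Ω), p.1 ∈ Icc 0 T ∧ p.2 ∈ frontier Ω := by
  have h1 : ∀ᵐ x ∂(surfaceMeasure Ω), x ∈ frontier Ω := ae_restrict_mem isClosed_frontier.measurableSet
  filter_upwards [Measure.quasiMeasurePreserving_fst.ae (ae_restrict_mem measurableSet_Icc),
    Measure.quasiMeasurePreserving_snd.ae h1] with p h1 h2 using ⟨h1, h2⟩

theorem lateralMeasure_restrict_iUnion [IsFiniteMeasure (surfaceMeasure Ω)] {n : ℕ}
    {e : Fin n → OpenPartialHomeomorph (BaseSpace N × ℝ) (Space N)}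
    (hcov : frontier Ω ⊆ ⋃ i, (e i).target) :
    (lateralMeasure T Ω).restrict (⋃ i, univ ×ˢ (e i).target) = lateralMeasure T Ω := by
  refine Measure.restrict_eq_self_of_ae_mem ?_
  filter_upwards [ae_lateralMeasure_mem] with p hp
  obtain ⟨i, hi⟩ := mem_iUnion.1 (hcov hp.2)
  exact mem_iUnion.2 ⟨i, trivial, hi⟩

theorem aemeasurable_outerNormal (hN : 1 ≤ N) (hΩ : IsOpen Ω) (hbdd : Bornology.IsBounded Ω)
    (hsm : HasSmoothBoundary Ω) :
    AEMeasurable (fun p : ℝ × Space N => outerNormal Ω p.2) (lateralMeasure T Ω) := by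
  have hfin := isFiniteMeasure_surfaceMeasure hN hΩ hbdd hsm
  obtain ⟨n, e, he, hcov⟩ := exists_finset_charts hN hΩ hbdd hsm
  rw [← lateralMeasure_restrict_iUnion hcov, aemeasurable_iUnion_iff]
  intro i
  obtain ⟨B, r, J, M, hi⟩ := he i
  exact hi.aemeasurable_outerNormal

theorem eventually_state (hN : 1 ≤ N) (hΩ : IsOpen Ω) (hbdd : Bornology.IsBounded Ω)
    (hsm : HasSmoothBoundary Ω)
    (hu : AEStronglyMeasurable (Function.uncurry u) (cylinderMeasure T Ω))
    (hU : ∀ᵐ p ∂(cylinderMeasure T Ω), |u p.1 p.2| ≤ U) :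
    ∀ᶠ ρ in essRightZero, AEMeasurable (fun p : ℝ × Space N => u p.1 (p.2 - ρ • outerNormal Ω p.2))
        (lateralMeasure T Ω) ∧
      ∀ᵐ p ∂(lateralMeasure T Ω), |u p.1 (p.2 - ρ • outerNormal Ω p.2)| ≤ U := by
  have hfin := isFiniteMeasure_surfaceMeasure hN hΩ hbdd hsm
  obtain ⟨n, e, he, hcov⟩ := exists_finset_charts hN hΩ hbdd hsm
  rw [← lateralMeasure_restrict_iUnion hcov]
  have h1 : ∀ᶠ ρ in essRightZero, ∀ i, AEMeasurable
      (fun p : ℝ × Space N => u p.1 (p.2 - ρ • outerNormal Ω p.2))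
        ((lateralMeasure T Ω).restrict (univ ×ˢ (e i).target)) ∧
      ∀ᵐ p ∂((lateralMeasure T Ω).restrict (univ ×ˢ (e i).target)),
        |u p.1 (p.2 - ρ • outerNormal Ω p.2)| ≤ U := by
    rw [eventually_all]
    intro i
    obtain ⟨B, r, J, M, hi⟩ := he i
    exact hi.eventually_state hu hU
  filter_upwards [h1] with ρ hρ
  refine ⟨aemeasurable_iUnion_iff.2 fun i => (hρ i).1, ?_⟩
  rw [ae_restrict_iUnion_eq]
  exact Filter.eventually_iSup.2 fun i => (hρ i).2

end StateTrace

/-! ### The discontinuous entropies and their continuous fluxes -/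

section Parts

/-- The functions `s ↦ s^±` and `sgn^±`. -/
structure IsEntropyPart (part sg : ℝ → ℝ) : Prop where
  measurable : Measurable part
  abs_le : ∀ s, |part s| ≤ |s|
  abs_sg_le : ∀ s, |sg s| ≤ 1
  exists_smooth : ∀ ε > 0, ∃ h, IsSmoothPart ε sg h ∧ ∀ s, part s = 0 → h s = 0
  exists_clamp : ∀ c : ℝ, ∃ a b : ℝ → ℝ, Continuous a ∧ Continuous b ∧
    ∀ (N : ℕ) (g : ℝ → Space N) z, sg (z - c) • (g z - g c) = g (a z) - g (b z)

/-- The jump of `sgn⁺` occurs where `g z - g c` vanishes; writing the flux with the clamped state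
`max z c` makes its continuity visible. -/
theorem sgnPlus_smul {V : Type*} [AddCommGroup V] [Module ℝ V] (g : ℝ → V) (z c : ℝ) :
    sgnPlus (z - c) • (g z - g c) = g (max z c) - g c := by
  rw [sgnPlus]
  split_ifs with h
  · rw [one_smul, max_eq_left (by linarith)]
  · rw [zero_smul, max_eq_right (by linarith), sub_self]

theorem sgnMinus_smul {V : Type*} [AddCommGroup V] [Module ℝ V] (g : ℝ → V) (z c : ℝ) :
    sgnMinus (z - c) • (g z - g c) = g c - g (min z c) := by
  rw [sgnMinus]
  split_ifs with h
  · rw [neg_one_smul, neg_sub, min_eq_left (by linarith)]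
  · rw [zero_smul, min_eq_right (by linarith), sub_self]

theorem isEntropyPart_plus : IsEntropyPart plusPart sgnPlus where
  measurable := measurable_id.max measurable_const
  abs_le s := by
    rw [plusPart]
    rcases le_total 0 s with h | h
    · rw [max_eq_left h]
    · rw [max_eq_right h, abs_zero]
      exact abs_nonneg s
  abs_sg_le s := by
    rw [sgnPlus]
    split_ifs <;> simp
  exists_smooth ε hε := by
    obtain ⟨h, hh, h0⟩ := exists_isSmoothPart_sgnPlus hε
    exact ⟨h, hh, fun s hs => h0 s (max_eq_right_iff.1 hs)⟩
  exists_clamp c := ⟨fun z => max z c, fun _ => c, by fun_prop, by fun_prop,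
    fun _ g z => sgnPlus_smul g z c⟩

theorem isEntropyPart_minus : IsEntropyPart minusPart sgnMinus where
  measurable := measurable_neg.max measurable_const
  abs_le s := by
    rw [minusPart]
    rcases le_total 0 s with h | h
    · rw [max_eq_right (by linarith), abs_zero]
      exact abs_nonneg s
    · rw [max_eq_left (by linarith), abs_neg]
  abs_sg_le s := by
    rw [sgnMinus]
    split_ifs <;> simp
  exists_smooth ε hε := by
    obtain ⟨h, hh, h0⟩ := exists_isSmoothPart_sgnMinus hε
    exact ⟨h, hh, fun s hs => h0 s (by have := max_eq_right_iff.1 hs; linarith)⟩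
  exists_clamp c := ⟨fun _ => c, fun z => min z c, by fun_prop, by fun_prop,
    fun _ g z => sgnMinus_smul g z c⟩

variable {N : ℕ} {T U : ℝ} {Ω : Set (Space N)} {f : ℝ → Space N → ℝ → Space N}
  {F : ℝ → Space N → ℝ → ℝ} {u₀ : Space N → ℝ} {ub u : ℝ → Space N → ℝ}

theorem continuousOn_comp_state {V : Type*} [TopologicalSpace V] {q : ℝ → Space N → ℝ → V}
    {S : Set (Space N)} (hq : ContinuousOn (fun p : ℝ × Space N × ℝ => q p.1 p.2.1 p.2.2)
      (Icc 0 T ×ˢ S ×ˢ univ)) {a : ℝ → ℝ} (ha : Continuous a) :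
    ContinuousOn (fun p : ℝ × Space N × ℝ => q p.1 p.2.1 (a p.2.2)) (Icc 0 T ×ˢ S ×ˢ univ) :=
  hq.comp (f := fun p : ℝ × Space N × ℝ => (p.1, p.2.1, a p.2.2)) (by fun_prop)
    fun _ hp => ⟨hp.1, hp.2.1, trivial⟩

theorem IsEntropyPart.continuousOn {part sg : ℝ → ℝ} (hp : IsEntropyPart part sg)
    (hf : IsFlux T Ω f) (c : ℝ) :
    ContinuousOn (fun p : ℝ × Space N × ℝ =>
      sg (p.2.2 - c) • (f p.1 p.2.1 p.2.2 - f p.1 p.2.1 c)) (Icc 0 T ×ˢ closure Ω ×ˢ univ) := by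
  obtain ⟨a, b, ha, hb, hab⟩ := hp.exists_clamp c
  have h1 : (fun p : ℝ × Space N × ℝ =>
      sg (p.2.2 - c) • (f p.1 p.2.1 p.2.2 - f p.1 p.2.1 c)) = fun p : ℝ × Space N × ℝ =>
      f p.1 p.2.1 (a p.2.2) - f p.1 p.2.1 (b p.2.2) :=
    funext fun p => hab N (f p.1 p.2.1) p.2.2
  rw [h1]
  exact (continuousOn_comp_state hf.contDiffOn.continuousOn ha).sub
    (continuousOn_comp_state hf.contDiffOn.continuousOn hb)

theorem exists_modulus (hbdd : Bornology.IsBounded Ω) (hf : IsFlux T Ω f) (R : ℝ) {ε : ℝ}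
    (hε : 0 < ε) : ∃ δ > 0, ∀ t ∈ Icc 0 T, ∀ x ∈ closure Ω, ∀ y z, |y| ≤ R → |z| ≤ R →
      |y - z| ≤ δ → ‖f t x y - f t x z‖ ≤ ε := by
  have hK : IsCompact (Icc 0 T ×ˢ closure Ω ×ˢ Icc (-R) R) :=
    isCompact_Icc.prod (hbdd.isCompact_closure.prod isCompact_Icc)
  obtain ⟨δ, hδ, h⟩ := Metric.uniformContinuousOn_iff.1 (hK.uniformContinuousOn_of_continuous
    (hf.contDiffOn.continuousOn.mono (prod_mono subset_rfl (prod_mono subset_rfl (subset_univ _)))))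
    ε hε
  refine ⟨δ / 2, half_pos hδ, fun t ht x hx y z hy hz hyz => ?_⟩
  have := h (t, x, y) ⟨ht, hx, abs_le.1 hy⟩ (t, x, z) ⟨ht, hx, abs_le.1 hz⟩ (by
    rw [Prod.dist_eq, Prod.dist_eq, dist_self, dist_self, Real.dist_eq]
    simp only [max_lt_iff]
    exact ⟨hδ, hδ, by linarith⟩)
  rw [dist_eq_norm] at this
  exact this.le

theorem aestronglyMeasurable_flux (hN : 1 ≤ N) (hΩ : IsOpen Ω) (hbdd : Bornology.IsBounded Ω)
    (hsm : HasSmoothBoundary Ω) {q : ℝ → Space N → ℝ → Space N}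
    (hq : ContinuousOn (fun p : ℝ × Space N × ℝ => q p.1 p.2.1 p.2.2)
      (Icc 0 T ×ˢ closure Ω ×ˢ univ)) {w γ : ℝ × Space N → ℝ}
    (hw : AEMeasurable w (lateralMeasure T Ω)) (hγ : AEStronglyMeasurable γ (lateralMeasure T Ω)) :
    AEStronglyMeasurable (fun p => inner ℝ (q p.1 p.2 (w p)) (outerNormal Ω p.2) * γ p)
      (lateralMeasure T Ω) := by
  have hfin := isFiniteMeasure_surfaceMeasure hN hΩ hbdd hsm
  have h1 : AEMeasurable (fun p => q p.1 p.2 (w p)) (lateralMeasure T Ω) := by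
    refine aemeasurable_comp_of_continuousOn hq
      (measurableSet_Icc.prod (isClosed_closure.measurableSet.prod .univ))
      (f := fun p : ℝ × Space N => (p.1, p.2, w p))
      (measurable_fst.aemeasurable.prodMk (measurable_snd.aemeasurable.prodMk hw)) ?_
    filter_upwards [ae_lateralMeasure_mem] with p hp
    exact ⟨hp.1, frontier_subset_closure hp.2, trivial⟩
  exact (h1.inner (aemeasurable_outerNormal hN hΩ hbdd hsm)).aestronglyMeasurable.mul hγ

end Parts

/-! ### The trace inequality at a fixed level -/

section Assembly

variable {N : ℕ} {T U : ℝ} {Ω : Set (Space N)} {f : ℝ → Space N → ℝ → Space N}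
  {F : ℝ → Space N → ℝ → ℝ} {u₀ : Space N → ℝ} {ub u : ℝ → Space N → ℝ}

theorem abs_inner_outerNormal_sub_le (v w ν : Space N) (hν : ‖ν‖ ≤ 1) (g : ℝ) {δ : ℝ}
    (h : ‖v - w‖ ≤ δ) : |inner ℝ v ν * g - inner ℝ w ν * g| ≤ δ * |g| := by
  rw [← sub_mul, ← inner_sub_left, abs_mul]
  refine mul_le_mul_of_nonneg_right ?_ (abs_nonneg _)
  calc |inner ℝ (v - w) ν| ≤ ‖v - w‖ * ‖ν‖ := abs_real_inner_le_norm _ _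
    _ ≤ ‖v - w‖ * 1 := mul_le_mul_of_nonneg_left hν (norm_nonneg _)
    _ ≤ δ := by rwa [mul_one]

/-- For MV-solutions the local trace result applies to the `sgn^±` flux itself. For RE-solutions it
applies to smooth entropies, whose data also vanish where `γ` lives, and the `2 * δ` bound on the
fluxes passes the result to the limit. -/
theorem IsBoundaryChart.hasNonnegTrace_part
    {e : OpenPartialHomeomorph (BaseSpace N × ℝ) (Space N)} {B : Set (BaseSpace N)} {r : ℝ}
    {J : BaseSpace N × ℝ → ℝ} {M : ℝ} (he : IsBoundaryChart Ω e B r J M)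
    (hN : 1 ≤ N) (hΩ : IsOpen Ω) (hbdd : Bornology.IsBounded Ω) (hsm : HasSmoothBoundary Ω)
    (hT : 0 < T) (hf : IsFlux T Ω f) (hF : IsSource T Ω F) {part sg : ℝ → ℝ}
    (hp : IsEntropyPart part sg)
    (hsol : IsRESolution T Ω f F u₀ ub u ∨ ∀ k φ, IsTestFunction T φ →
      SemiEntropyInequality part sg T Ω f F u₀ ub u k φ)
    (hu : AEStronglyMeasurable (Function.uncurry u) (cylinderMeasure T Ω))
    (hU : ∀ᵐ p ∂(cylinderMeasure T Ω), |u p.1 p.2| ≤ U)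
    {b : ℝ × Space N → ℝ} (hb : Measurable b) {R : ℝ} (hbR : ∀ p, |b p| ≤ R)
    (hub : Function.uncurry ub =ᵐ[lateralMeasure T Ω] b) {c : ℝ} {γ : ℝ × Space N → ℝ}
    (hγ : Integrable γ (lateralMeasure T Ω)) (hγ0 : ∀ᵐ p ∂(lateralMeasure T Ω), 0 ≤ γ p)
    (hγe : ∀ p, p.2 ∉ e.target → γ p = 0) (hγc : ∀ p, γ p ≠ 0 → part (b p - c) = 0) :
    HasNonnegTrace (lateralMeasure T Ω) (fun ρ p => u p.1 (p.2 - ρ • outerNormal Ω p.2))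
      fun p z => inner ℝ (sg (z - c) • (f p.1 p.2 z - f p.1 p.2 c)) (outerNormal Ω p.2) * γ p := by
  have hfin := isFiniteMeasure_surfaceMeasure hN hΩ hbdd hsm
  have hbc : ∀ p, |b p - c| ≤ R + |c| := fun p =>
    (abs_sub _ _).trans (add_le_add_left (hbR p) _)
  rcases hsol with hRE | hMV
  · refine HasNonnegTrace.of_approx (S := {z | |z| ≤ U}) ?_ ?_ fun ε hε => ?_
    · filter_upwards [IBVP.eventually_state hN hΩ hbdd hsm hu hU] with ρ hρ using hρ.2
    · filter_upwards [IBVP.eventually_state hN hΩ hbdd hsm hu hU] with ρ hρ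
      exact aestronglyMeasurable_flux
        (q := fun t x z => sg (z - c) • (f t x z - f t x c)) hN hΩ hbdd hsm (hp.continuousOn hf c)
        hρ.1 hγ.aestronglyMeasurable
    · set m := ∫ p, |γ p| ∂(lateralMeasure T Ω) with hm
      have hm0 : 0 ≤ m := integral_nonneg fun _ => abs_nonneg _
      set δ := ε / (2 * (m + 1)) with hδ
      have hδ0 : 0 < δ := by positivity
      -- All states between `c` and a value of `u` have modulus at most `max U |c|`.
      obtain ⟨η, hη, hmod⟩ := exists_modulus hbdd hf (max U |c|) hδ0
      obtain ⟨h, hh, h0⟩ := hp.exists_smooth η hη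
      have hpair := isBoundaryEntropyPair_smoothFlux hN hT hΩ hsm hf hh
      obtain ⟨C, hC, hineq⟩ := fluxInequality_of_entropyPair hΩ hbdd hf hF hRE hU hpair c
      have hhC : Continuous h := hh.contDiff.continuous
      obtain ⟨H, hH⟩ := (isCompact_Icc (a := -(R + |c|)) (b := R + |c|)).exists_bound_of_continuousOn
        hhC.continuousOn
      have hqc : ContinuousOn (fun p : ℝ × Space N × ℝ => smoothFlux f h p.1 p.2.1 p.2.2 c)
          (Icc 0 T ×ˢ closure Ω ×ˢ univ) :=
        hpair.contDiffOn.continuousOn.comp (f := fun p : ℝ × Space N × ℝ => (p.1, p.2.1, p.2.2, c))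
          (by fun_prop) fun p hp => ⟨hp.1, hp.2.1, trivial, trivial⟩
      have hineq' := hineq.congr (hb' := fun p => h (b p - c)) (by
        filter_upwards [hub] with p hp
        rw [← hp]
        rfl)
      refine ⟨_, fun p => 2 * δ * |γ p|, he.hasNonnegTrace
        (q := fun t x z => smoothFlux f h t x z c) hΩ hbdd hqc hu hU hC
        (hhC.measurable.comp (hb.sub_const c)) (fun p => hH _ (abs_le.1 (hbc p))) hineq' hγ hγ0 hγe
        fun p => ?_, hγ.abs.const_mul _, ?_, ?_⟩
      · by_cases hγp : γ p = 0
        · rw [hγp, mul_zero]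
        · show h (b p - c) * γ p = 0
          rw [h0 _ (hγc p hγp), zero_mul]
      · rw [integral_const_mul, ← hm, hδ]
        calc 2 * (ε / (2 * (m + 1))) * m = ε * (m / (m + 1)) := by field_simp
          _ ≤ ε * 1 := by
              refine mul_le_mul_of_nonneg_left ?_ hε.le
              rw [div_le_one (by positivity)]
              linarith
          _ = ε := mul_one ε
      · filter_upwards [ae_lateralMeasure_mem] with p hpm z hz
        refine abs_inner_outerNormal_sub_le _ _ _ (norm_outerNormal_le _ _) _ ?_
        rw [norm_sub_rev]
        have hpc := frontier_subset_closure hpm.2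
        refine hh.norm_smoothFlux_sub_le ?_ hδ0.le fun y hy hyc => ?_
        · rw [← continuousOn_univ]
          exact hf.contDiffOn.continuousOn.comp (f := fun y : ℝ => (p.1, p.2, y)) (by fun_prop)
            fun y _ => ⟨hpm.1, hpc, trivial⟩
        · refine hmod _ hpm.1 _ hpc _ _ ?_ (le_max_right _ _) hyc
          have hz : |z| ≤ U := hz
          have h1 := abs_le.1 (hz.trans (le_max_left U |c|))
          have h2 := abs_le.1 (le_max_right U |c|)
          rw [mem_uIcc] at hy
          rw [abs_le]
          rcases hy with hy | hy <;> constructor <;> linarith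
  · obtain ⟨C, hC, hineq⟩ := fluxInequality_of_semiEntropy hΩ hbdd hf hF hU hp.abs_le hp.abs_sg_le
      (hMV c)
    have hineq' := hineq.congr (hb' := fun p => part (b p - c)) (by
      filter_upwards [hub] with p hp
      rw [← hp]
      rfl)
    refine he.hasNonnegTrace (q := fun t x z => sg (z - c) • (f t x z - f t x c)) hΩ hbdd
      (hp.continuousOn hf c) hu hU hC (hp.measurable.comp (hb.sub_const c))
      (fun p => (hp.abs_le _).trans (hbc p)) hineq' hγ hγ0 hγe fun p => ?_
    by_cases hγp : γ p = 0
    · rw [hγp, mul_zero]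
    · show part (b p - c) * γ p = 0
      rw [hγc p hγp, zero_mul]

/-- As `γ` need only be integrable, no smooth partition of unity is required: `γ` is cut by
indicators of the chart ranges, one chart at a time. -/
theorem hasNonnegTrace_part (hN : 1 ≤ N) (hΩ : IsOpen Ω) (hbdd : Bornology.IsBounded Ω)
    (hsm : HasSmoothBoundary Ω) (hT : 0 < T) (hf : IsFlux T Ω f) (hF : IsSource T Ω F)
    {part sg : ℝ → ℝ} (hp : IsEntropyPart part sg)
    (hsol : IsRESolution T Ω f F u₀ ub u ∨ ∀ k φ, IsTestFunction T φ →
      SemiEntropyInequality part sg T Ω f F u₀ ub u k φ)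
    (hu : AEStronglyMeasurable (Function.uncurry u) (cylinderMeasure T Ω))
    (hU : ∀ᵐ p ∂(cylinderMeasure T Ω), |u p.1 p.2| ≤ U)
    {b : ℝ × Space N → ℝ} (hb : Measurable b) {R : ℝ} (hbR : ∀ p, |b p| ≤ R)
    (hub : Function.uncurry ub =ᵐ[lateralMeasure T Ω] b) {c : ℝ} {γ : ℝ × Space N → ℝ}
    (hγ : Integrable γ (lateralMeasure T Ω)) (hγ0 : ∀ᵐ p ∂(lateralMeasure T Ω), 0 ≤ γ p)
    (hγc : ∀ p, γ p ≠ 0 → part (b p - c) = 0) :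
    HasNonnegTrace (lateralMeasure T Ω) (fun ρ p => u p.1 (p.2 - ρ • outerNormal Ω p.2))
      fun p z => inner ℝ (sg (z - c) • (f p.1 p.2 z - f p.1 p.2 c)) (outerNormal Ω p.2) * γ p := by
  classical
  have hfin := isFiniteMeasure_surfaceMeasure hN hΩ hbdd hsm
  obtain ⟨n, e, he, hcov⟩ := exists_finset_charts hN hΩ hbdd hsm
  have hind : ∀ (s : Finset (Fin n)) (γ : ℝ × Space N → ℝ), Integrable γ (lateralMeasure T Ω) →
      (∀ᵐ p ∂(lateralMeasure T Ω), 0 ≤ γ p) → (∀ p, γ p ≠ 0 → part (b p - c) = 0) →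
      (∀ p, (∀ i ∈ s, p.2 ∉ (e i).target) → γ p = 0) →
      HasNonnegTrace (lateralMeasure T Ω) (fun ρ p => u p.1 (p.2 - ρ • outerNormal Ω p.2))
        fun p z => inner ℝ (sg (z - c) • (f p.1 p.2 z - f p.1 p.2 c)) (outerNormal Ω p.2) * γ p := by
    intro s
    induction s using Finset.induction_on with
    | empty =>
      intro γ _ _ _ hγe
      have h0 : γ = 0 := funext fun p => hγe p (by simp)
      simpa [h0] using HasNonnegTrace.zero
    | insert i s hi ih =>
      intro γ hγ hγ0 hγc hγe
      obtain ⟨B, r, J, M, hei⟩ := he i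
      set O : Set (ℝ × Space N) := univ ×ˢ (e i).target with hO
      have hOm : MeasurableSet O := MeasurableSet.univ.prod (e i).open_target.measurableSet
      have hne : ∀ (A : Set (ℝ × Space N)) p, A.indicator γ p ≠ 0 → γ p ≠ 0 := by
        intro A p h h'
        exact h (by by_cases hA : p ∈ A <;> simp [hA, h'])
      have hnn : ∀ A : Set (ℝ × Space N), ∀ᵐ p ∂(lateralMeasure T Ω), 0 ≤ A.indicator γ p := by
        intro A
        filter_upwards [hγ0] with p hp using indicator_apply_nonneg fun _ => hp
      have h1 := hei.hasNonnegTrace_part hN hΩ hbdd hsm hT hf hF hp hsol hu hU hb hbR hub (c := c)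
        (hγ.indicator hOm) (hnn O) (fun p hp => indicator_of_notMem (fun h => hp h.2) _)
        fun p hp => hγc p (hne _ _ hp)
      have h2 := ih (Oᶜ.indicator γ) (hγ.indicator hOm.compl) (hnn _)
        (fun p hp => hγc p (hne _ _ hp)) (fun p hp => by
          by_cases hpO : p ∈ O
          · exact indicator_of_notMem (not_not.2 hpO) _
          · rw [indicator_of_mem (show p ∈ Oᶜ from hpO)]
            refine hγe p fun j hj => ?_
            rcases Finset.mem_insert.1 hj with rfl | hj
            · exact fun h => hpO ⟨trivial, h⟩
            · exact hp j hj)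
      refine (h1.add h2).congr_ae (Eventually.of_forall fun p z => ?_)
      rw [← mul_add, indicator_self_add_compl_apply]
  set A : Set (ℝ × Space N) := ⋃ i, univ ×ˢ (e i).target with hA
  have hAm : MeasurableSet A :=
    MeasurableSet.iUnion fun i => MeasurableSet.univ.prod (e i).open_target.measurableSet
  refine (hind Finset.univ (A.indicator γ) (hγ.indicator hAm) ?_ ?_ ?_).congr_ae ?_
  · filter_upwards [hγ0] with p hp using indicator_apply_nonneg fun _ => hp
  · intro p h
    refine hγc p fun h' => h ?_
    by_cases hpA : p ∈ A <;> simp [hpA, h']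
  · intro p h
    refine indicator_of_notMem (fun hpA => ?_) _
    obtain ⟨i, hi⟩ := mem_iUnion.1 hpA
    exact h i (Finset.mem_univ i) hi.2
  · filter_upwards [ae_lateralMeasure_mem] with p hpm z
    obtain ⟨i, hi⟩ := mem_iUnion.1 (hcov hpm.2)
    have hpA : p ∈ A := mem_iUnion.2 ⟨i, trivial, hi⟩
    rw [indicator_of_mem hpA]

/-- The six cases collapse to a `sgn⁺` flux at level `max w k` plus a `sgn⁻` flux at level `min w
k`, here in clamped form. Nonnegativity thus reduces to the two semi-entropies, and continuity to
that of `f`, `max` and `min`. -/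
theorem boundaryFlux_eq (f : ℝ → Space N → ℝ → Space N) (t : ℝ) (x : Space N) (z w k : ℝ) :
    boundaryFlux f t x z w k = (f t x (max z (max w k)) - f t x (max w k)) +
      (f t x (min w k) - f t x (min z (min w k))) := by
  obtain ⟨h1, h2, h3, h4, h5, h6⟩ := boundaryFlux_cases f t x z w k
  rcases le_total z w with hzw | hzw <;> rcases le_total w k with hwk | hwk <;>
    rcases le_total z k with hzk | hzk
  · rw [h1 hzw hwk, max_eq_right hwk, min_eq_left hwk, max_eq_right hzk, min_eq_left hzw]
    abel
  · rw [h1 hzw hwk, max_eq_right hwk, min_eq_left hwk, max_eq_left hzk, min_eq_left hzw]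
    have : z = k := le_antisymm (hzw.trans hwk) hzk
    subst this
    abel
  · rw [h4 hzk hwk, max_eq_left hwk, min_eq_right hwk, max_eq_right hzw, min_eq_left hzk]
    abel
  · rw [h5 hzk hzw, max_eq_left hwk, min_eq_right hwk, max_eq_right hzw, min_eq_right hzk]
    abel
  · rw [h2 hzw hzk, max_eq_right hwk, min_eq_left hwk, max_eq_right hzk, min_eq_right hzw]
    abel
  · rw [h3 hwk hzk, max_eq_right hwk, min_eq_left hwk, max_eq_left hzk, min_eq_right hzw]
    abel
  · have e1 : z = k := le_antisymm hzk (hwk.trans hzw)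
    have e2 : w = z := le_antisymm hzw (e1 ▸ hwk)
    subst e2
    rw [h6 hwk hzw, ← e1]
    simp
  · rw [h6 hwk hzw, max_eq_left hwk, min_eq_right hwk, max_eq_left hzw, min_eq_right hzk]
    abel

theorem continuousOn_boundaryFlux (hf : IsFlux T Ω f) :
    ContinuousOn (fun p : ℝ × Space N × ℝ × ℝ × ℝ =>
      boundaryFlux f p.1 p.2.1 p.2.2.1 p.2.2.2.1 p.2.2.2.2) (Icc 0 T ×ˢ closure Ω ×ˢ univ) := by
  have h : ∀ a : ℝ × ℝ × ℝ → ℝ, Continuous a → ContinuousOn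
      (fun p : ℝ × Space N × ℝ × ℝ × ℝ => f p.1 p.2.1 (a p.2.2)) (Icc 0 T ×ˢ closure Ω ×ˢ univ) :=
    fun a ha => hf.contDiffOn.continuousOn.comp
      (f := fun p : ℝ × Space N × ℝ × ℝ × ℝ => (p.1, p.2.1, a p.2.2)) (by fun_prop)
      fun _ hp => ⟨hp.1, hp.2.1, trivial⟩
  simp only [boundaryFlux_eq]
  exact ((h (fun q => max q.1 (max q.2.1 q.2.2)) (by fun_prop)).sub
    (h (fun q => max q.2.1 q.2.2) (by fun_prop))).add
    ((h (fun q => min q.2.1 q.2.2) (by fun_prop)).sub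
      (h (fun q => min q.1 (min q.2.1 q.2.2)) (by fun_prop)))

end Assembly

/-! ### Levels depending on the boundary point, and the conclusion -/

theorem ae_abs_le_of_memLp_top {α : Type*} [MeasurableSpace α] {μ : Measure α} {g : α → ℝ}
    (hg : MemLp g ⊤ μ) : ∃ C, 0 ≤ C ∧ ∀ᵐ x ∂μ, |g x| ≤ C := by
  refine ⟨(eLpNorm g ⊤ μ).toReal, ENNReal.toReal_nonneg, ?_⟩
  have h1 := ae_le_eLpNormEssSup (f := g) (μ := μ)
  filter_upwards [h1] with x hx
  rw [← eLpNorm_exponent_top] at hx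
  have h2 := ENNReal.toReal_mono hg.2.ne hx
  simpa using h2

theorem norm_max_sub_le {V : Type*} [NormedAddCommGroup V] {g : ℝ → V} {R δ ε : ℝ}
    (hmod : ∀ y z, |y| ≤ R → |z| ≤ R → |y - z| ≤ δ → ‖g y - g z‖ ≤ ε) {z b c : ℝ} (hz : |z| ≤ R)
    (hb : |b| ≤ R) (hc : |c| ≤ R) (hbc : |b - c| ≤ δ) :
    ‖(g (max z b) - g b) - (g (max z c) - g c)‖ ≤ ε + ε := by
  have h1 : ‖g (max z b) - g (max z c)‖ ≤ ε := by
    refine hmod _ _ (abs_max_le_max_abs_abs.trans (max_le hz hb))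
      (abs_max_le_max_abs_abs.trans (max_le hz hc)) ?_
    rw [max_comm z b, max_comm z c]
    exact (abs_max_sub_max_le_abs _ _ _).trans hbc
  rw [sub_sub_sub_comm]
  exact (norm_sub_le _ _).trans (add_le_add h1 (hmod _ _ hb hc hbc))

theorem norm_min_sub_le {V : Type*} [NormedAddCommGroup V] {g : ℝ → V} {R δ ε : ℝ}
    (hmod : ∀ y z, |y| ≤ R → |z| ≤ R → |y - z| ≤ δ → ‖g y - g z‖ ≤ ε) {z b c : ℝ} (hz : |z| ≤ R)
    (hb : |b| ≤ R) (hc : |c| ≤ R) (hbc : |b - c| ≤ δ) :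
    ‖(g b - g (min z b)) - (g c - g (min z c))‖ ≤ ε + ε := by
  have h1 : ‖g (min z b) - g (min z c)‖ ≤ ε := by
    refine hmod _ _ (abs_min_le_max_abs_abs.trans (max_le hz hb))
      (abs_min_le_max_abs_abs.trans (max_le hz hc)) ?_
    refine (abs_min_sub_min_le_max _ _ _ _).trans (max_le ?_ hbc)
    rw [sub_self, abs_zero]
    exact (abs_nonneg _).trans hbc
  rw [sub_sub_sub_comm]
  exact (norm_sub_le _ _).trans (add_le_add (hmod _ _ hb hc hbc) h1)

theorem ceil_mem_Icc {x η R : ℝ} (hη : 0 < η) (hx : |x| ≤ R) :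
    ⌈x / η⌉ ∈ Finset.Icc (-⌈R / η⌉) ⌈R / η⌉ := by
  rw [Finset.mem_Icc]
  have h1 := abs_le.1 hx
  refine ⟨?_, Int.ceil_mono (by gcongr; exact h1.2)⟩
  have h2 : -(R / η) ≤ x / η := by rw [← neg_div]; gcongr; exact h1.1
  have h3 : (-⌈R / η⌉ : ℤ) ≤ ((⌈x / η⌉ : ℤ) : ℝ) := by
    push_cast
    linarith [Int.le_ceil (R / η), Int.le_ceil (x / η)]
  exact_mod_cast h3

/-- Rounding must go upward: a level above `max (u_b, k)` keeps `(u_b - c)⁺ = 0`. The level for the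
minus part is rounded down by applying this to the negative. -/
theorem abs_sub_mul_ceil_le {x η : ℝ} (hη : 0 < η) : x ≤ η * ⌈x / η⌉ ∧ |x - η * ⌈x / η⌉| ≤ η := by
  have h1 := Int.le_ceil (x / η)
  have h2 := (Int.ceil_lt_add_one (x / η)).le
  rw [div_le_iff₀ hη] at h1
  have h3 : η * ⌈x / η⌉ ≤ η * (x / η + 1) := mul_le_mul_of_nonneg_left h2 hη.le
  rw [mul_add, mul_div_cancel₀ _ hη.ne'] at h3
  refine ⟨by linarith, ?_⟩
  rw [abs_le]
  constructor <;> linarith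

section Main

variable {N : ℕ} {T U : ℝ} {Ω : Set (Space N)} {f : ℝ → Space N → ℝ → Space N}
  {F : ℝ → Space N → ℝ → ℝ} {u₀ : Space N → ℝ} {ub u : ℝ → Space N → ℝ}

/-- The trace inequality for an entropy part with levels `η * j` selected measurably. -/
theorem hasNonnegTrace_sum (hN : 1 ≤ N) (hΩ : IsOpen Ω) (hbdd : Bornology.IsBounded Ω)
    (hsm : HasSmoothBoundary Ω) (hT : 0 < T) (hf : IsFlux T Ω f) (hF : IsSource T Ω F)
    {part sg : ℝ → ℝ} (hp : IsEntropyPart part sg)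
    (hsol : IsRESolution T Ω f F u₀ ub u ∨ ∀ k φ, IsTestFunction T φ →
      SemiEntropyInequality part sg T Ω f F u₀ ub u k φ)
    (hu : AEStronglyMeasurable (Function.uncurry u) (cylinderMeasure T Ω))
    (hU : ∀ᵐ p ∂(cylinderMeasure T Ω), |u p.1 p.2| ≤ U)
    {b : ℝ × Space N → ℝ} (hb : Measurable b) {R : ℝ} (hbR : ∀ p, |b p| ≤ R)
    (hub : Function.uncurry ub =ᵐ[lateralMeasure T Ω] b) {β : ℝ × Space N → ℝ}
    (hβ : Integrable β (lateralMeasure T Ω)) (hβ0 : ∀ᵐ p ∂(lateralMeasure T Ω), 0 ≤ β p)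
    (s : Finset ℤ) {j : ℝ × Space N → ℤ} (hj : Measurable j) (hjs : ∀ p, j p ∈ s) (η : ℝ)
    (hjb : ∀ p, part (b p - η * j p) = 0) :
    HasNonnegTrace (lateralMeasure T Ω) (fun ρ p => u p.1 (p.2 - ρ • outerNormal Ω p.2))
      fun p z => inner ℝ (sg (z - η * j p) • (f p.1 p.2 z - f p.1 p.2 (η * j p)))
        (outerNormal Ω p.2) * β p := by
  have h1 := HasNonnegTrace.sum s fun i _ =>
    hasNonnegTrace_part hN hΩ hbdd hsm hT hf hF hp hsol hu hU hb hbR hub (c := η * i)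
      (γ := {p | j p = i}.indicator β) (hβ.indicator (hj (measurableSet_singleton i)))
      (by filter_upwards [hβ0] with p hp using indicator_apply_nonneg fun _ => hp)
      fun p hp => by
        have h2 : j p = i := by
          by_contra h
          exact hp (indicator_of_notMem (show p ∉ {p' | j p' = i} from h) β)
        rw [← h2]
        exact hjb p
  refine h1.congr_ae (Eventually.of_forall fun p z => ?_)
  rw [Finset.sum_eq_single (j p)]
  · rw [indicator_of_mem (show p ∈ {p' | j p' = j p} from rfl)]
  · intro i _ hi
    rw [indicator_of_notMem (show p ∉ {p' | j p' = i} from fun h => hi h.symm), mul_zero]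
  · exact fun h => absurd (hjs p) h

/-- Both levels in `boundaryFlux_eq` are rounded to a grid of mesh `η`, where `hasNonnegTrace_sum`
applies to each sign; the rounding error is uniform over bounded states. -/
theorem hasNonnegTrace_boundaryFlux (hN : 1 ≤ N) (hΩ : IsOpen Ω) (hbdd : Bornology.IsBounded Ω)
    (hsm : HasSmoothBoundary Ω) (hT : 0 < T) (hf : IsFlux T Ω f) (hF : IsSource T Ω F)
    (hsol : IsRESolution T Ω f F u₀ ub u ∨ IsMVSolution T Ω f F u₀ ub u)
    (hu : AEStronglyMeasurable (Function.uncurry u) (cylinderMeasure T Ω))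
    (hU : ∀ᵐ p ∂(cylinderMeasure T Ω), |u p.1 p.2| ≤ U)
    {b : ℝ × Space N → ℝ} (hb : Measurable b) {R : ℝ} (hbR : ∀ p, |b p| ≤ R)
    (hub : Function.uncurry ub =ᵐ[lateralMeasure T Ω] b) {β : ℝ × Space N → ℝ}
    (hβ : Integrable β (lateralMeasure T Ω)) (hβ0 : ∀ᵐ p ∂(lateralMeasure T Ω), 0 ≤ β p) (k : ℝ) :
    HasNonnegTrace (lateralMeasure T Ω) (fun ρ p => u p.1 (p.2 - ρ • outerNormal Ω p.2))
      fun p z => inner ℝ (boundaryFlux f p.1 p.2 z (ub p.1 p.2) k) (outerNormal Ω p.2) * β p := by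
  have hfin := isFiniteMeasure_surfaceMeasure hN hΩ hbdd hsm
  suffices h : HasNonnegTrace (lateralMeasure T Ω)
      (fun ρ p => u p.1 (p.2 - ρ • outerNormal Ω p.2))
      fun p z => inner ℝ (boundaryFlux f p.1 p.2 z (b p) k) (outerNormal Ω p.2) * β p by
    refine h.congr_ae ?_
    filter_upwards [hub] with p hp z
    rw [← hp]
    rfl
  have hplus : IsRESolution T Ω f F u₀ ub u ∨ ∀ k φ, IsTestFunction T φ →
      SemiEntropyInequality plusPart sgnPlus T Ω f F u₀ ub u k φ := hsol.imp_right fun h => h.plus_ineq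
  have hminus : IsRESolution T Ω f F u₀ ub u ∨ ∀ k φ, IsTestFunction T φ →
      SemiEntropyInequality minusPart sgnMinus T Ω f F u₀ ub u k φ :=
    hsol.imp_right fun h => h.minus_ineq
  refine HasNonnegTrace.of_approx (S := {z | |z| ≤ U}) ?_ ?_ fun ε hε => ?_
  · filter_upwards [eventually_state hN hΩ hbdd hsm hu hU] with ρ hρ using hρ.2
  · filter_upwards [eventually_state hN hΩ hbdd hsm hu hU] with ρ hρ
    have h1 : AEMeasurable (fun p : ℝ × Space N => boundaryFlux f p.1 p.2
        (u p.1 (p.2 - ρ • outerNormal Ω p.2)) (b p) k) (lateralMeasure T Ω) := by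
      refine aemeasurable_comp_of_continuousOn (continuousOn_boundaryFlux hf)
        (measurableSet_Icc.prod (isClosed_closure.measurableSet.prod .univ))
        (f := fun p : ℝ × Space N => (p.1, p.2, u p.1 (p.2 - ρ • outerNormal Ω p.2), b p, k))
        (measurable_fst.aemeasurable.prodMk (measurable_snd.aemeasurable.prodMk
          (hρ.1.prodMk (hb.aemeasurable.prodMk aemeasurable_const)))) ?_
      filter_upwards [ae_lateralMeasure_mem] with p hp
      exact ⟨hp.1, frontier_subset_closure hp.2, trivial⟩
    exact (h1.inner (aemeasurable_outerNormal hN hΩ hbdd hsm)).aestronglyMeasurable.mul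
      hβ.aestronglyMeasurable
  · set m := ∫ p, |β p| ∂(lateralMeasure T Ω) with hm
    have hm0 : 0 ≤ m := integral_nonneg fun _ => abs_nonneg _
    -- Each of the two parts contains `f` at two arguments affected by rounding, so the total error
    -- is at most `4 * δ * |β|`.
    set δ := ε / (4 * (m + 1)) with hδ
    have hδ0 : 0 < δ := by positivity
    set R₁ := max R |k| with hR₁
    -- Since `η ≤ 1`, rounding moves a level bounded by `R₁` no further than `R₁ + 1`.
    obtain ⟨η', hη', hmod'⟩ := exists_modulus hbdd hf (max U (R₁ + 1)) hδ0
    set η := min η' 1 with hη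
    have hη0 : 0 < η := lt_min hη' one_pos
    have hη1 : η ≤ 1 := min_le_right _ _
    have hmax : ∀ p, |max (b p) k| ≤ R₁ := fun p =>
      abs_max_le_max_abs_abs.trans (max_le_max_right _ (hbR p))
    have hmin : ∀ p, |-min (b p) k| ≤ R₁ := fun p => by
      rw [abs_neg]
      exact abs_min_le_max_abs_abs.trans (max_le_max_right _ (hbR p))
    set j₁ : ℝ × Space N → ℤ := fun p => ⌈max (b p) k / η⌉ with hj₁
    set j₂ : ℝ × Space N → ℤ := fun p => -⌈-min (b p) k / η⌉ with hj₂
    have hj₁m : Measurable j₁ := Int.measurable_ceil.comp ((hb.max measurable_const).div_const η)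
    have hj₂m : Measurable j₂ :=
      (Int.measurable_ceil.comp ((hb.min measurable_const).neg.div_const η)).neg
    have hc₁ := fun p => abs_sub_mul_ceil_le (x := max (b p) k) hη0
    have hc₂ := fun p => abs_sub_mul_ceil_le (x := -min (b p) k) hη0
    have hs₁ : ∀ p, j₁ p ∈ Finset.Icc (-⌈R₁ / η⌉) ⌈R₁ / η⌉ := fun p => ceil_mem_Icc hη0 (hmax p)
    have hs₂ : ∀ p, j₂ p ∈ Finset.Icc (-⌈R₁ / η⌉) ⌈R₁ / η⌉ := fun p => by
      have := Finset.mem_Icc.1 (ceil_mem_Icc hη0 (hmin p))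
      rw [Finset.mem_Icc]
      constructor <;> simp only [hj₂] <;> linarith [this.1, this.2]
    have h₁ := hasNonnegTrace_sum hN hΩ hbdd hsm hT hf hF isEntropyPart_plus hplus hu hU hb hbR hub
      hβ hβ0 _ hj₁m hs₁ η fun p => max_eq_right (by
        have := le_max_left (b p) k
        have := (hc₁ p).1
        simp only [hj₁]
        linarith)
    have h₂ := hasNonnegTrace_sum hN hΩ hbdd hsm hT hf hF isEntropyPart_minus hminus hu hU hb hbR
      hub hβ hβ0 _ hj₂m hs₂ η fun p => max_eq_right (by
        have := min_le_left (b p) k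
        have := (hc₂ p).1
        simp only [hj₂]
        push_cast
        linarith)
    refine ⟨_, fun p => 4 * δ * |β p|, h₁.add h₂, hβ.abs.const_mul _, ?_, ?_⟩
    · rw [integral_const_mul, ← hm, hδ]
      calc 4 * (ε / (4 * (m + 1))) * m = ε * (m / (m + 1)) := by field_simp
        _ ≤ ε * 1 := by
            refine mul_le_mul_of_nonneg_left ?_ hε.le
            rw [div_le_one (by positivity)]
            linarith
        _ = ε := mul_one ε
    · filter_upwards [ae_lateralMeasure_mem] with p hp z hz
      rw [← add_mul, ← inner_add_left]
      refine abs_inner_outerNormal_sub_le _ _ _ (norm_outerNormal_le _ _) _ ?_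
      rw [sgnPlus_smul, sgnMinus_smul, boundaryFlux_eq, add_sub_add_comm]
      have hmod := hmod' p.1 hp.1 p.2 (frontier_subset_closure hp.2)
      have hz : |z| ≤ max U (R₁ + 1) := le_max_of_le_left hz
      have e1 : |max (b p) k - η * j₁ p| ≤ η := (hc₁ p).2
      have e2 : |min (b p) k - η * j₂ p| ≤ η := by
        have := (hc₂ p).2
        rw [← abs_neg] at this
        refine (le_of_eq (congrArg abs ?_)).trans this
        simp only [hj₂]
        push_cast
        ring
      have hbnd : ∀ x y : ℝ, |x| ≤ R₁ → |x - y| ≤ η → |x| ≤ max U (R₁ + 1) ∧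
          |y| ≤ max U (R₁ + 1) := by
        intro x y hx hxy
        have h3 := abs_le.1 hx
        have h4 := abs_le.1 (hxy.trans hη1)
        refine ⟨le_max_of_le_right (by linarith), le_max_of_le_right (abs_le.2 ⟨?_, ?_⟩)⟩ <;>
          linarith
      have hb₁ := hbnd _ _ (hmax p) e1
      have hb₂ := hbnd _ _ (by simpa using hmin p) e2
      refine (norm_add_le _ _).trans ((add_le_add
        (norm_max_sub_le hmod hz hb₁.1 hb₁.2 (e1.trans (min_le_left _ _)))
        (norm_min_sub_le hmod hz hb₂.1 hb₂.2 (e2.trans (min_le_left _ _)))).trans ?_)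
      linarith

end Main

end IBVP

end

theorem mainTheorem6 (N : ℕ) (hN : 1 ≤ N)
    (Ω : Set (IBVP.Space N)) (hΩ_open : IsOpen Ω) (hΩ_bdd : Bornology.IsBounded Ω)
    (hΩ_smooth : IBVP.HasSmoothBoundary Ω)
    (T : ℝ) (hT : 0 < T)
    (f : ℝ → IBVP.Space N → ℝ → IBVP.Space N) (hf : IBVP.IsFlux T Ω f)
    (F : ℝ → IBVP.Space N → ℝ → ℝ) (hF : IBVP.IsSource T Ω F)
    (u₀ : IBVP.Space N → ℝ) (hu₀ : MemLp u₀ ∞ (volume.restrict Ω))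
    (ub : ℝ → IBVP.Space N → ℝ)
    (hub : MemLp (Function.uncurry ub) ∞ (IBVP.lateralMeasure T Ω))
    (u : ℝ → IBVP.Space N → ℝ)
    (hu : IBVP.IsRESolution T Ω f F u₀ ub u ∨ IBVP.IsMVSolution T Ω f F u₀ ub u) :
    ContinuousOn
      (fun p : ℝ × IBVP.Space N × ℝ × ℝ × ℝ =>
        IBVP.boundaryFlux f p.1 p.2.1 p.2.2.1 p.2.2.2.1 p.2.2.2.2)
      (Icc 0 T ×ˢ closure Ω ×ˢ univ) ∧
    ∀ (β : ℝ × IBVP.Space N → ℝ), Integrable β (IBVP.lateralMeasure T Ω) →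
      (∀ᵐ p ∂(IBVP.lateralMeasure T Ω), 0 ≤ β p) → ∀ k : ℝ,
      (∀ᶠ ρ in IBVP.essRightZero, Integrable
        (fun p : ℝ × IBVP.Space N =>
          inner ℝ (IBVP.boundaryFlux f p.1 p.2
            (u p.1 (p.2 - ρ • IBVP.outerNormal Ω p.2)) (ub p.1 p.2) k)
            (IBVP.outerNormal Ω p.2) * β p)
        (IBVP.lateralMeasure T Ω)) ∧
      ∃ ℓ : ℝ, 0 ≤ ℓ ∧
        Tendsto
          (fun ρ : ℝ => ∫ p,
            inner ℝ (IBVP.boundaryFlux f p.1 p.2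
              (u p.1 (p.2 - ρ • IBVP.outerNormal Ω p.2)) (ub p.1 p.2) k)
              (IBVP.outerNormal Ω p.2) * β p ∂(IBVP.lateralMeasure T Ω))
          IBVP.essRightZero (𝓝 ℓ) := by
  refine ⟨IBVP.continuousOn_boundaryFlux hf, fun β hβ hβ0 k => ?_⟩
  have hum : MemLp (Function.uncurry u) ⊤ (IBVP.cylinderMeasure T Ω) :=
    hu.elim (fun h => h.memLp) fun h => h.memLp
  obtain ⟨U, -, hU⟩ := IBVP.ae_abs_le_of_memLp_top hum
  obtain ⟨R, hR0, hR⟩ := IBVP.ae_abs_le_of_memLp_top hub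
  have hg := hub.aestronglyMeasurable.aemeasurable
  -- The boundary datum is replaced by a Borel representative clamped to `[-R, R]`: level sets and
  -- bounds are then available at every point, not merely almost everywhere.
  refine IBVP.hasNonnegTrace_boundaryFlux hN hΩ_open hΩ_bdd hΩ_smooth hT hf hF hu
    hum.aestronglyMeasurable hU (b := fun p => max (-R) (min (hg.mk _ p) R)) (R := R)
    (measurable_const.max (hg.measurable_mk.min measurable_const)) ?_ ?_ hβ hβ0 k
  · intro p
    rw [abs_le]
    exact ⟨le_max_left _ _, max_le (by linarith) (min_le_right _ _)⟩
  · filter_upwards [hg.ae_eq_mk, hR] with p hp hpR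
    rw [← hp]
    have := abs_le.1 hpR
    rw [min_eq_left this.2, max_eq_right this.1]
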